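/- **Setting.** Let $F$ be a perfect field with algebraic closure $\overline F$, let $H\le GL_n(\overline F)$ be a linear algebraic group defined over $F$ with identity component $H^o$, and let $H_i$ be a coset of $H^o$ in $H$. A *Cartan subgroup* of $H$ is a Zariski closed subgroup $C\le H$ which is diagonalizable (it has a faithful rational representation with diagonal image), such that $C/C^o$ is cyclic and $C$ has finite index in $N_H(C)$. It is an *$F$-Cartan subgroup associated to $H_i$* if moreover it is defined over $F$ and $C/C^o$ is generated by $C^og$ for some $g\in H_i(F)$. For such a $C$ let $X(C)$ be the group of rational characters $\chi:C\to\mathbb G_m$ over $\overline F$, and let $\phi_C:\mathrm{Gal}(\overline F/F)\to \mathrm{Aut}(X(C))$ be given by $\phi_C(\sigma)(\chi)=\chi^\sigma$, where $\chi^\sigma(d)=\sigma(\chi(\sigma^{-1}(d)))$. Let - $F_C$ be the fixed field of $\ker\phi_C$, and $F_i=\bigcap_{C'}F_{C'}$, the intersection over all $F$-Cartan subgroups $C'$ associated to $H_i$; - $\widetilde W(H_i,C)\le \mathrm{Aut}(X(C))$ be the image of the outer Weyl group $N_{H^o}(C)/C^o$, acting through conjugation on $C$; - $\Pi(H_i,C,F)\le\mathrm{Aut}(X(C))$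 be the subgroup generated by $\widetilde W(H_i,C)$ and $\phi_C(\mathrm{Gal}(\overline F/F))$; - $F_i^W$ be the fixed field of $\phi_C^{-1}(\widetilde W(H_i,C))$. For an intermediate field $F\subseteq E\subseteq\overline F$ that is finite over $F$, $\Pi(H_i,C,E)$ is defined in the same way with $E$ in place of $F$. **Lemma.** Let $C$ be an $F$-Cartan subgroup of $H$ associated to $H_i$. The field $F_i^W$ does not depend on the choice of $C$, the fields $F_C$ and $F_i^W$ are finite Galois extensions of $F$, and the following hold. 1. $\phi_C(\mathrm{Gal}(\overline F/F_i))\subseteq\widetilde W(H_i,C)$; that is, $F_i^W\subseteq F_i$, and in particular $\mathrm{Gal}(\overline F/F_i)\le\mathrm{Gal}(\overline F/F_i^W)$. 2. (a) $F_i^W\subseteq F_C$, and $\mathrm{Gal}(F_C/F_i^W)$ is isomorphic to a subgroup of $\widetilde W(H_i,C)$. (b) There are exact sequences $$1\to\widetilde W(H_i,C)\cap\phi_C(\mathrm{Gal}(\overline F/F))\to\phi_C(\mathrm{Gal}(\overline F/F))\to\mathrm{Gal}(F_i^W/F)\to1,$$ $$1\to\widetilde W(H_i,C)\to\Pi(H_i,C,F)\to\mathrm{Gal}(F_i^W/F)\to1,$$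 in which the first map is the inclusion and the second map sends $\phi_C(\sigma)$ to $\sigma|_{F_i^W}$. 3. For every finite extension $E/F$ inside $\overline F$, $\Pi(H_i,C,E)\le\Pi(H_i,C,F)$. 4. If there is a finite extension $E/F$ inside $\overline F$ such that $\phi_C:\mathrm{Gal}(\overline F/E)\to\Pi(H_i,C,E)$ is surjective, then $\phi_C:\mathrm{Gal}(\overline F/F)\to\Pi(H_i,C,F)$ is surjective. -/

import Mathlib

namespace CosetWeyl

open scoped MatrixGroups

section Zariski

/-- Index set for the coordinates on `GL n`: the entries of `g` and the entries of `g⁻¹`. -/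
abbrev Coord (n : ℕ) : Type := (Fin n × Fin n) ⊕ (Fin n × Fin n)

/-- The entries of `g` and of `g⁻¹`. Polynomials in these are exactly the regular functions on
`GL n`, because the entries of `g⁻¹` are the entries of the adjugate of `g` divided by `det g`, and
`1 / det g = det g⁻¹`. -/
def coord {K : Type*} [Field K] {n : ℕ} (g : GL (Fin n) K) : Coord n → K :=
  Sum.elim (fun ij => (g : Matrix (Fin n) (Fin n) K) ij.1 ij.2)
    (fun ij => ((g⁻¹ : GL (Fin n) K) : Matrix (Fin n) (Fin n) K) ij.1 ij.2)

/-- `S ⊆ GL n K` is the zero locus of regular functions with coefficients in `k`. For `k = K` this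
says that `S` is Zariski closed. For `K` an algebraic closure of a perfect field `k` it says that the
closed set `S` is defined over `k` (over a perfect field, `k`-closed and defined over `k` agree). -/
def DefinedOver (k : Type*) {K : Type*} [Field k] [Field K] [Algebra k K] {n : ℕ}
    (S : Set (GL (Fin n) K)) : Prop :=
  ∃ I : Set (MvPolynomial (Coord n) k), S = {g | ∀ p ∈ I, MvPolynomial.aeval (coord g) p = 0}

theorem DefinedOver.extend {k : Type*} (E : Type*) {K : Type*} [Field k] [Field E] [Field K]
    [Algebra k K] [Algebra k E] [Algebra E K] [IsScalarTower k E K] {n : ℕ}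
    {S : Set (GL (Fin n) K)} (h : DefinedOver k S) : DefinedOver E S := by
  obtain ⟨I, rfl⟩ := h
  refine ⟨MvPolynomial.map (algebraMap k E) '' I, ?_⟩
  ext g
  simp [MvPolynomial.aeval_map_algebraMap]

/-- The Zariski topology on `GL n K`: the closed sets are the zero loci of regular functions. -/
@[reducible] def zariski (K : Type*) [Field K] (n : ℕ) : TopologicalSpace (GL (Fin n) K) :=
  TopologicalSpace.ofClosed {S | DefinedOver K S}
    ⟨{1}, by ext g; simp⟩
    (by
      intro A hA
      refine ⟨{p | ∃ S ∈ A, ∀ g ∈ S, MvPolynomial.aeval (coord g) p = 0}, ?_⟩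
      ext g
      constructor
      · rintro h p ⟨S, hS, hp⟩
        exact hp g (h S hS)
      · intro h S hS
        obtain ⟨I, rfl⟩ := hA hS
        exact fun p hp => h p ⟨_, hS, fun _ hx => hx p hp⟩)
    (by
      rintro S ⟨I, rfl⟩ T ⟨J, rfl⟩
      refine ⟨{r | ∃ p ∈ I, ∃ q ∈ J, r = p * q}, ?_⟩
      ext g
      constructor
      · rintro (h | h) r ⟨p, hp, q, hq, rfl⟩
        · rw [map_mul, h p hp, zero_mul]
        · rw [map_mul, h q hq, mul_zero]
      · intro h
        by_contra hc
        rw [Set.mem_union, not_or] at hc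
        obtain ⟨hc1, hc2⟩ := hc
        obtain ⟨p, hp, hp0⟩ : ∃ p ∈ I, MvPolynomial.aeval (coord g) p ≠ 0 := by
          by_contra! hc
          exact hc1 hc
        obtain ⟨q, hq, hq0⟩ : ∃ q ∈ J, MvPolynomial.aeval (coord g) q ≠ 0 := by
          by_contra! hc
          exact hc2 hc
        have := h _ ⟨p, hp, q, hq, rfl⟩
        rw [map_mul] at this
        exact (mul_ne_zero hp0 hq0) this)

theorem isClosed_zariski_iff {K : Type*} [Field K] {n : ℕ} (S : Set (GL (Fin n) K)) :
    @IsClosed _ (zariski K n) S ↔ DefinedOver K S := by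
  rw [← @isOpen_compl_iff _ _ (zariski K n)]
  change DefinedOver K Sᶜᶜ ↔ _
  rw [compl_compl]

/-- Two-sided translation `g ↦ a * g * b` is polynomial in the coordinates. -/
theorem exists_translate {K : Type*} [Field K] {n : ℕ} (a b : GL (Fin n) K) :
    ∃ q : Coord n → MvPolynomial (Coord n) K,
      ∀ g, coord (a * g * b) = fun i => MvPolynomial.eval (coord g) (q i) := by
  refine ⟨Sum.elim
    (fun ij => ∑ l, ∑ m, MvPolynomial.C ((a : Matrix _ _ K) ij.1 m * (b : Matrix _ _ K) l ij.2)
      * MvPolynomial.X (Sum.inl (m, l)))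
    (fun ij => ∑ l, ∑ m, MvPolynomial.C (((b⁻¹ : GL (Fin n) K) : Matrix _ _ K) ij.1 m
      * ((a⁻¹ : GL (Fin n) K) : Matrix _ _ K) l ij.2) * MvPolynomial.X (Sum.inr (m, l))), ?_⟩
  intro g
  funext i
  rcases i with ⟨i, j⟩ | ⟨i, j⟩
  · simp only [coord, Sum.elim_inl, Units.val_mul, Matrix.mul_apply, map_sum, map_mul,
      MvPolynomial.eval_C, MvPolynomial.eval_X, Finset.sum_mul]
    refine Finset.sum_congr rfl fun l _ => Finset.sum_congr rfl fun m _ => by ring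
  · simp only [coord, Sum.elim_inr, _root_.mul_inv_rev, ← mul_assoc, Units.val_mul, Matrix.mul_apply,
      map_sum, map_mul, MvPolynomial.eval_C, MvPolynomial.eval_X, Finset.sum_mul]
    refine Finset.sum_congr rfl fun l _ => Finset.sum_congr rfl fun m _ => by ring

theorem continuous_translate {K : Type*} [Field K] {n : ℕ} (a b : GL (Fin n) K) :
    @Continuous _ _ (zariski K n) (zariski K n) (fun g => a * g * b) := by
  let _ := zariski K n
  rw [continuous_iff_isClosed]
  intro S hS
  rw [isClosed_zariski_iff] at hS ⊢
  obtain ⟨I, rfl⟩ := hS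
  obtain ⟨q, hq⟩ := exists_translate a b
  refine ⟨MvPolynomial.bind₁ q '' I, ?_⟩
  ext g
  simp only [Set.mem_preimage, Set.mem_ofPred_eq, Set.forall_mem_image, MvPolynomial.aeval_bind₁, hq]
  rfl

/-- The identity component `H°` of `H`, for the Zariski topology. -/
def idComp {K : Type*} [Field K] {n : ℕ} (H : Subgroup (GL (Fin n) K)) :
    Subgroup (GL (Fin n) K) :=
  letI := zariski K n
  have key : ∀ x ∈ H, x⁻¹ ∈ connectedComponentIn (H : Set (GL (Fin n) K)) 1 →
      ∀ y ∈ connectedComponentIn (H : Set (GL (Fin n) K)) 1,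
        x * y ∈ connectedComponentIn (H : Set (GL (Fin n) K)) 1 := by
    intro x hx hx' y hy
    have hc : Continuous (fun g : GL (Fin n) K => x * g * 1) := continuous_translate x 1
    have hsub := (isPreconnected_connectedComponentIn (x := (1 : GL (Fin n) K))
      (F := (H : Set (GL (Fin n) K)))).image _ hc.continuousOn
    have := hsub.subset_connectedComponentIn (F := (H : Set (GL (Fin n) K)))
      (x := 1) ⟨x⁻¹, hx', by simp⟩ (by
        rintro _ ⟨z, hz, rfl⟩
        simpa using H.mul_mem hx (connectedComponentIn_subset _ _ hz))
    exact this ⟨y, hy, by simp⟩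
  have hone : (1 : GL (Fin n) K) ∈ connectedComponentIn (H : Set (GL (Fin n) K)) 1 :=
    mem_connectedComponentIn H.one_mem
  have hinv : ∀ x ∈ connectedComponentIn (H : Set (GL (Fin n) K)) 1,
      x⁻¹ ∈ connectedComponentIn (H : Set (GL (Fin n) K)) 1 := fun x hx => by
    simpa using key x⁻¹ (H.inv_mem (connectedComponentIn_subset _ _ hx)) (by simpa using hx) 1 hone
  { carrier := connectedComponentIn (H : Set (GL (Fin n) K)) 1
    mul_mem' := fun {x y} hx hy =>
      key x (connectedComponentIn_subset _ _ hx) (hinv x hx) y hy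
    one_mem' := hone
    inv_mem' := fun {x} hx => hinv x hx }

end Zariski

section Characters

/-- A function on `C ⊆ GL n K` is regular if it is the restriction of a regular function on
`GL n`. -/
def IsRegular {K : Type*} [Field K] {n : ℕ} (C : Subgroup (GL (Fin n) K)) (f : C → K) : Prop :=
  ∃ p : MvPolynomial (Coord n) K, ∀ c : C, f c = MvPolynomial.eval (coord (c : GL (Fin n) K)) p

theorem coord_inv {K : Type*} [Field K] {n : ℕ} (g : GL (Fin n) K) :
    coord g⁻¹ = coord g ∘ Sum.swap := by
  funext i
  rcases i with i | i <;> simp [coord]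

/-- The character group `X(C)`: rational homomorphisms `C → 𝔾ₘ` (over `K`), under pointwise
multiplication. -/
def charGroup {K : Type*} [Field K] {n : ℕ} (C : Subgroup (GL (Fin n) K)) :
    Subgroup (C →* Kˣ) where
  carrier := {χ | IsRegular C fun c => (χ c : K)}
  mul_mem' := by
    rintro χ ψ ⟨p, hp⟩ ⟨q, hq⟩
    exact ⟨p * q, fun c => by simp [← hp c, ← hq c]⟩
  one_mem' := ⟨1, fun c => by simp⟩
  inv_mem' := by
    rintro χ ⟨p, hp⟩
    refine ⟨MvPolynomial.rename Sum.swap p, fun c => ?_⟩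
    have h := hp c⁻¹
    rw [MvPolynomial.eval_rename, ← coord_inv]
    simpa using h

end Characters

section Galois

/-- The action of `σ` on `GL n K`, entry by entry. -/
def galGL {k K : Type*} [Field k] [Field K] [Algebra k K] {n : ℕ} (σ : K ≃ₐ[k] K) :
    GL (Fin n) K →* GL (Fin n) K :=
  Matrix.GeneralLinearGroup.map (σ : K →+* K)

theorem coord_galGL {k K : Type*} [Field k] [Field K] [Algebra k K] {n : ℕ} (σ : K ≃ₐ[k] K)
    (g : GL (Fin n) K) : coord (galGL σ g) = fun i => σ (coord g i) := by
  funext i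
  rcases i with i | i
  · rfl
  · simp only [coord, Sum.elim_inr, ← map_inv]
    rfl

theorem galGL_mem {k K : Type*} [Field k] [Field K] [Algebra k K] {n : ℕ}
    {S : Set (GL (Fin n) K)} (hS : DefinedOver k S) (σ : K ≃ₐ[k] K) {g : GL (Fin n) K}
    (hg : g ∈ S) : galGL σ g ∈ S := by
  obtain ⟨I, rfl⟩ := hS
  intro p hp
  have := congrArg σ (hg p hp)
  rw [map_zero] at this
  rw [coord_galGL, ← this]
  exact (MvPolynomial.comp_aeval_apply _ (σ : K →ₐ[k] K) p).symm

/-- The action of `σ` on the points of a subgroup `C` defined over `k`. -/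
def galPts {k K : Type*} [Field k] [Field K] [Algebra k K] {n : ℕ}
    {C : Subgroup (GL (Fin n) K)} (hC : DefinedOver k (C : Set (GL (Fin n) K)))
    (σ : K ≃ₐ[k] K) : C →* C :=
  ((galGL σ).comp C.subtype).codRestrict C fun c => galGL_mem hC σ c.2

/-- `χ^σ (d) = σ (χ (σ⁻¹ d))`. -/
def galChar {k K : Type*} [Field k] [Field K] [Algebra k K] {n : ℕ}
    {C : Subgroup (GL (Fin n) K)} (hC : DefinedOver k (C : Set (GL (Fin n) K)))
    (σ : K ≃ₐ[k] K) (χ : charGroup C) : charGroup C :=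
  ⟨(Units.map (σ : K →* K)).comp ((χ : C →* Kˣ).comp (galPts hC σ⁻¹)), by
    obtain ⟨p, hp⟩ := χ.2
    refine ⟨MvPolynomial.map (σ : K →+* K) p, fun c => ?_⟩
    have h1 : coord (c : GL (Fin n) K)
        = fun i => (σ : K →+* K) (coord (galPts hC σ⁻¹ c : GL (Fin n) K) i) := by
      funext i
      change _ = σ (coord (galGL σ⁻¹ (c : GL (Fin n) K)) i)
      rw [coord_galGL]
      exact (σ.apply_symm_apply _).symm
    have h2 := congrArg σ (hp (galPts hC σ⁻¹ c))
    refine h2.trans ?_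
    rw [h1, MvPolynomial.eval_map]
    exact (MvPolynomial.eval₂_comp_left (σ : K →+* K) (RingHom.id K) _ p)⟩

theorem galChar_apply {k K : Type*} [Field k] [Field K] [Algebra k K] {n : ℕ}
    {C : Subgroup (GL (Fin n) K)} (hC : DefinedOver k (C : Set (GL (Fin n) K)))
    (σ : K ≃ₐ[k] K) (χ : charGroup C) (c : C) :
    (((galChar hC σ χ : C →* Kˣ) c : Kˣ) : K)
      = σ (((χ : C →* Kˣ) (galPts hC σ⁻¹ c) : Kˣ) : K) := rfl

theorem galChar_mul {k K : Type*} [Field k] [Field K] [Algebra k K] {n : ℕ}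
    {C : Subgroup (GL (Fin n) K)} (hC : DefinedOver k (C : Set (GL (Fin n) K)))
    (σ τ : K ≃ₐ[k] K) (χ : charGroup C) :
    galChar hC (σ * τ) χ = galChar hC σ (galChar hC τ χ) := by
  apply Subtype.ext
  ext c
  simp only [galChar_apply]
  rw [_root_.mul_inv_rev]
  rfl

theorem galChar_one {k K : Type*} [Field k] [Field K] [Algebra k K] {n : ℕ}
    {C : Subgroup (GL (Fin n) K)} (hC : DefinedOver k (C : Set (GL (Fin n) K)))
    (χ : charGroup C) : galChar hC (1 : K ≃ₐ[k] K) χ = χ := by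
  apply Subtype.ext
  ext c
  simp only [galChar_apply]
  rw [inv_one]
  rfl

/-- The homomorphism `φ_C : Gal(K/k) → Aut(X(C))`, `φ_C(σ)(χ) = χ^σ`. -/
def phi (k : Type*) {K : Type*} [Field k] [Field K] [Algebra k K] {n : ℕ}
    (C : Subgroup (GL (Fin n) K)) (hC : DefinedOver k (C : Set (GL (Fin n) K))) :
    (K ≃ₐ[k] K) →* MulAut (charGroup C) where
  toFun σ :=
    { toFun := galChar hC σ
      invFun := galChar hC σ⁻¹
      left_inv := fun χ => by rw [← galChar_mul, inv_mul_cancel, galChar_one]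
      right_inv := fun χ => by rw [← galChar_mul, mul_inv_cancel, galChar_one]
      map_mul' := fun χ ψ => by
        apply Subtype.ext
        ext c
        simp [galChar] }
  map_one' := by
    ext1 χ
    exact galChar_one hC χ
  map_mul' σ τ := by
    ext1 χ
    exact galChar_mul hC σ τ χ

/-- The splitting field of `C`: the fixed field of `ker φ_C`. -/
def splittingField (k : Type*) {K : Type*} [Field k] [Field K] [Algebra k K] {n : ℕ}
    (C : Subgroup (GL (Fin n) K)) (hC : DefinedOver k (C : Set (GL (Fin n) K))) :
    IntermediateField k K :=
  IntermediateField.fixedField (phi k C hC).ker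

end Galois

section Weyl

/-- The element `x` of the normalizer of `C` acts on characters by `χ ↦ (c ↦ χ (x⁻¹ c x))`. -/
def conjChar {K : Type*} [Field K] {n : ℕ} (C : Subgroup (GL (Fin n) K))
    (x : Subgroup.normalizer (C : Set (GL (Fin n) K))) (χ : charGroup C) : charGroup C :=
  ⟨(χ : C →* Kˣ).comp (C.normalizerMonoidHom x⁻¹).toMonoidHom, by
    obtain ⟨p, hp⟩ := χ.2
    obtain ⟨q, hq⟩ := exists_translate (x : GL (Fin n) K)⁻¹ (x : GL (Fin n) K)
    refine ⟨MvPolynomial.bind₁ q p, fun c => ?_⟩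
    refine (hp (C.normalizerMonoidHom x⁻¹ c)).trans ?_
    have h1 : ((C.normalizerMonoidHom x⁻¹ c : C) : GL (Fin n) K)
        = (x : GL (Fin n) K)⁻¹ * c * x := by
      change (x : GL (Fin n) K)⁻¹ * c * ((x : GL (Fin n) K)⁻¹)⁻¹ = _
      rw [inv_inv]
    rw [h1, hq, ← MvPolynomial.aeval_eq_eval, ← MvPolynomial.aeval_eq_eval]
    exact (MvPolynomial.aeval_bind₁ _ _ _).symm⟩

theorem conjChar_mul {K : Type*} [Field K] {n : ℕ} (C : Subgroup (GL (Fin n) K))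
    (x y : Subgroup.normalizer (C : Set (GL (Fin n) K))) (χ : charGroup C) :
    conjChar C (x * y) χ = conjChar C x (conjChar C y χ) := by
  apply Subtype.ext
  ext c
  simp [conjChar]

theorem conjChar_one {K : Type*} [Field K] {n : ℕ} (C : Subgroup (GL (Fin n) K))
    (χ : charGroup C) : conjChar C 1 χ = χ := by
  apply Subtype.ext
  ext c
  simp [conjChar]

/-- The homomorphism from the normalizer of `C` to `Aut(X(C))`. -/
def conjAct {K : Type*} [Field K] {n : ℕ} (C : Subgroup (GL (Fin n) K)) :
    Subgroup.normalizer (C : Set (GL (Fin n) K)) →* MulAut (charGroup C) where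
  toFun x :=
    { toFun := conjChar C x
      invFun := conjChar C x⁻¹
      left_inv := fun χ => by rw [← conjChar_mul, inv_mul_cancel, conjChar_one]
      right_inv := fun χ => by rw [← conjChar_mul, mul_inv_cancel, conjChar_one]
      map_mul' := fun χ ψ => by
        apply Subtype.ext
        ext c
        simp [conjChar] }
  map_one' := by
    ext1 χ
    exact conjChar_one C χ
  map_mul' x y := by
    ext1 χ
    exact conjChar_mul C x y χ

/-- `W̃(Hᵢ, C)`: the image in `Aut(X(C))` of the outer Weyl group `N_{H°}(C) / C°`. As `C` is
commutative, `C°` acts trivially on `X(C)`, so this is the image of `N_{H°}(C)`. (It does not matter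
whether `w` acts by `χ ∘ w` or by `χ ∘ w⁻¹`: the image is the same.) -/
def weyl {K : Type*} [Field K] {n : ℕ} (H C : Subgroup (GL (Fin n) K)) :
    Subgroup (MulAut (charGroup C)) :=
  ((idComp H).subgroupOf (Subgroup.normalizer (C : Set (GL (Fin n) K)))).map (conjAct C)

/-- `Π(Hᵢ, C, k)`: the subgroup of `Aut(X(C))` generated by `W̃(Hᵢ, C)` and the image of `φ_C`. -/
def PiGroup (k : Type*) {K : Type*} [Field k] [Field K] [Algebra k K] {n : ℕ}
    (H C : Subgroup (GL (Fin n) K)) (hC : DefinedOver k (C : Set (GL (Fin n) K))) :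
    Subgroup (MulAut (charGroup C)) :=
  weyl H C ⊔ (phi k C hC).range

/-- `φ_C`, regarded as a homomorphism `Gal(K/k) → Π(Hᵢ, C, k)`. -/
def phiPi (k : Type*) {K : Type*} [Field k] [Field K] [Algebra k K] {n : ℕ}
    (H C : Subgroup (GL (Fin n) K)) (hC : DefinedOver k (C : Set (GL (Fin n) K))) :
    (K ≃ₐ[k] K) →* PiGroup k H C hC :=
  (phi k C hC).codRestrict (PiGroup k H C hC) fun σ => le_sup_right (a := weyl H C) ⟨σ, rfl⟩

/-- The field `kᵢ^W`: the fixed field of `φ_C⁻¹(W̃(Hᵢ, C))`. -/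
def weylField (k : Type*) {K : Type*} [Field k] [Field K] [Algebra k K] {n : ℕ}
    (H C : Subgroup (GL (Fin n) K)) (hC : DefinedOver k (C : Set (GL (Fin n) K))) :
    IntermediateField k K :=
  IntermediateField.fixedField ((weyl H C).comap (phi k C hC))

end Weyl

section Cartan

/-- There is a faithful rational representation of `C` whose image consists of diagonal matrices. -/
def IsDiagonalizable {K : Type*} [Field K] {n : ℕ} (C : Subgroup (GL (Fin n) K)) : Prop :=
  ∃ (m : ℕ) (ρ : C →* GL (Fin m) K),
    (∀ i j, IsRegular C fun c => (ρ c : Matrix (Fin m) (Fin m) K) i j) ∧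
    Function.Injective ρ ∧ ∀ c, (ρ c : Matrix (Fin m) (Fin m) K).IsDiag

/-- `g ∈ C`, and the coset `C° g` generates `C / C°`. -/
def GeneratesComponents {K : Type*} [Field K] {n : ℕ} (C : Subgroup (GL (Fin n) K))
    (g : GL (Fin n) K) : Prop :=
  g ∈ C ∧ ∀ c ∈ C, ∃ m : ℤ, c * (g ^ m)⁻¹ ∈ idComp C

/-- Cartan subgroups of a (not necessarily connected) linear algebraic group `H`. -/
structure IsCartan {K : Type*} [Field K] {n : ℕ} (H C : Subgroup (GL (Fin n) K)) : Prop where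
  le : C ≤ H
  closed : DefinedOver K (C : Set (GL (Fin n) K))
  diagonalizable : IsDiagonalizable C
  cyclic : ∃ g, GeneratesComponents C g
  finite_index : C.relIndex (Subgroup.normalizer (C : Set (GL (Fin n) K)) ⊓ H) ≠ 0

/-- `Hi` is a coset of `H°` in `H`. -/
def IsComponent {K : Type*} [Field K] {n : ℕ} (H : Subgroup (GL (Fin n) K))
    (Hi : Set (GL (Fin n) K)) : Prop :=
  ∃ h ∈ H, Hi = {x | h⁻¹ * x ∈ idComp H}

/-- `C` is a `k`-Cartan subgroup of `H` associated to the coset `Hi`: it is a Cartan subgroup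
defined over `k`, and `C / C°` is generated by `C° g` for some `g ∈ Hi(k)`. -/
structure IsCartanOver (k : Type*) {K : Type*} [Field k] [Field K] [Algebra k K] {n : ℕ}
    (H : Subgroup (GL (Fin n) K)) (Hi : Set (GL (Fin n) K)) (C : Subgroup (GL (Fin n) K)) :
    Prop where
  isCartan : IsCartan H C
  definedOver : DefinedOver k (C : Set (GL (Fin n) K))
  generator : ∃ g : GL (Fin n) k,
    Matrix.GeneralLinearGroup.map (algebraMap k K) g ∈ Hi ∧
    GeneratesComponents C (Matrix.GeneralLinearGroup.map (algebraMap k K) g)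

/-- The splitting field `kᵢ` of the coset `Hi`: the intersection of the splitting fields of all
`k`-Cartan subgroups associated to `Hi`. -/
def cosetSplittingField (k : Type*) {K : Type*} [Field k] [Field K] [Algebra k K] {n : ℕ}
    (H : Subgroup (GL (Fin n) K)) (Hi : Set (GL (Fin n) K)) : IntermediateField k K :=
  ⨅ C : {C : Subgroup (GL (Fin n) K) // IsCartanOver k H Hi C},
    splittingField k C.1 C.2.definedOver

end Cartan

end CosetWeyl

/-! The heart of the matter is that two Cartan subgroups `C`, `C'` associated to the same coset are
conjugate under `H°` (`IsCartan.exists_conj`). Let `g` generate `C` modulo `C°` and map `H° × C°` to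
`gH°` by `(h, s) ↦ h(gs)h⁻¹`. Once `C` is diagonalized, the `s` for which everything commuting with
`gs` commutes with all of `C` fill at least a nonempty open part of `C°` (`exists_regular`). In the
fibre over such a `gs`, the first coordinate lies in `N_H(C)`, where `C°` has finite index, and it
determines the second; so the fibre has dimension at most `dim C°` (`IsCartan.zdim_fibre_le`). The
fibre dimension inequality then makes the image dense in `gH°`, and Chevalley's theorem puts a
nonempty open set of conjugates of regular elements inside it. The open sets of `C` and `C'` meet
because the coset is irreducible. A common point gives `t ∈ H°` carrying a regular element of `C` to
one of `C'`, and hence `C` to `C'`.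

If `tCt⁻¹ = C'` then also `σ(t)Cσ(t)⁻¹ = C'`. When `σ` acts on `X(C)` as `x ∈ N_{H°}(C)` does, it
acts on `X(C')` as `σ(t)xt⁻¹` does (`comap_weyl_le_of_conj`). So `φ_C⁻¹(W̃)`, and with it `F_i^W`,
depends only on the coset; being contained in every `F_{C'}`, this field lies in their intersection
`F_i`.

For finiteness, diagonalizability is given by some abstract representation and has to be moved to
the given matrices: Jordan decomposition shows that a closed diagonalizable `C` consists of
semisimple matrices, so `C` is conjugate to a diagonal group. Independence of characters shows that
the diagonal entries generate `X(C)`. They are finitely many polynomials, and their coefficients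
generate a finite extension `E` with `Gal(K/E) ≤ ker φ_C`. Thus `ker φ_C` and `φ_C⁻¹(W̃)` are open;
both are normal, since Galois normalizes `W̃`. The Galois correspondence and the isomorphism
theorems give the rest. -/

namespace CosetWeyl

open MvPolynomial TopologicalSpace

/-! ### Affine charts and the Nullstellensatz dictionary between closed sets and ideals -/

section Charts

variable {K : Type*} [Field K] {σ τ M N : Type*}

/-- `κ` identifies `M`, with its topology, with a Zariski closed subset of affine space. -/
structure IsAffineChart [TopologicalSpace M] (κ : M → σ → K) : Prop where
  injective : Function.Injective κ
  isClosed_iff : ∀ S : Set M, IsClosed S ↔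
    ∃ I : Set (MvPolynomial σ K), S = {m | ∀ p ∈ I, eval (κ m) p = 0}
  range : ∃ I : Set (MvPolynomial σ K), Set.range κ = {x | ∀ p ∈ I, eval x p = 0}

/-- A map which is polynomial in the given coordinates. -/
def IsRegularMap (κ : M → σ → K) (μ : N → τ → K) (φ : M → N) : Prop :=
  ∃ q : τ → MvPolynomial σ K, ∀ m, μ (φ m) = fun i => eval (κ m) (q i)

/-- The ideal of polynomials vanishing on a subset of a chart. -/
def vanIdeal (κ : M → σ → K) (T : Set M) : Ideal (MvPolynomial σ K) where
  carrier := {p | ∀ m ∈ T, eval (κ m) p = 0}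
  add_mem' := fun hp hq m hm => by rw [map_add, hp m hm, hq m hm, add_zero]
  zero_mem' := fun m _ => map_zero _
  smul_mem' := fun a p hp m hm => by rw [smul_eq_mul, map_mul, hp m hm, mul_zero]

/-- The zero locus of an ideal in a chart. -/
def locus (κ : M → σ → K) (P : Ideal (MvPolynomial σ K)) : Set M :=
  {m | ∀ p ∈ P, eval (κ m) p = 0}

theorem mem_vanIdeal {κ : M → σ → K} {T : Set M} {p : MvPolynomial σ K} :
    p ∈ vanIdeal κ T ↔ ∀ m ∈ T, eval (κ m) p = 0 := Iff.rfl

theorem mem_locus {κ : M → σ → K} {P : Ideal (MvPolynomial σ K)} {m : M} :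
    m ∈ locus κ P ↔ ∀ p ∈ P, eval (κ m) p = 0 := Iff.rfl

theorem vanIdeal_anti {κ : M → σ → K} {S T : Set M} (h : S ⊆ T) :
    vanIdeal κ T ≤ vanIdeal κ S := fun _ hp m hm => hp m (h hm)

theorem locus_anti {κ : M → σ → K} {P Q : Ideal (MvPolynomial σ K)} (h : P ≤ Q) :
    locus κ Q ⊆ locus κ P := fun _ hm p hp => hm p (h hp)

theorem IsRegularMap.eval_bind₁ {κ : M → σ → K} {μ : N → τ → K} {φ : M → N}
    {q : τ → MvPolynomial σ K} (hq : ∀ m, μ (φ m) = fun i => eval (κ m) (q i)) (m : M)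
    (p : MvPolynomial τ K) : eval (κ m) (bind₁ q p) = eval (μ (φ m)) p := by
  rw [hq, ← aeval_eq_eval, ← aeval_eq_eval, aeval_bind₁]

variable [TopologicalSpace M] [TopologicalSpace N]

theorem IsAffineChart.isClosed_locus {κ : M → σ → K} (hκ : IsAffineChart κ)
    (P : Ideal (MvPolynomial σ K)) : IsClosed (locus κ P) :=
  (hκ.isClosed_iff _).2 ⟨P, rfl⟩

theorem IsAffineChart.locus_vanIdeal {κ : M → σ → K} (hκ : IsAffineChart κ) {T : Set M}
    (hT : IsClosed T) : locus κ (vanIdeal κ T) = T := by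
  obtain ⟨I, hI⟩ := (hκ.isClosed_iff T).1 hT
  refine Set.Subset.antisymm (fun m hm => ?_) fun m hm p hp => hp m hm
  rw [hI]
  refine fun p hp => hm p fun m' hm' => ?_
  rw [hI] at hm'
  exact hm' p hp

theorem IsAffineChart.vanIdeal_closure {κ : M → σ → K} (hκ : IsAffineChart κ) (T : Set M) :
    vanIdeal κ (closure T) = vanIdeal κ T := by
  refine le_antisymm (vanIdeal_anti subset_closure) fun p hp m hm => ?_
  have : closure T ⊆ locus κ (vanIdeal κ T) :=
    closure_minimal (fun m hm p hp => hp m hm) (hκ.isClosed_locus _)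
  exact this hm p hp

theorem IsAffineChart.isPrime_vanIdeal {κ : M → σ → K} (hκ : IsAffineChart κ) {T : Set M}
    (hT : IsIrreducible T) : (vanIdeal κ T).IsPrime := by
  refine ⟨fun h => ?_, fun {p q} hpq => ?_⟩
  · obtain ⟨m, hm⟩ := hT.1
    have : (1 : MvPolynomial σ K) ∈ vanIdeal κ T := h ▸ Submodule.mem_top
    simpa using this m hm
  · have := isPreirreducible_iff_isClosed_union_isClosed.1 hT.2
      (locus κ (Ideal.span {p})) (locus κ (Ideal.span {q})) (hκ.isClosed_locus _)
      (hκ.isClosed_locus _) (fun m hm => by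
        have h := hpq m hm
        rw [map_mul, mul_eq_zero] at h
        refine h.imp (fun h r hr => ?_) fun h r hr => ?_ <;>
        · obtain ⟨s, rfl⟩ := Ideal.mem_span_singleton'.1 hr
          rw [map_mul, h, mul_zero])
    exact this.imp (fun h m hm => h hm p (Ideal.mem_span_singleton_self p))
      fun h m hm => h hm q (Ideal.mem_span_singleton_self q)

/-- The Nullstellensatz in affine space, restricted to the chart: `P` contains the equations of the
closed set `Set.range κ`, so every zero of `P` in affine space is already a point of `M`. -/
theorem IsAffineChart.vanIdeal_locus [IsAlgClosed K] [Finite σ] {κ : M → σ → K}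
    (hκ : IsAffineChart κ) {P : Ideal (MvPolynomial σ K)} (hP : P.IsPrime)
    (h : vanIdeal κ Set.univ ≤ P) : vanIdeal κ (locus κ P) = P := by
  refine le_antisymm (fun p hp => ?_) fun p hp m hm => hm p hp
  rw [← IsPrime.vanishingIdeal_zeroLocus (K := K) P, mem_vanishingIdeal_iff]
  intro x hx
  obtain ⟨I, hI⟩ := hκ.range
  have hx' : x ∈ Set.range κ := by
    rw [hI]
    intro q hq
    have hq' : q ∈ vanIdeal κ Set.univ := fun m _ => by
      have : κ m ∈ Set.range κ := ⟨m, rfl⟩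
      rw [hI] at this
      exact this q hq
    exact hx q (h hq')
  obtain ⟨m, rfl⟩ := hx'
  exact hp m fun q hq => hx q hq

theorem IsAffineChart.isIrreducible_locus [IsAlgClosed K] [Finite σ] {κ : M → σ → K}
    (hκ : IsAffineChart κ) {P : Ideal (MvPolynomial σ K)} (hP : P.IsPrime)
    (h : vanIdeal κ Set.univ ≤ P) : IsIrreducible (locus κ P) := by
  have hv := hκ.vanIdeal_locus hP h
  refine ⟨?_, isPreirreducible_iff_isClosed_union_isClosed.2 fun Z₁ Z₂ h₁ h₂ hZ => ?_⟩
  · rw [Set.nonempty_iff_ne_empty]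
    intro he
    apply hP.ne_top
    rw [← hv, he, eq_top_iff]
    exact fun p _ m hm => hm.elim
  · by_contra! hc
    obtain ⟨⟨m₁, hm₁, hn₁⟩, m₂, hm₂, hn₂⟩ := hc.imp Set.not_subset.1 Set.not_subset.1
    rw [← hκ.locus_vanIdeal h₁, mem_locus] at hn₁
    rw [← hκ.locus_vanIdeal h₂, mem_locus] at hn₂
    push Not at hn₁ hn₂
    obtain ⟨p₁, hp₁, hne₁⟩ := hn₁
    obtain ⟨p₂, hp₂, hne₂⟩ := hn₂
    have : p₁ * p₂ ∈ vanIdeal κ (locus κ P) := fun m hm => by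
      rw [map_mul]
      rcases hZ hm with h | h
      · rw [hp₁ m h, zero_mul]
      · rw [hp₂ m h, mul_zero]
    rw [hv] at this
    rcases hP.mem_or_mem this with h | h
    · exact hne₁ (hm₁ p₁ h)
    · exact hne₂ (hm₂ p₂ h)

/-- Sending a point to its maximal ideal induces the topology of `M` from the prime spectrum of a
polynomial ring in finitely many variables, which is Noetherian. -/
theorem IsAffineChart.noetherianSpace [Finite σ] {κ : M → σ → K}
    (hκ : IsAffineChart κ) : NoetherianSpace M := by
  have : Topology.IsInducing fun m => pointToPoint (k := K) (κ m) := by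
    rw [Topology.isInducing_iff]
    refine TopologicalSpace.ext_isClosed fun S => ?_
    rw [hκ.isClosed_iff, isClosed_induced_iff]
    constructor
    · rintro ⟨I, rfl⟩
      refine ⟨PrimeSpectrum.zeroLocus I, PrimeSpectrum.isClosed_zeroLocus _, ?_⟩
      ext m
      simp only [Set.mem_preimage, PrimeSpectrum.mem_zeroLocus, Set.subset_def, Set.mem_ofPred_eq]
      refine forall₂_congr fun p _ => ?_
      change p ∈ vanishingIdeal K {κ m} ↔ _
      rw [mem_vanishingIdeal_singleton_iff]
      rfl
    · rintro ⟨Z, hZ, rfl⟩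
      obtain ⟨I, rfl⟩ := (PrimeSpectrum.isClosed_iff_zeroLocus _).1 hZ
      refine ⟨I, ?_⟩
      ext m
      simp only [Set.mem_preimage, PrimeSpectrum.mem_zeroLocus, Set.subset_def, Set.mem_ofPred_eq]
      refine forall₂_congr fun p _ => ?_
      change p ∈ vanishingIdeal K {κ m} ↔ _
      rw [mem_vanishingIdeal_singleton_iff]
      rfl
  exact this.noetherianSpace

theorem IsRegularMap.continuous {κ : M → σ → K} {μ : N → τ → K} {φ : M → N}
    (hκ : IsAffineChart κ) (hμ : IsAffineChart μ) (hφ : IsRegularMap κ μ φ) : Continuous φ := by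
  obtain ⟨q, hq⟩ := hφ
  refine continuous_iff_isClosed.2 fun S hS => ?_
  obtain ⟨I, rfl⟩ := (hμ.isClosed_iff S).1 hS
  refine (hκ.isClosed_iff _).2 ⟨bind₁ q '' I, ?_⟩
  ext m
  simp [IsRegularMap.eval_bind₁ hq]

end Charts

/-! ### Krull dimension of subsets compared with dimension and height in rings -/

section Dimension

/-- The Krull dimension of a subset: the supremum of the lengths of the chains of irreducible closed
sets contained in it. -/
noncomputable def zdim {M : Type*} [TopologicalSpace M] (F : Set M) : WithBot ℕ∞ :=
  Order.krullDim {T : IrreducibleCloseds M // (T : Set M) ⊆ F}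

/-- The Krull dimension of a subset at a point. -/
noncomputable def zdimAt {M : Type*} [TopologicalSpace M] (x : M) (F : Set M) : WithBot ℕ∞ :=
  Order.krullDim {T : IrreducibleCloseds M // x ∈ (T : Set M) ∧ (T : Set M) ⊆ F}

variable {K : Type*} [Field K] {σ τ M N : Type*} [TopologicalSpace M] [TopologicalSpace N]

theorem IsAffineChart.vanIdeal_strictAnti {κ : M → σ → K} (hκ : IsAffineChart κ)
    {S T : IrreducibleCloseds M} (h : S < T) : vanIdeal κ (T : Set M) < vanIdeal κ (S : Set M) := by
  refine lt_of_le_of_ne (vanIdeal_anti h.le) fun he => h.ne ?_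
  apply SetLike.coe_injective
  rw [← hκ.locus_vanIdeal S.isClosed, ← hκ.locus_vanIdeal T.isClosed, he]

/-- Finiteness is what later allows `dim C°` to be cancelled from an inequality of dimensions. -/
theorem IsAffineChart.zdim_lt_top [Finite σ] {κ : M → σ → K} (hκ : IsAffineChart κ) (F : Set M) :
    zdim F < ⊤ := by
  have h : zdim F ≤ ringKrullDim (MvPolynomial σ K) := by
    rw [zdim, ← Order.krullDim_orderDual]
    refine Order.krullDim_le_of_strictMono
      (fun T => ⟨vanIdeal κ ((OrderDual.ofDual T).1 : Set M),
        hκ.isPrime_vanIdeal (OrderDual.ofDual T).1.isIrreducible⟩) fun S T hST => ?_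
    exact hκ.vanIdeal_strictAnti (OrderDual.ofDual_lt_ofDual.2 hST)
  refine h.trans_lt ?_
  rw [MvPolynomial.ringKrullDim_of_isNoetherianRing, ringKrullDim_eq_zero_of_field, zero_add]
  exact WithBot.coe_lt_coe.2 (ENat.natCast_lt_top _)

/-- Primes of `A` pull back to primes containing `ker π`, whose loci are irreducible and, by the
Nullstellensatz, distinct. `A` may be non-reduced, so this applies to scheme-theoretic fibres. -/
theorem IsAffineChart.ringKrullDim_le_zdim [IsAlgClosed K] [Finite σ] {κ : M → σ → K}
    (hκ : IsAffineChart κ) {A : Type*} [CommRing A] (π : MvPolynomial σ K →+* A)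
    (hπ : Function.Surjective π) (h : vanIdeal κ Set.univ ≤ RingHom.ker π) {F : Set M}
    (hF : locus κ (RingHom.ker π) ⊆ F) : ringKrullDim A ≤ zdim F := by
  have hle : ∀ Q : PrimeSpectrum A, RingHom.ker π ≤ Q.asIdeal.comap π := fun Q =>
    Ideal.comap_mono bot_le
  rw [zdim, ← Order.krullDim_orderDual (α := {T : IrreducibleCloseds M // (T : Set M) ⊆ F})]
  have hv := fun Q : PrimeSpectrum A => hκ.vanIdeal_locus (Q.2.comap π) (h.trans (hle Q))
  refine Order.krullDim_le_of_strictMono (fun Q => OrderDual.toDual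
    ⟨⟨locus κ (Q.asIdeal.comap π), hκ.isIrreducible_locus (Q.2.comap π) (h.trans (hle Q)),
      hκ.isClosed_locus _⟩, (locus_anti (hle Q)).trans hF⟩) fun P Q hPQ => ?_
  refine lt_of_le_of_ne ?_ fun he => hPQ.ne ?_
  · exact locus_anti (Ideal.comap_mono hPQ.le)
  · have h1 : locus κ (P.asIdeal.comap π) = locus κ (Q.asIdeal.comap π) :=
      congrArg (fun T => (((OrderDual.ofDual T).1 : IrreducibleCloseds M) : Set M)) he
    have h2 := hv P
    rw [h1, hv Q] at h2
    exact PrimeSpectrum.ext (Ideal.comap_injective_of_surjective π hπ h2.symm)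

/-- Irreducible closed sets in `X` through `x` correspond, with order reversed, to primes of the
coordinate ring of `X` below the ideal of `x`; a chain of them is therefore counted by a height. -/
theorem IsAffineChart.zdimAt_le_height [Finite σ] {κ : M → σ → K}
    (hκ : IsAffineChart κ) {X : Set M} (x : M)
    (P : PrimeSpectrum (MvPolynomial σ K ⧸ vanIdeal κ X))
    (hP : (vanIdeal κ {x}).map (Ideal.Quotient.mk (vanIdeal κ X)) ≤ P.asIdeal) :
    zdimAt x X ≤ P.asIdeal.height := by
  rw [PrimeSpectrum.height_eq_orderHeight, Order.height_eq_krullDim_Iic, zdimAt,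
    ← Order.krullDim_orderDual
      (α := {T : IrreducibleCloseds M // x ∈ (T : Set M) ∧ (T : Set M) ⊆ X})]
  have hk : ∀ T : {T : IrreducibleCloseds M // x ∈ (T : Set M) ∧ (T : Set M) ⊆ X},
      RingHom.ker (Ideal.Quotient.mk (vanIdeal κ X)) ≤ vanIdeal κ (T.1 : Set M) := fun T => by
    rw [Ideal.mk_ker]
    exact vanIdeal_anti T.2.2
  have hcm : ∀ T : {T : IrreducibleCloseds M // x ∈ (T : Set M) ∧ (T : Set M) ⊆ X},
      ((vanIdeal κ (T.1 : Set M)).map (Ideal.Quotient.mk (vanIdeal κ X))).comap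
        (Ideal.Quotient.mk (vanIdeal κ X)) = vanIdeal κ (T.1 : Set M) := fun T => by
    rw [Ideal.comap_map_of_surjective _ Ideal.Quotient.mk_surjective]
    exact sup_eq_left.2 (hk T)
  refine Order.krullDim_le_of_strictMono
    (fun T => ⟨⟨(vanIdeal κ ((OrderDual.ofDual T).1 : Set M)).map
      (Ideal.Quotient.mk (vanIdeal κ X)), ?_⟩, ?_⟩) ?_
  · have := hκ.isPrime_vanIdeal (OrderDual.ofDual T).1.isIrreducible
    exact Ideal.map_isPrime_of_surjective Ideal.Quotient.mk_surjective (hk (OrderDual.ofDual T))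
  · exact (Ideal.map_mono (vanIdeal_anti
      (Set.singleton_subset_iff.2 (OrderDual.ofDual T).2.1))).trans hP
  · intro S T hST
    have hlt := hκ.vanIdeal_strictAnti (OrderDual.ofDual_lt_ofDual.2 hST)
    refine lt_of_le_of_ne ?_ fun he => hlt.ne ?_
    · exact Ideal.map_mono hlt.le
    · have h1 := congrArg (fun Q => PrimeSpectrum.asIdeal (Subtype.val Q)) he
      have h2 := congrArg (Ideal.comap (Ideal.Quotient.mk (vanIdeal κ X))) h1
      exact (hcm (OrderDual.ofDual S)).symm.trans (h2.trans (hcm (OrderDual.ofDual T)))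

end Dimension

end CosetWeyl

namespace CosetWeyl

open MvPolynomial TopologicalSpace

/-! ### Fibre dimension and Chevalley's theorem for regular maps -/

section Fibres

variable {K : Type*} [Field K] {σ τ M N : Type*} [TopologicalSpace N]

theorem vanIdeal_image {κ : M → σ → K} {μ : N → τ → K} {φ : M → N} (hμ : IsAffineChart μ)
    {q : τ → MvPolynomial σ K} (hq : ∀ m, μ (φ m) = fun i => eval (κ m) (q i)) (X : Set M) :
    vanIdeal μ (closure (φ '' X)) = (vanIdeal κ X).comap (bind₁ q : _ →ₐ[K] _).toRingHom := by
  rw [hμ.vanIdeal_closure]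
  ext p
  simp only [mem_vanIdeal, Set.forall_mem_image, Ideal.mem_comap, AlgHom.toRingHom_eq_coe,
    RingHom.coe_coe, IsRegularMap.eval_bind₁ hq]

variable [IsAlgClosed K] [Finite σ] [Finite τ] [TopologicalSpace M]

/-- The fibre dimension inequality. -/
theorem IsRegularMap.zdimAt_le {κ : M → σ → K} {μ : N → τ → K} {φ : M → N}
    (hκ : IsAffineChart κ) (hμ : IsAffineChart μ) (hφ : IsRegularMap κ μ φ) {X : Set M}
    (hX : IsClosed X) {x : M} (hx : x ∈ X) :
    zdimAt x X ≤ zdim (closure (φ '' X)) + zdim (X ∩ φ ⁻¹' {φ x}) := by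
  obtain ⟨q, hq⟩ := hφ
  let f : MvPolynomial τ K →+* MvPolynomial σ K := (bind₁ q : _ →ₐ[K] _).toRingHom
  have hf : ∀ (m : M) (p : MvPolynomial τ K), eval (κ m) (f p) = eval (μ (φ m)) p :=
    IsRegularMap.eval_bind₁ hq
  have hI : vanIdeal μ (closure (φ '' X)) = (vanIdeal κ X).comap f := vanIdeal_image hμ hq X
  let g : (MvPolynomial τ K ⧸ vanIdeal μ (closure (φ '' X))) →+* (MvPolynomial σ K ⧸ vanIdeal κ X) :=
    Ideal.quotientMap (vanIdeal κ X) f hI.le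
  algebraize [g]
  have hker : RingHom.ker (Ideal.Quotient.mk (vanIdeal κ X)) ≤ vanIdeal κ {x} := by
    rw [Ideal.mk_ker]
    exact vanIdeal_anti (Set.singleton_subset_iff.2 hx)
  have hx1 := hκ.isPrime_vanIdeal (isIrreducible_singleton (x := x))
  let P : Ideal (MvPolynomial σ K ⧸ vanIdeal κ X) :=
    (vanIdeal κ {x}).map (Ideal.Quotient.mk (vanIdeal κ X))
  have hP : P.IsPrime := Ideal.map_isPrime_of_surjective Ideal.Quotient.mk_surjective hker
  let p : Ideal (MvPolynomial τ K ⧸ vanIdeal μ (closure (φ '' X))) := P.comap g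
  have hp : p.IsPrime := hP.comap g
  have : P.LiesOver p := ⟨rfl⟩
  have h1 := hκ.zdimAt_le_height (X := X) x ⟨P, hP⟩ le_rfl
  -- The algebraic core: `ht P ≤ ht p + ht (P/pB)`, with `P` the ideal of `x` in the coordinate ring
  -- `B` of `X`, and `p` its contraction to the coordinate ring of the closure of the image. The
  -- last two heights are then bounded by the dimensions of that closure and of the fibre.
  have h2 := Ideal.height_le_height_add_of_liesOver p P
  have h3 : (p.height : WithBot ℕ∞) ≤ zdim (closure (φ '' X)) := by
    refine (Ideal.height_le_ringKrullDim_of_ne_top hp.ne_top).trans ?_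
    refine hμ.ringKrullDim_le_zdim (Ideal.Quotient.mk _) Ideal.Quotient.mk_surjective ?_ ?_
    · rw [Ideal.mk_ker]
      exact vanIdeal_anti (Set.subset_univ _)
    · rw [Ideal.mk_ker, hμ.locus_vanIdeal isClosed_closure]
  have hmem : ∀ r : MvPolynomial τ K, eval (μ (φ x)) r = 0 →
      Ideal.Quotient.mk (vanIdeal κ X) (f r) ∈ p.map g := by
    intro r hr
    refine Ideal.mem_map_of_mem g (x := Ideal.Quotient.mk _ r) ?_
    change Ideal.Quotient.mk (vanIdeal κ X) (f r) ∈ P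
    refine Ideal.mem_map_of_mem _ fun m hm => ?_
    rw [Set.mem_singleton_iff.1 hm, hf, hr]
  have h4 : ((P.map (Ideal.Quotient.mk (p.map g))).height : WithBot ℕ∞) ≤
      zdim (X ∩ φ ⁻¹' {φ x}) := by
    refine (Ideal.height_le_ringKrullDim_of_ne_top ?_).trans ?_
    · have hle : RingHom.ker (Ideal.Quotient.mk (p.map g)) ≤ P := by
        rw [Ideal.mk_ker]
        exact Ideal.map_comap_le
      exact (Ideal.map_isPrime_of_surjective Ideal.Quotient.mk_surjective hle).ne_top
    -- `B / pB` is the ring of the scheme-theoretic fibre over `φ x`. Its points lie in `X`, and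
    -- they map to `φ x` because `pB` contains each difference between a pulled-back coordinate and
    -- its value at `φ x`.
    · refine hκ.ringKrullDim_le_zdim ((Ideal.Quotient.mk (p.map g)).comp (Ideal.Quotient.mk _))
        (Ideal.Quotient.mk_surjective.comp Ideal.Quotient.mk_surjective) ?_ ?_
      · intro r hr
        rw [RingHom.mem_ker, RingHom.comp_apply,
          Ideal.Quotient.eq_zero_iff_mem.2 (vanIdeal_anti (Set.subset_univ X) hr), map_zero]
      · intro m hm
        refine ⟨?_, ?_⟩
        · rw [← hκ.locus_vanIdeal hX]
          intro r hr
          refine hm r ?_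
          rw [RingHom.mem_ker, RingHom.comp_apply, Ideal.Quotient.eq_zero_iff_mem.2 hr, map_zero]
        · have hpt : ∀ r : MvPolynomial τ K, eval (μ (φ x)) r = 0 → eval (μ (φ m)) r = 0 := by
            intro r hr
            rw [← hf]
            refine hm _ ?_
            rw [RingHom.mem_ker, RingHom.comp_apply]
            exact Ideal.Quotient.eq_zero_iff_mem.2 (hmem r hr)
          apply hμ.injective
          funext i
          have := hpt (MvPolynomial.X i - C (μ (φ x) i)) (by simp)
          simpa [sub_eq_zero] using this
  calc zdimAt x X ≤ P.height := h1
    _ ≤ ((p.height + (P.map (Ideal.Quotient.mk (p.map g))).height : ℕ∞) : WithBot ℕ∞) :=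
        WithBot.coe_le_coe.2 h2
    _ = p.height + (P.map (Ideal.Quotient.mk (p.map g))).height := WithBot.coe_add _ _
    _ ≤ _ := add_le_add h3 h4

/-- The image of a nonempty open subset of an irreducible closed set contains a nonempty open subset
of its closure. -/
theorem IsRegularMap.exists_open_subset_image {κ : M → σ → K} {μ : N → τ → K} {φ : M → N}
    (hκ : IsAffineChart κ) (hμ : IsAffineChart μ) (hφ : IsRegularMap κ μ φ) {X : Set M}
    (hX : IsIrreducible X) (hXc : IsClosed X) {f : MvPolynomial σ K} (hf : f ∉ vanIdeal κ X) :
    ∃ g : MvPolynomial τ K, g ∉ vanIdeal μ (closure (φ '' X)) ∧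
      ∀ y ∈ closure (φ '' X), eval (μ y) g ≠ 0 → ∃ x ∈ X, eval (κ x) f ≠ 0 ∧ φ x = y := by
  obtain ⟨q, hq⟩ := hφ
  let F : MvPolynomial τ K →+* MvPolynomial σ K := (bind₁ q : _ →ₐ[K] _).toRingHom
  have hF : ∀ (m : M) (p : MvPolynomial τ K), eval (κ m) (F p) = eval (μ (φ m)) p :=
    IsRegularMap.eval_bind₁ hq
  have hI : vanIdeal μ (closure (φ '' X)) = (vanIdeal κ X).comap F := vanIdeal_image hμ hq X
  have hfp : F.FinitePresentation := by
    refine (RingHom.FinitePresentation.of_finiteType).1 ?_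
    refine RingHom.FiniteType.of_comp_finiteType (f := (C : K →+* MvPolynomial τ K)) ?_
    have : F.comp (C : K →+* MvPolynomial τ K) = algebraMap K (MvPolynomial σ K) := by
      ext a
      simp [F]
    rw [this, RingHom.finiteType_algebraMap]
    infer_instance
  let s : Set (PrimeSpectrum (MvPolynomial σ K)) :=
    PrimeSpectrum.zeroLocus (vanIdeal κ X : Set _) \ PrimeSpectrum.zeroLocus {f}
  have hs : Topology.IsConstructible s := by
    have h : ∀ J : Set (MvPolynomial σ K),
        Topology.IsConstructible (PrimeSpectrum.zeroLocus J) := fun J => by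
      rw [← Topology.isConstructible_compl]
      exact (NoetherianSpace.isCompact _).isConstructible
        (PrimeSpectrum.isClosed_zeroLocus J).isOpen_compl
    exact (h _).sdiff (h _)
  have hprime := hκ.isPrime_vanIdeal hX
  have himg := PrimeSpectrum.isConstructible_comap_image hfp hs
  -- By Chevalley the image is a finite union of pieces `V(D.g) \ V(D.f)`. One of them contains the
  -- generic point of the closure of `φ '' X`; then that closure lies in `V(D.g)`, and `D.f` is the
  -- required polynomial.
  obtain ⟨S, hS⟩ := PrimeSpectrum.exists_constructibleSetData_iff.2 himg
  have hgen : (PrimeSpectrum.comap F ⟨vanIdeal κ X, hprime⟩) ∈ S.toSet := by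
    rw [hS]
    refine ⟨_, ⟨?_, ?_⟩, rfl⟩
    · exact fun _ h => h
    · exact fun h => hf (h rfl)
  rw [PrimeSpectrum.ConstructibleSetData.toSet, Set.mem_iUnion₂] at hgen
  obtain ⟨D, hD, hgD, hfD⟩ := hgen
  refine ⟨D.f, ?_, fun y hy hgy => ?_⟩
  · rw [hI]
    exact fun h => hfD (Set.singleton_subset_iff.2 h)
  have hy1 := hμ.isPrime_vanIdeal (isIrreducible_singleton (x := y))
  have hyS : (⟨vanIdeal μ {y}, hy1⟩ : PrimeSpectrum _) ∈ S.toSet := by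
    rw [PrimeSpectrum.ConstructibleSetData.toSet, Set.mem_iUnion₂]
    refine ⟨D, hD, ?_, ?_⟩
    · refine Set.Subset.trans hgD ?_
      change (vanIdeal κ X).comap F ≤ vanIdeal μ {y}
      rw [← hI]
      exact vanIdeal_anti (Set.singleton_subset_iff.2 hy)
    · exact fun h => hgy (Set.singleton_subset_iff.1 h y rfl)
  rw [hS] at hyS
  obtain ⟨Q, ⟨hQX, hQf⟩, hQ⟩ := hyS
  have hQy : Q.asIdeal.comap F = vanIdeal μ {y} := congrArg PrimeSpectrum.asIdeal hQ
  have hQX' : vanIdeal κ X ≤ Q.asIdeal := hQX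
  -- `Q` lies over the point `y` but need not be maximal. Since `f ∉ Q`, the Nullstellensatz
  -- supplies an actual point of the locus of `Q` where `f` does not vanish, and every point of that
  -- locus maps to `y`.
  have hv := hκ.vanIdeal_locus Q.2 ((vanIdeal_anti (Set.subset_univ X)).trans hQX')
  by_contra! hc
  refine hQf (Set.singleton_subset_iff.2 ?_)
  rw [SetLike.mem_coe, ← hv]
  intro m hm
  by_contra hne
  refine hc m ?_ hne ?_
  · rw [← hκ.locus_vanIdeal hXc]
    exact locus_anti hQX' hm
  · apply hμ.injective
    funext i
    have h1 : MvPolynomial.X i - C (μ y i) ∈ Q.asIdeal.comap F := by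
      rw [hQy]
      intro z hz
      rw [Set.mem_singleton_iff.1 hz]
      simp
    have h2 := hm _ h1
    rw [hF] at h2
    simpa [sub_eq_zero] using h2

end Fibres

end CosetWeyl

namespace CosetWeyl

open MvPolynomial TopologicalSpace
open scoped MatrixGroups

/-! ### `GL n` and `GL n × GL n` as affine varieties -/

section GroupCharts

/-- The topology on `M` induced by the Zariski topology through the coordinates `κ`. -/
@[reducible] noncomputable def chartTopology {K σ M : Type*} [Field K] (κ : M → σ → K) : TopologicalSpace M :=
  TopologicalSpace.induced (fun m => pointToPoint (k := K) (κ m)) inferInstance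

theorem isAffineChart_chartTopology {K σ M : Type*} [Field K] {κ : M → σ → K}
    (h : Function.Injective κ)
    (hr : ∃ I : Set (MvPolynomial σ K), Set.range κ = {x | ∀ p ∈ I, eval x p = 0}) :
    @IsAffineChart K _ σ M (chartTopology κ) κ := by
  let _ := chartTopology κ
  have hmem : ∀ (I : Set (MvPolynomial σ K)), {m | ∀ p ∈ I, eval (κ m) p = 0} =
      (fun m => pointToPoint (k := K) (κ m)) ⁻¹' PrimeSpectrum.zeroLocus I := fun I => by
    ext m
    simp only [Set.mem_preimage, PrimeSpectrum.mem_zeroLocus, Set.subset_def, Set.mem_ofPred_eq]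
    refine forall₂_congr fun p _ => ?_
    change _ ↔ p ∈ vanishingIdeal K {κ m}
    rw [mem_vanishingIdeal_singleton_iff]
    rfl
  refine ⟨h, fun S => ?_, hr⟩
  rw [isClosed_induced_iff]
  constructor
  · rintro ⟨Z, hZ, rfl⟩
    obtain ⟨I, rfl⟩ := (PrimeSpectrum.isClosed_iff_zeroLocus _).1 hZ
    exact ⟨I, (hmem I).symm⟩
  · rintro ⟨I, rfl⟩
    exact ⟨_, PrimeSpectrum.isClosed_zeroLocus I, (hmem I).symm⟩

variable {K : Type*} [Field K] {n : ℕ}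

theorem coord_injective : Function.Injective (coord : GL (Fin n) K → Coord n → K) := by
  intro g h hgh
  ext i j
  exact congrFun hgh (Sum.inl (i, j))

/-- The equations of the range of `coord`. -/
def coordRel (K : Type*) [Field K] (n : ℕ) : Set (MvPolynomial (Coord n) K) :=
  Set.range (fun ij : Fin n × Fin n => ∑ k, X (Sum.inl (ij.1, k)) * X (Sum.inr (k, ij.2))
      - C ((1 : Matrix (Fin n) (Fin n) K) ij.1 ij.2)) ∪
    Set.range (fun ij : Fin n × Fin n => ∑ k, X (Sum.inr (ij.1, k)) * X (Sum.inl (k, ij.2))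
      - C ((1 : Matrix (Fin n) (Fin n) K) ij.1 ij.2))

/-- A point of the right-hand side is a pair of matrices inverse to each other on both sides, that
is, a unit. -/
theorem range_coord : Set.range (coord : GL (Fin n) K → Coord n → K) =
    {x | ∀ p ∈ coordRel K n, eval x p = 0} := by
  ext x
  simp only [coordRel, Set.mem_range, Set.mem_ofPred_eq, Set.mem_union, or_imp, forall_and,
    forall_exists_index, forall_apply_eq_imp_iff]
  simp only [map_sub, map_sum, map_mul, eval_X, eval_C, sub_eq_zero, Prod.forall]
  constructor
  · rintro ⟨g, rfl⟩
    have h1 : (g : Matrix (Fin n) (Fin n) K) * ((g⁻¹ : GL (Fin n) K) : Matrix _ _ K) = 1 := by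
      rw [← Units.val_mul, mul_inv_cancel, Units.val_one]
    have h2 : ((g⁻¹ : GL (Fin n) K) : Matrix _ _ K) * (g : Matrix (Fin n) (Fin n) K) = 1 := by
      rw [← Units.val_mul, inv_mul_cancel, Units.val_one]
    refine ⟨fun i j => ?_, fun i j => ?_⟩
    · rw [← h1, Matrix.mul_apply]; rfl
    · rw [← h2, Matrix.mul_apply]; rfl
  · rintro ⟨h1, h2⟩
    refine ⟨⟨Matrix.of fun i j => x (Sum.inl (i, j)), Matrix.of fun i j => x (Sum.inr (i, j)),
      ?_, ?_⟩, ?_⟩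
    · ext i j
      simpa [Matrix.mul_apply] using h1 i j
    · ext i j
      simpa [Matrix.mul_apply] using h2 i j
    · funext i
      rcases i with ⟨i, j⟩ | ⟨i, j⟩ <;> rfl

theorem isAffineChart_coord :
    @IsAffineChart K _ (Coord n) (GL (Fin n) K) (zariski K n) coord := by
  let _ := zariski K n
  refine ⟨coord_injective, fun S => ?_, ⟨_, range_coord⟩⟩
  rw [isClosed_zariski_iff]
  rfl

/-- The coordinates on a product `GL n × GL n`. -/
def pairCoord (z : GL (Fin n) K × GL (Fin n) K) : Coord n ⊕ Coord n → K :=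
  Sum.elim (coord z.1) (coord z.2)

/-- The Zariski topology on `GL n × GL n`. -/
@[reducible] noncomputable def pairZariski (K : Type*) [Field K] (n : ℕ) :
    TopologicalSpace (GL (Fin n) K × GL (Fin n) K) :=
  chartTopology pairCoord

/-- The equations are two copies of `coordRel` in separate variables. The topology is the Zariski
topology of the product variety, not the product topology, so continuity has to come from
regularity. -/
theorem isAffineChart_pairCoord :
    @IsAffineChart K _ (Coord n ⊕ Coord n) (GL (Fin n) K × GL (Fin n) K) (pairZariski K n)
      pairCoord := by
  refine isAffineChart_chartTopology (fun z w h => ?_)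
    ⟨rename Sum.inl '' coordRel K n ∪ rename Sum.inr '' coordRel K n, ?_⟩
  · refine Prod.ext (coord_injective ?_) (coord_injective ?_)
    · exact congrArg (· ∘ Sum.inl) h
    · exact congrArg (· ∘ Sum.inr) h
  · ext x
    have h1 := Set.ext_iff.1 (range_coord (K := K) (n := n)) (x ∘ Sum.inl)
    have h2 := Set.ext_iff.1 (range_coord (K := K) (n := n)) (x ∘ Sum.inr)
    rw [Set.mem_ofPred_eq] at h1 h2
    simp only [Set.mem_ofPred_eq, Set.mem_union, or_imp, forall_and, Set.forall_mem_image,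
      eval_rename]
    rw [← h1, ← h2]
    constructor
    · rintro ⟨z, rfl⟩
      exact ⟨⟨z.1, rfl⟩, ⟨z.2, rfl⟩⟩
    · rintro ⟨⟨g, hg⟩, h, hh⟩
      refine ⟨(g, h), ?_⟩
      funext i
      rcases i with i | i
      · exact congrFun hg i
      · exact congrFun hh i

section Regular

variable {σ M : Type*} {κ : M → σ → K}

theorem IsRegularMap.id : IsRegularMap κ κ fun m => m :=
  ⟨X, fun m => by simp⟩

theorem IsRegularMap.const (g : GL (Fin n) K) : IsRegularMap κ coord fun _ : M => g :=
  ⟨fun i => C (coord g i), fun m => by simp⟩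

theorem IsRegularMap.mul {φ ψ : M → GL (Fin n) K} (hφ : IsRegularMap κ coord φ)
    (hψ : IsRegularMap κ coord ψ) : IsRegularMap κ coord fun m => φ m * ψ m := by
  obtain ⟨p, hp⟩ := hφ
  obtain ⟨q, hq⟩ := hψ
  refine ⟨Sum.elim (fun ij => ∑ k, p (Sum.inl (ij.1, k)) * q (Sum.inl (k, ij.2)))
    (fun ij => ∑ k, q (Sum.inr (ij.1, k)) * p (Sum.inr (k, ij.2))), fun m => ?_⟩
  funext i
  rcases i with ⟨i, j⟩ | ⟨i, j⟩
  · simp only [Sum.elim_inl, map_sum, map_mul, ← congrFun (hp m), ← congrFun (hq m)]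
    simp [coord, Matrix.mul_apply]
  · simp only [Sum.elim_inr, map_sum, map_mul, ← congrFun (hp m), ← congrFun (hq m)]
    simp only [coord, Sum.elim_inr, _root_.mul_inv_rev, Units.val_mul, Matrix.mul_apply]

theorem IsRegularMap.inv {φ : M → GL (Fin n) K} (hφ : IsRegularMap κ coord φ) :
    IsRegularMap κ coord fun m => (φ m)⁻¹ := by
  obtain ⟨p, hp⟩ := hφ
  refine ⟨fun i => p i.swap, fun m => ?_⟩
  rw [coord_inv, hp]
  rfl

theorem IsRegularMap.pair {φ ψ : M → GL (Fin n) K} (hφ : IsRegularMap κ coord φ)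
    (hψ : IsRegularMap κ coord ψ) : IsRegularMap κ pairCoord fun m => (φ m, ψ m) := by
  obtain ⟨p, hp⟩ := hφ
  obtain ⟨q, hq⟩ := hψ
  refine ⟨Sum.elim p q, fun m => ?_⟩
  funext i
  rcases i with i | i
  · exact congrFun (hp m) i
  · exact congrFun (hq m) i

theorem isRegularMap_fst :
    IsRegularMap pairCoord coord (Prod.fst : GL (Fin n) K × GL (Fin n) K → GL (Fin n) K) :=
  ⟨fun i => X (Sum.inl i), fun z => by simp [pairCoord]⟩

theorem isRegularMap_snd :
    IsRegularMap pairCoord coord (Prod.snd : GL (Fin n) K × GL (Fin n) K → GL (Fin n) K) :=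
  ⟨fun i => X (Sum.inr i), fun z => by simp [pairCoord]⟩

end Regular

end GroupCharts

/-! ### Irreducible components and the identity component -/

section Components

attribute [local instance] zariski

variable {K : Type*} [Field K] {n : ℕ}

theorem continuous_mul_left_zariski (a : GL (Fin n) K) :
    Continuous fun g : GL (Fin n) K => a * g := by
  simpa using continuous_translate a 1

theorem noetherianSpace_zariski : NoetherianSpace (GL (Fin n) K) :=
  isAffineChart_coord.noetherianSpace

theorem isIrreducible_mul_left {T : Set (GL (Fin n) K)} (hT : IsIrreducible T)
    (a : GL (Fin n) K) : IsIrreducible {x | a⁻¹ * x ∈ T} := by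
  have : {x | a⁻¹ * x ∈ T} = (fun g => a * g) '' T := by
    ext x
    exact ⟨fun h => ⟨_, h, by simp⟩, by rintro ⟨y, hy, rfl⟩; simpa using hy⟩
  rw [this]
  exact hT.image _ (continuous_mul_left_zariski a).continuousOn

theorem isClosed_mul_left {T : Set (GL (Fin n) K)} (hT : IsClosed T)
    (a : GL (Fin n) K) : IsClosed {x | a⁻¹ * x ∈ T} :=
  hT.preimage (continuous_mul_left_zariski a⁻¹)

theorem exists_subset_of_isIrreducible {T : Set (GL (Fin n) K)} (hT : IsIrreducible T)
    {S : Set (Set (GL (Fin n) K))} (hS : S.Finite) (hc : ∀ Z ∈ S, IsClosed Z) (h : T ⊆ ⋃₀ S) :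
    ∃ Z ∈ S, T ⊆ Z := by
  obtain ⟨Z, hZ, hTZ⟩ := isIrreducible_iff_sUnion_isClosed.1 hT hS.toFinset
    (fun Z hZ => hc Z (hS.mem_toFinset.1 hZ)) (by rwa [hS.coe_toFinset])
  exact ⟨Z, hS.mem_toFinset.1 hZ, hTZ⟩

theorem idComp_le (G : Subgroup (GL (Fin n) K)) : idComp G ≤ G :=
  fun _ hx => connectedComponentIn_subset (G : Set (GL (Fin n) K)) 1 hx

theorem subset_idComp {G : Subgroup (GL (Fin n) K)} {T : Set (GL (Fin n) K)}
    (hT : IsIrreducible T) (h1 : 1 ∈ T) (hTG : T ⊆ G) : T ⊆ idComp G :=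
  hT.2.isPreconnected.subset_connectedComponentIn h1 hTG

/-- The structure of the irreducible components of a closed subgroup. -/
theorem exists_components {G : Subgroup (GL (Fin n) K)} (hG : IsClosed (G : Set (GL (Fin n) K))) :
    IsIrreducible (idComp G : Set (GL (Fin n) K)) ∧
    IsClosed (idComp G : Set (GL (Fin n) K)) ∧ (idComp G).relIndex G ≠ 0 := by
  have := noetherianSpace_zariski (K := K) (n := n)
  obtain ⟨S, hSf, hSc, hSi, hS⟩ := NoetherianSpace.exists_finite_set_isClosed_irreducible hG
  have hne : S.Nonempty := by
    rw [Set.nonempty_iff_ne_empty]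
    rintro rfl
    have : (1 : GL (Fin n) K) ∈ (G : Set (GL (Fin n) K)) := G.one_mem
    simp [hS] at this
  obtain ⟨Z₀, hZ₀, hmax⟩ := hSf.exists_maximal hne
  have hSG : ∀ Z ∈ S, Z ⊆ (G : Set (GL (Fin n) K)) := fun Z hZ => hS ▸ Set.subset_sUnion_of_mem hZ
  -- Otherwise the other members of `S` would cover the irreducible set `Z₀`, so one would contain
  -- it, against maximality.
  obtain ⟨z₀, hz₀, hz₀'⟩ : ∃ z ∈ Z₀, ∀ Z ∈ S, z ∈ Z → Z = Z₀ := by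
    by_contra! hc
    obtain ⟨Z, hZ, hZZ⟩ := exists_subset_of_isIrreducible (hSi _ hZ₀)
      (hSf.subset (Set.sdiff_subset (t := {Z₀}))) (fun Z hZ => hSc Z hZ.1) (fun z hz => by
        obtain ⟨Z, hZ, hzZ, hne⟩ := hc z hz
        exact ⟨Z, ⟨hZ, hne⟩, hzZ⟩)
    exact hZ.2 (Set.Subset.antisymm (hmax hZ.1 hZZ) hZZ)
  have hz₀G : z₀ ∈ G := hSG _ hZ₀ hz₀
  -- `N = z₀⁻¹Z₀`. As `z₀` lies on no other member of `S`, translation makes `N` the largest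
  -- irreducible subset of `G` through `1`; this replaces the usual argument that only one component
  -- passes through `1`.
  let N : Set (GL (Fin n) K) := {x | z₀⁻¹⁻¹ * x ∈ Z₀}
  have hNi : IsIrreducible N := isIrreducible_mul_left (hSi _ hZ₀) _
  have hNc : IsClosed N := isClosed_mul_left (hSc _ hZ₀) _
  have hN1 : (1 : GL (Fin n) K) ∈ N := by simpa [N] using hz₀
  have hNG : N ⊆ G := fun x hx => by
    have := hSG _ hZ₀ hx
    rw [SetLike.mem_coe, inv_inv] at this
    exact (G.mul_mem_cancel_left hz₀G).1 this
  have hNmax : ∀ T : Set (GL (Fin n) K), IsIrreducible T → 1 ∈ T → T ⊆ G → T ⊆ N := by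
    intro T hT h1 hTG
    obtain ⟨Z, hZ, hTZ⟩ := exists_subset_of_isIrreducible (isIrreducible_mul_left hT z₀) hSf hSc
      (fun x hx => by
        rw [← hS]
        exact (G.mul_mem_cancel_left (G.inv_mem hz₀G)).1 (hTG hx))
    have : Z = Z₀ := hz₀' Z hZ (hTZ (by simpa using h1))
    subst this
    exact fun x hx => hTZ (by simpa using hx)
  have hNmax' : ∀ x ∈ G, ∀ T : Set (GL (Fin n) K), IsIrreducible T → x ∈ T → T ⊆ G →
      T ⊆ {y | x⁻¹ * y ∈ N} := by
    intro x hx T hT hxT hTG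
    have := hNmax {y | x⁻¹⁻¹ * y ∈ T} (isIrreducible_mul_left hT _) (by simpa using hxT)
      (fun y hy => (G.mul_mem_cancel_left (by simpa using hx)).1 (hTG hy))
    exact fun y hy => this (by simpa using hy)
  have hNS : ∀ x ∈ G, {y | x⁻¹ * y ∈ N} ∈ S := by
    intro x hx
    obtain ⟨Z, hZ, hNZ⟩ := exists_subset_of_isIrreducible (isIrreducible_mul_left hNi x) hSf hSc
      (fun y hy => by
        rw [← hS]
        exact (G.mul_mem_cancel_left (G.inv_mem hx)).1 (hNG hy))
    have := hNmax' x hx Z (hSi Z hZ) (hNZ (by simpa using hN1)) (hSG Z hZ)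
    rwa [Set.Subset.antisymm hNZ this]
  have hNN : ∀ x ∈ N, {y | x⁻¹ * y ∈ N} = N := by
    intro x hx
    have h1 := hNmax' x (hNG hx) N hNi hx hNG
    refine Set.Subset.antisymm (hNmax _ (isIrreducible_mul_left hNi x) (h1 hN1) fun y hy => ?_) h1
    exact (G.mul_mem_cancel_left (G.inv_mem (hNG hx))).1 (hNG hy)
  have hNeq : (idComp G : Set (GL (Fin n) K)) = N := by
    refine Set.Subset.antisymm ?_ (subset_idComp hNi hN1 hNG)
    have hcc : IsPreconnected (idComp G : Set (GL (Fin n) K)) :=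
      isPreconnected_connectedComponentIn
    have hdis : ∀ x ∈ G, x ∉ N → {y | x⁻¹ * y ∈ N} ∩ N = ∅ := by
      intro x hx hxN
      by_contra hne
      obtain ⟨y, hyx, hyN⟩ := Set.nonempty_iff_ne_empty.2 hne
      have h := hNmax' y (hNG hyN) _ (isIrreducible_mul_left hNi x) hyx fun z hz =>
        (G.mul_mem_cancel_left (G.inv_mem hx)).1 (hNG hz)
      rw [hNN y hyN] at h
      exact hxN (h (by simpa using hN1))
    -- Each translate `xN` belongs to the finite family `S`, and those with `x ∉ N` miss `N`. So `N`
    -- is closed with closed complement in `G`, and connectedness confines `idComp G` to `N`.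
    have := isPreconnected_iff_subset_of_disjoint_closed.1 hcc N (⋃₀ {Z ∈ S | Z ∩ N = ∅}) hNc ?_ ?_ ?_
    · refine this.resolve_right fun h => ?_
      obtain ⟨Z, hZ, h1Z⟩ := h (idComp G).one_mem
      have : (1 : GL (Fin n) K) ∈ Z ∩ N := ⟨h1Z, hN1⟩
      rw [hZ.2] at this
      exact this
    · rw [Set.sUnion_eq_biUnion]
      exact (hSf.subset (Set.sep_subset _ _)).isClosed_biUnion fun Z hZ => hSc Z hZ.1
    · intro x hx
      by_cases hxN : x ∈ N
      · exact Or.inl hxN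
      · exact Or.inr ⟨_, ⟨hNS x (idComp_le G hx), hdis x (idComp_le G hx) hxN⟩,
          by simpa using hN1⟩
    · rw [Set.eq_empty_iff_forall_notMem]
      rintro x ⟨-, hxN, Z, hZ, hxZ⟩
      have : x ∈ Z ∩ N := ⟨hxZ, hxN⟩
      rw [hZ.2] at this
      exact this
  refine ⟨hNeq ▸ hNi, hNeq ▸ hNc, ?_⟩
  have hfin : Finite (G ⧸ (idComp G).subgroupOf G) := by
    have := hSf.to_subtype
    refine Finite.of_injective (β := S) (Quotient.lift
      (fun x : G => (⟨_, hNS x.1 x.2⟩ : S)) fun x y hxy => ?_) ?_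
    · have hxy' : (x : GL (Fin n) K)⁻¹ * y ∈ N := by
        rw [← hNeq]
        exact QuotientGroup.leftRel_apply (s := (idComp G).subgroupOf G).1 hxy
      refine Subtype.ext ?_
      ext z
      have h := Set.ext_iff.1 (hNN _ hxy') ((x : GL (Fin n) K)⁻¹ * z)
      simp only [Set.mem_ofPred_eq] at h ⊢
      rw [← h]
      group
    · rintro ⟨x⟩ ⟨y⟩ hxy
      refine Quotient.sound (QuotientGroup.leftRel_apply.2 ?_)
      have h := Set.ext_iff.1 (congrArg Subtype.val hxy) (y : GL (Fin n) K)
      have h' : (x : GL (Fin n) K)⁻¹ * y ∈ N := h.2 (by simpa using hN1)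
      rw [← hNeq] at h'
      exact h'
  exact Subgroup.index_ne_zero_of_finite

theorem isIrreducible_idComp {G : Subgroup (GL (Fin n) K)}
    (hG : IsClosed (G : Set (GL (Fin n) K))) :
    IsIrreducible (idComp G : Set (GL (Fin n) K)) := (exists_components hG).1

theorem isClosed_idComp {G : Subgroup (GL (Fin n) K)}
    (hG : IsClosed (G : Set (GL (Fin n) K))) :
    IsClosed (idComp G : Set (GL (Fin n) K)) := (exists_components hG).2.1

theorem relIndex_idComp_ne_zero {G : Subgroup (GL (Fin n) K)}
    (hG : IsClosed (G : Set (GL (Fin n) K))) : (idComp G).relIndex G ≠ 0 :=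
  (exists_components hG).2.2

theorem continuous_conj_zariski (a : GL (Fin n) K) :
    Continuous fun g : GL (Fin n) K => a * g * a⁻¹ := continuous_translate a a⁻¹

theorem conj_mem_idComp {G : Subgroup (GL (Fin n) K)} (hG : IsClosed (G : Set (GL (Fin n) K)))
    {a x : GL (Fin n) K} (ha : a ∈ G) (hx : x ∈ idComp G) : a * x * a⁻¹ ∈ idComp G := by
  refine subset_idComp ((isIrreducible_idComp hG).image _ (continuous_conj_zariski a).continuousOn)
    ⟨1, (idComp G).one_mem, by simp⟩ ?_ ⟨x, hx, rfl⟩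
  rintro _ ⟨y, hy, rfl⟩
  exact G.mul_mem (G.mul_mem ha (idComp_le G hy)) (G.inv_mem ha)

theorem idComp_mono {A B : Subgroup (GL (Fin n) K)} (hA : IsClosed (A : Set (GL (Fin n) K)))
    (h : A ≤ B) : idComp A ≤ idComp B :=
  subset_idComp (isIrreducible_idComp hA) (idComp A).one_mem ((idComp_le A).trans h)

/-- An irreducible subset of a group lies in one coset of a closed subgroup of finite index. -/
theorem exists_subset_coset {A B : Subgroup (GL (Fin n) K)}
    (hA : IsClosed (A : Set (GL (Fin n) K))) (h : A.relIndex B ≠ 0) {T : Set (GL (Fin n) K)}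
    (hT : IsIrreducible T) (hTB : T ⊆ B) : ∃ b ∈ B, T ⊆ {x | b⁻¹ * x ∈ A} := by
  have hfin : Finite (B ⧸ A.subgroupOf B) :=
    have : (A.subgroupOf B).FiniteIndex := ⟨h⟩
    inferInstance
  let f : B ⧸ A.subgroupOf B → Set (GL (Fin n) K) := fun q => {x | (q.out : GL (Fin n) K)⁻¹ * x ∈ A}
  obtain ⟨_, ⟨q, rfl⟩, hq⟩ := exists_subset_of_isIrreducible hT (Set.finite_range f)
    (by rintro _ ⟨q, rfl⟩; exact isClosed_mul_left hA _) (fun x hx => by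
      refine ⟨_, ⟨QuotientGroup.mk ⟨x, hTB hx⟩, rfl⟩, ?_⟩
      have := QuotientGroup.leftRel_apply.1 (Quotient.exact
        (Quotient.out_eq (QuotientGroup.mk (s := A.subgroupOf B) (⟨x, hTB hx⟩ : B))))
      exact this)
  exact ⟨q.out, q.out.2, hq⟩

/-- The one coset of `A` that contains `T` passes through `1`, so it is `A` itself. -/
theorem subset_of_relIndex_ne_zero {A B : Subgroup (GL (Fin n) K)}
    (hA : IsClosed (A : Set (GL (Fin n) K))) (h : A.relIndex B ≠ 0) {T : Set (GL (Fin n) K)}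
    (hT : IsIrreducible T) (hTB : T ⊆ B) (h1 : 1 ∈ T) : T ⊆ A := by
  obtain ⟨b, hb, hTb⟩ := exists_subset_coset hA h hT hTB
  have hbA : b ∈ A := by simpa using hTb h1
  exact fun x hx => (A.mul_mem_cancel_left (A.inv_mem hbA)).1 (hTb hx)

end Components

end CosetWeyl

namespace CosetWeyl

open MvPolynomial TopologicalSpace
open scoped MatrixGroups

/-! ### Dimension under translation and in products -/

section ProductDimension

attribute [local instance] zariski pairZariski

variable {K : Type*} [Field K] {n : ℕ}

/-- Subsets that are identified by continuous maps have the same dimension. -/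
theorem zdim_le_of_leftInverse {M N : Type*} [TopologicalSpace M] [TopologicalSpace N]
    {F : Set M} {G : Set N} {α : M → N} {β : N → M} (hα : Continuous α) (hβ : Continuous β)
    (hG : IsClosed G) (hFG : ∀ m ∈ F, α m ∈ G) (hβα : ∀ m ∈ F, β (α m) = m)
    (hαβ : ∀ y ∈ G, α (β y) = y) : zdim F ≤ zdim G := by
  -- Images under `α` are rewritten as preimages under `β`, which shows that they are closed.
  have himg : ∀ T : {T : IrreducibleCloseds M // (T : Set M) ⊆ F},
      α '' (T.1 : Set M) = G ∩ β ⁻¹' T.1 := by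
    intro T
    ext y
    constructor
    · rintro ⟨m, hm, rfl⟩
      exact ⟨hFG m (T.2 hm), by simpa [hβα m (T.2 hm)] using hm⟩
    · rintro ⟨hy, hy'⟩
      exact ⟨β y, hy', hαβ y hy⟩
  refine Order.krullDim_le_of_strictMono (fun T => ⟨⟨α '' (T.1 : Set M),
    T.1.isIrreducible.image _ hα.continuousOn, ?_⟩, ?_⟩) fun S T hST => ?_
  · rw [himg]
    exact hG.inter (T.1.isClosed.preimage hβ)
  · rintro _ ⟨m, hm, rfl⟩
    exact hFG m (T.2 hm)
  · refine lt_of_le_of_ne (Set.image_mono (f := α) hST.le) fun he => hST.ne ?_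
    have h1 : α '' (S.1 : Set M) = α '' (T.1 : Set M) :=
      congrArg (fun T => ((T.1 : IrreducibleCloseds N) : Set N)) he
    apply Subtype.ext
    apply SetLike.coe_injective
    have h2 : ∀ T : {T : IrreducibleCloseds M // (T : Set M) ⊆ F},
        (T.1 : Set M) = β '' (α '' (T.1 : Set M)) := fun T => by
      rw [Set.image_image]
      conv_lhs => rw [← Set.image_id (T.1 : Set M)]
      exact Set.image_congr fun m hm => (hβα m (T.2 hm)).symm
    rw [h2 S, h2 T, h1]

theorem zdim_coset_le {A : Set (GL (Fin n) K)} (hA : IsClosed A) (a : GL (Fin n) K) :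
    zdim {x | a⁻¹ * x ∈ A} ≤ zdim A :=
  zdim_le_of_leftInverse (continuous_mul_left_zariski a⁻¹) (continuous_mul_left_zariski a)
    hA (fun _ h => h) (fun _ _ => by simp) (fun _ _ => by simp)

/-- The left translate of an irreducible closed set. -/
def irrTranslate (a : GL (Fin n) K) (T : IrreducibleCloseds (GL (Fin n) K)) :
    IrreducibleCloseds (GL (Fin n) K) :=
  ⟨{x | a⁻¹ * x ∈ (T : Set (GL (Fin n) K))}, isIrreducible_mul_left T.isIrreducible a,
    isClosed_mul_left T.isClosed a⟩

theorem irrTranslate_strictMono (a : GL (Fin n) K) : StrictMono (irrTranslate a) := by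
  intro S T h
  refine lt_of_le_of_ne (fun x hx => h.le hx) fun he => h.ne ?_
  apply SetLike.coe_injective
  ext x
  have h2 := Set.ext_iff.1 (congrArg IrreducibleCloseds.carrier he) (a * x)
  simpa [irrTranslate] using h2

/-- A chain of irreducible closed subsets of a group can be translated to any point. -/
theorem zdim_le_zdimAt (G : Subgroup (GL (Fin n) K)) {g : GL (Fin n) K} (hg : g ∈ G) :
    zdim (G : Set (GL (Fin n) K)) ≤ zdimAt g (G : Set (GL (Fin n) K)) := by
  refine iSup_le fun l => ?_
  -- A point of the smallest member lies in the whole chain; left translation by `g * t⁻¹` moves it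
  -- to `g`.
  obtain ⟨t, ht⟩ := l.head.1.isIrreducible.1
  have htG : t ∈ G := l.head.2 ht
  let a := g * t⁻¹
  have ha : a ∈ G := G.mul_mem hg (G.inv_mem htG)
  let l' : LTSeries {T : IrreducibleCloseds (GL (Fin n) K) //
      g ∈ (T : Set (GL (Fin n) K)) ∧ (T : Set (GL (Fin n) K)) ⊆ G} :=
    { length := l.length
      toFun := fun i => ⟨irrTranslate a (l i).1, by
          have : t ∈ ((l i).1 : Set (GL (Fin n) K)) := (l.head_le i : l.head ≤ l i) ht
          simpa [irrTranslate, a] using this,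
        fun x hx => (G.mul_mem_cancel_left (G.inv_mem ha)).1 ((l i).2 hx)⟩
      step := fun i => irrTranslate_strictMono a (l.step i) }
  exact le_iSup (fun p : LTSeries _ => (p.length : WithBot ℕ∞)) l'

theorem continuous_fst_pairZariski :
    Continuous (Prod.fst : GL (Fin n) K × GL (Fin n) K → GL (Fin n) K) :=
  isRegularMap_fst.continuous isAffineChart_pairCoord isAffineChart_coord

theorem continuous_snd_pairZariski :
    Continuous (Prod.snd : GL (Fin n) K × GL (Fin n) K → GL (Fin n) K) :=
  isRegularMap_snd.continuous isAffineChart_pairCoord isAffineChart_coord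

theorem isClosed_prod_zariski {A B : Set (GL (Fin n) K)} (hA : IsClosed A) (hB : IsClosed B) :
    IsClosed (A ×ˢ B) :=
  (hA.preimage continuous_fst_pairZariski).inter (hB.preimage continuous_snd_pairZariski)

/-- Continuity of the slices `b ↦ (a, b)` and `a ↦ (a, b)` suffices: irreducibility of `B` gives a
`y` whose horizontal slice meets both open sets, and irreducibility of `A` then gives a common
point. -/
theorem isIrreducible_prod_zariski {A B : Set (GL (Fin n) K)} (hA : IsIrreducible A)
    (hB : IsIrreducible B) : IsIrreducible (A ×ˢ B) := by
  have hl : ∀ a : GL (Fin n) K, Continuous fun b : GL (Fin n) K => (a, b) := fun a =>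
    ((IsRegularMap.const a).pair IsRegularMap.id).continuous isAffineChart_coord
      isAffineChart_pairCoord
  have hr : ∀ b : GL (Fin n) K, Continuous fun a : GL (Fin n) K => (a, b) := fun b =>
    (IsRegularMap.id.pair (IsRegularMap.const b)).continuous isAffineChart_coord
      isAffineChart_pairCoord
  refine ⟨hA.1.prod hB.1, ?_⟩
  rintro U V hU hV ⟨⟨a, b⟩, ⟨ha, hb⟩, hab⟩ ⟨⟨c, d⟩, ⟨hc, hd⟩, hcd⟩
  obtain ⟨y, hy, hyU, hyV⟩ := hB.2 _ _ (hU.preimage (hl a)) (hV.preimage (hl c))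
    ⟨b, hb, hab⟩ ⟨d, hd, hcd⟩
  obtain ⟨x, hx, hxU, hxV⟩ := hA.2 _ _ (hU.preimage (hr y)) (hV.preimage (hr y))
    ⟨a, ha, hyU⟩ ⟨c, hc, hyV⟩
  exact ⟨(x, y), ⟨hx, hy⟩, hxU, hxV⟩

/-- The product of irreducible closed sets. -/
noncomputable def irrProd (A B : IrreducibleCloseds (GL (Fin n) K)) :
    IrreducibleCloseds (GL (Fin n) K × GL (Fin n) K) :=
  ⟨(A : Set _) ×ˢ (B : Set _), isIrreducible_prod_zariski A.isIrreducible B.isIrreducible,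
    isClosed_prod_zariski A.isClosed B.isClosed⟩

theorem irrProd_strictMono_right (A : IrreducibleCloseds (GL (Fin n) K)) :
    StrictMono (irrProd A) := by
  intro B C h
  refine lt_of_le_of_ne (fun z hz => ⟨hz.1, h.le hz.2⟩) fun he => h.ne ?_
  apply SetLike.coe_injective
  obtain ⟨a, ha⟩ := A.isIrreducible.1
  ext x
  have h1 : (A : Set (GL (Fin n) K)) ×ˢ (B : Set (GL (Fin n) K)) = (A : Set _) ×ˢ (C : Set _) :=
    congrArg (fun T => ((T : IrreducibleCloseds _) : Set (GL (Fin n) K × GL (Fin n) K))) he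
  simpa [ha] using Set.ext_iff.1 h1 (a, x)

theorem irrProd_strictMono_left (B : IrreducibleCloseds (GL (Fin n) K)) :
    StrictMono fun A => irrProd A B := by
  intro A C h
  refine lt_of_le_of_ne (fun z hz => ⟨h.le hz.1, hz.2⟩) fun he => h.ne ?_
  apply SetLike.coe_injective
  obtain ⟨b, hb⟩ := B.isIrreducible.1
  ext x
  have h1 : (A : Set (GL (Fin n) K)) ×ˢ (B : Set (GL (Fin n) K)) = (C : Set _) ×ˢ (B : Set _) :=
    congrArg (fun T => ((T : IrreducibleCloseds _) : Set (GL (Fin n) K × GL (Fin n) K))) he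
  simpa [hb] using Set.ext_iff.1 h1 (x, b)

/-- The chain climbs in the second factor over the bottom of the first, then in the first factor
over the top of the second. Only this lower bound for the dimension of a product is needed. -/
theorem add_le_zdimAt_prod {A B : Set (GL (Fin n) K)} {x y : GL (Fin n) K} {a b : ℕ}
    (ha : a ≤ zdimAt x A) (hb : b ≤ zdimAt y B) :
    ((a + b : ℕ) : WithBot ℕ∞) ≤ zdimAt (x, y) (A ×ˢ B) := by
  obtain ⟨l, hl⟩ := Order.le_krullDim_iff.1 ha
  obtain ⟨m, hm⟩ := Order.le_krullDim_iff.1 hb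
  refine Order.le_krullDim_iff.2 ⟨RelSeries.smash
    (m.map (fun T => ⟨irrProd l.head.1 T.1, ⟨l.head.2.1, T.2.1⟩, Set.prod_mono l.head.2.2 T.2.2⟩)
      fun S T h => irrProd_strictMono_right _ h)
    (l.map (fun T => ⟨irrProd T.1 m.last.1, ⟨T.2.1, m.last.2.1⟩, Set.prod_mono T.2.2 m.last.2.2⟩)
      fun S T h => irrProd_strictMono_left _ h) ?_, ?_⟩
  · rfl
  · exact (congrArg₂ (· + ·) hm hl).trans (add_comm b a)

end ProductDimension

end CosetWeyl

namespace CosetWeyl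

open MvPolynomial TopologicalSpace Module
open scoped MatrixGroups

/-! ### Exponential sequences with unipotent coefficients -/

section ExponentialPolynomials

variable {K : Type*} [Field K]

/-- Induction on the sum of the exponents through the twisted Leibniz rule `(f - ab)(xy) = (f - a)x
· f y + a · x · (f - b)y`; each term lowers one exponent, and `f y` is killed by the same power of
`f - b` as `y`. -/
theorem mul_mem_maxGenEigenspace {E : Type*} [CommRing E] [Algebra K E] (f : E →ₐ[K] E) {a b : K}
    {x y : E} (hx : x ∈ End.maxGenEigenspace f.toLinearMap a)
    (hy : y ∈ End.maxGenEigenspace f.toLinearMap b) :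
    x * y ∈ End.maxGenEigenspace f.toLinearMap (a * b) := by
  rw [End.mem_maxGenEigenspace] at hx hy ⊢
  obtain ⟨i, hi⟩ := hx
  obtain ⟨j, hj⟩ := hy
  refine ⟨i + j, ?_⟩
  induction hm : i + j generalizing i j x y with
  | zero =>
    obtain ⟨rfl, rfl⟩ : i = 0 ∧ j = 0 := by omega
    rw [pow_zero, End.one_apply] at hi ⊢
    rw [hi, zero_mul]
  | succ m ih =>
    have hcomm : ∀ j (y : E), ((f.toLinearMap - b • (1 : End K E)) ^ j) y = 0 →
        ((f.toLinearMap - b • (1 : End K E)) ^ j) (f y) = 0 := by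
      intro j y hj
      have : Commute ((f.toLinearMap - b • (1 : End K E)) ^ j) f.toLinearMap :=
        (((Commute.refl _).sub_left ((Commute.one_left _).smul_left b))).pow_left j
      have h := congrArg (fun g : End K E => g y) this.eq
      simp only [End.mul_apply, hj, map_zero] at h
      exact h
    rcases Nat.eq_zero_or_pos i with rfl | hi0
    · rw [pow_zero, End.one_apply] at hi
      rw [hi, zero_mul, map_zero]
    rcases Nat.eq_zero_or_pos j with rfl | hj0
    · rw [pow_zero, End.one_apply] at hj
      rw [hj, mul_zero, map_zero]
    obtain ⟨i', rfl⟩ : ∃ i', i = i' + 1 := ⟨i - 1, by omega⟩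
    obtain ⟨j', rfl⟩ : ∃ j', j = j' + 1 := ⟨j - 1, by omega⟩
    have happ : ∀ (c : K) (z : E), (f.toLinearMap - c • (1 : End K E)) z = f z - c • z :=
      fun _ _ => rfl
    have hsplit : (f.toLinearMap - (a * b) • (1 : End K E)) (x * y) =
        ((f.toLinearMap - a • (1 : End K E)) x) * f y +
          a • (x * (f.toLinearMap - b • (1 : End K E)) y) := by
      simp only [happ]
      simp only [map_mul, Algebra.smul_def]
      ring
    rw [pow_succ, End.mul_apply, hsplit, map_add, map_smul]
    rw [ih i' (by rw [← End.mul_apply, ← pow_succ]; exact hi) (j' + 1) (hcomm _ _ hj) (by omega),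
      ih (i' + 1) hi j' (by rw [← End.mul_apply, ← pow_succ]; exact hj) (by omega), smul_zero,
      add_zero]

/-- The shift of a two-sided sequence. -/
def shift (K : Type*) [Field K] : (ℤ → K) →ₐ[K] (ℤ → K) where
  toFun q := fun l => q (l + 1)
  map_one' := rfl
  map_mul' _ _ := rfl
  map_zero' := rfl
  map_add' _ _ := rfl
  commutes' _ := rfl

theorem shift_apply (q : ℤ → K) (l : ℤ) : shift K q l = q (l + 1) := rfl

/-- Sequences annihilated by a power of the shift minus the identity. -/
def unipotentSeq (K : Type*) [Field K] : Submodule K (ℤ → K) :=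
  End.maxGenEigenspace (shift K).toLinearMap 1

/-- These sequences play the role of polynomials in the exponent, in a form independent of the
characteristic. -/
theorem mul_mem_unipotentSeq {q r : ℤ → K} (hq : q ∈ unipotentSeq K) (hr : r ∈ unipotentSeq K) :
    q * r ∈ unipotentSeq K := by
  simpa [unipotentSeq] using mul_mem_maxGenEigenspace (shift K) hq hr

theorem const_mem_unipotentSeq (a : K) : (fun _ => a) ∈ unipotentSeq K := by
  refine (End.mem_maxGenEigenspace _ _ _).2 ⟨1, ?_⟩
  funext l
  simp [shift_apply]

theorem zpow_mem_eigenspace (α : Kˣ) : (fun k : ℤ => ((α ^ k : Kˣ) : K)) ∈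
    End.maxGenEigenspace (shift K).toLinearMap (α : K) := by
  refine (End.mem_maxGenEigenspace _ _ _).2 ⟨1, ?_⟩
  funext l
  simp [shift_apply, zpow_add₀ α.ne_zero, mul_comm]

/-- Double sequences `(k, l) ↦ α ^ k * q l` with `q` unipotent. -/
def expSpace (α : Kˣ) : Submodule K (ℤ × ℤ → K) where
  carrier := {F | ∃ q ∈ unipotentSeq K, ∀ k l, F (k, l) = ((α ^ k : Kˣ) : K) * q l}
  add_mem' := by
    rintro F G ⟨q, hq, hF⟩ ⟨r, hr, hG⟩
    exact ⟨q + r, add_mem hq hr, fun k l => by simp [hF, hG, mul_add]⟩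
  zero_mem' := ⟨0, zero_mem _, by simp⟩
  smul_mem' := by
    rintro a F ⟨q, hq, hF⟩
    refine ⟨a • q, Submodule.smul_mem _ a hq, fun k l => ?_⟩
    simp only [Pi.smul_apply, smul_eq_mul, hF]
    ring

theorem mul_mem_iSup_expSpace {F G : ℤ × ℤ → K} (hF : F ∈ ⨆ α : Kˣ, expSpace α)
    (hG : G ∈ ⨆ α : Kˣ, expSpace α) : F * G ∈ ⨆ α : Kˣ, expSpace α := by
  refine Submodule.iSup_induction _ (motive := fun F => F * G ∈ _) hF (fun α F hF => ?_) (by simp) fun x y hx hy => by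
    rw [add_mul]; exact add_mem hx hy
  refine Submodule.iSup_induction _ (motive := fun G => F * G ∈ _) hG (fun β G hG => ?_) (by simp) fun x y hx hy => by
    rw [mul_add]; exact add_mem hx hy
  obtain ⟨q, hq, hF⟩ := hF
  obtain ⟨r, hr, hG⟩ := hG
  refine Submodule.mem_iSup_of_mem (α * β) ⟨q * r, mul_mem_unipotentSeq hq hr, fun k l => ?_⟩
  simp only [Pi.mul_apply, hF, hG, mul_zpow, Units.val_mul]
  ring

/-- A sum of exponential times unipotent double sequences that vanishes on the diagonal is zero. -/
theorem eq_zero_of_diagonal {F : ℤ × ℤ → K} (hF : F ∈ ⨆ α : Kˣ, expSpace α)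
    (h : ∀ k, F (k, k) = 0) : F = 0 := by
  obtain ⟨f, hf, rfl⟩ := (Submodule.mem_iSup_iff_exists_finsupp _ _).1 hF
  -- On the diagonal the `α`-component becomes `α ^ k * q k`, a generalized eigenvector of the shift
  -- for `α`. Independence kills each component separately, and `α ^ k` is invertible, so every `q`
  -- is zero.
  have hind : iSupIndep fun α : Kˣ => End.maxGenEigenspace (shift K).toLinearMap (α : K) :=
    (End.independent_maxGenEigenspace (shift K).toLinearMap).comp Units.val_injective
  have hd : ∀ α : Kˣ, (fun k : ℤ => f α (k, k)) ∈
      End.maxGenEigenspace (shift K).toLinearMap (α : K) := by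
    intro α
    obtain ⟨q, hq, hF⟩ := hf α
    have := mul_mem_maxGenEigenspace (shift K) (zpow_mem_eigenspace α) hq
    rw [mul_one] at this
    convert! this using 1
    funext k
    exact hF k k
  have hz := (iSupIndep_iff_finsetSum_eq_zero_imp_eq_zero _).1 hind f.support
    (fun α => fun k : ℤ => f α (k, k)) (fun α _ => hd α) (by
      funext k
      have := h k
      simpa [Finsupp.sum, Finset.sum_apply] using this)
  refine Finset.sum_eq_zero fun α hα => ?_
  obtain ⟨q, hq, hF⟩ := hf α
  have hq0 : ∀ k, q k = 0 := fun k => by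
    have := congrFun (hz α hα) k
    exact (mul_eq_zero.1 ((hF k k).symm.trans this)).resolve_left (Units.ne_zero _)
  funext ⟨k, l⟩
  exact (hF k l).trans (by rw [hq0, mul_zero]; rfl)

end ExponentialPolynomials

/-! ### Powers of commuting semisimple and unipotent matrices; Jordan decomposition -/

section JordanDecomposition

variable {K : Type*} [Field K] {n : ℕ}

/-- Applying the shift minus the identity to `l ↦ (u ^ l v)_i` replaces `v` by `(u - 1)v`, so
nilpotency of `u - 1` is inherited. -/
theorem entry_zpow_mem_unipotentSeq {u : GL (Fin n) K}
    (hu : IsNilpotent ((u : Matrix (Fin n) (Fin n) K) - 1)) (v : Fin n → K) (i : Fin n) :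
    (fun l : ℤ => (((u ^ l : GL (Fin n) K) : Matrix (Fin n) (Fin n) K).mulVec v) i) ∈
      unipotentSeq K := by
  obtain ⟨m, hm⟩ := hu
  refine (End.mem_maxGenEigenspace _ _ _).2 ⟨m, ?_⟩
  have key : ∀ m (v : Fin n → K), (((shift K).toLinearMap - (1 : K) • (1 : End K (ℤ → K))) ^ m)
      (fun l : ℤ => (((u ^ l : GL (Fin n) K) : Matrix (Fin n) (Fin n) K).mulVec v) i) =
      fun l : ℤ => (((u ^ l : GL (Fin n) K) : Matrix (Fin n) (Fin n) K).mulVec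
        ((((u : Matrix (Fin n) (Fin n) K) - 1) ^ m).mulVec v)) i := by
    intro m
    induction m with
    | zero => intro v; simp
    | succ m ih =>
      intro v
      rw [pow_succ, End.mul_apply]
      have : ((shift K).toLinearMap - (1 : K) • (1 : End K (ℤ → K)))
          (fun l : ℤ => (((u ^ l : GL (Fin n) K) : Matrix (Fin n) (Fin n) K).mulVec v) i) =
          fun l : ℤ => (((u ^ l : GL (Fin n) K) : Matrix (Fin n) (Fin n) K).mulVec
            (((u : Matrix (Fin n) (Fin n) K) - 1).mulVec v)) i := by
        funext l
        simp [shift_apply, zpow_add_one, -Matrix.coe_units_zpow, Matrix.sub_mulVec, Matrix.mulVec_sub]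
      rw [this, ih]
      funext l
      simp only [pow_succ, Matrix.mulVec_mulVec]
  rw [key, hm]
  funext l
  simp

theorem isNilpotent_inv_sub_one {u : GL (Fin n) K}
    (hu : IsNilpotent ((u : Matrix (Fin n) (Fin n) K) - 1)) :
    IsNilpotent (((u⁻¹ : GL (Fin n) K) : Matrix (Fin n) (Fin n) K) - 1) := by
  have h1 : ((u⁻¹ : GL (Fin n) K) : Matrix (Fin n) (Fin n) K) * (u : Matrix (Fin n) (Fin n) K) = 1 := by
    rw [← Units.val_mul, inv_mul_cancel, Units.val_one]
  have h2 : (u : Matrix (Fin n) (Fin n) K) * ((u⁻¹ : GL (Fin n) K) : Matrix (Fin n) (Fin n) K) = 1 := by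
    rw [← Units.val_mul, mul_inv_cancel, Units.val_one]
  have : ((u⁻¹ : GL (Fin n) K) : Matrix (Fin n) (Fin n) K) - 1 =
      -((u⁻¹ : GL (Fin n) K) : Matrix (Fin n) (Fin n) K) * ((u : Matrix (Fin n) (Fin n) K) - 1) := by
    rw [mul_sub, neg_mul, neg_mul, h1, mul_one]; abel
  rw [this]
  refine Commute.isNilpotent_mul_left ?_ hu
  rw [Commute, SemiconjBy, mul_sub, sub_mul, neg_mul, mul_neg, h1, h2]
  simp

theorem eval_coord_zpow_mem_unipotentSeq {u : GL (Fin n) K}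
    (hu : IsNilpotent ((u : Matrix (Fin n) (Fin n) K) - 1)) (p : MvPolynomial (Coord n) K) :
    (fun l : ℤ => eval (coord (u ^ l)) p) ∈ unipotentSeq K := by
  induction p using MvPolynomial.induction_on with
  | C a => simpa using const_mem_unipotentSeq a
  | add p q hp hq => simpa using! add_mem hp hq
  | mul_X p i hp =>
    have hX : (fun l : ℤ => coord (u ^ l) i) ∈ unipotentSeq K := by
      rcases i with ⟨i, j⟩ | ⟨i, j⟩
      · simpa [coord] using entry_zpow_mem_unipotentSeq hu (Pi.single j 1) i
      · simpa [coord] using entry_zpow_mem_unipotentSeq (isNilpotent_inv_sub_one hu)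
          (Pi.single j 1) i
    simpa using! mul_mem_unipotentSeq hp hX

theorem units_mulVec_zpow {s : GL (Fin n) K} {α : Kˣ} {v : Fin n → K}
    (h : (s : Matrix (Fin n) (Fin n) K).mulVec v = (α : K) • v) (k : ℤ) :
    ((s ^ k : GL (Fin n) K) : Matrix (Fin n) (Fin n) K).mulVec v = ((α ^ k : Kˣ) : K) • v := by
  have hinv : ((s⁻¹ : GL (Fin n) K) : Matrix (Fin n) (Fin n) K).mulVec v
      = ((α⁻¹ : Kˣ) : K) • v := by
    have h1 := congrArg (fun w => ((α⁻¹ : Kˣ) : K) •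
      ((s⁻¹ : GL (Fin n) K) : Matrix (Fin n) (Fin n) K).mulVec w) h
    simp only [Matrix.mulVec_mulVec, Matrix.mulVec_smul, smul_smul, ← Units.val_mul,
      inv_mul_cancel, Units.val_one, Matrix.one_mulVec, one_smul] at h1
    exact h1.symm
  induction k using Int.induction_on with
  | zero => simp
  | succ k ih =>
    rw [zpow_add_one, zpow_add_one, Units.val_mul, ← Matrix.mulVec_mulVec, h, Matrix.mulVec_smul,
      ih, smul_smul, Units.val_mul, mul_comm]
  | pred k ih =>
    rw [zpow_sub_one, zpow_sub_one, Units.val_mul, ← Matrix.mulVec_mulVec, hinv,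
      Matrix.mulVec_smul, ih, smul_smul, Units.val_mul, mul_comm]

/-- By linearity `v` may be taken to be an eigenvector of `s`, with eigenvalue `α` say; then `s ^ k
* u ^ l` sends it to `α ^ k` times `u ^ l v`. -/
theorem entry_mem_iSup_expSpace {s u : GL (Fin n) K}
    (hs : ⨆ a, End.eigenspace (Matrix.toLin' (s : Matrix (Fin n) (Fin n) K)) a = ⊤)
    (hu : IsNilpotent ((u : Matrix (Fin n) (Fin n) K) - 1)) (hsu : Commute s u) (v : Fin n → K)
    (i : Fin n) :
    (fun kl : ℤ × ℤ => (((s ^ kl.1 * u ^ kl.2 : GL (Fin n) K) :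
      Matrix (Fin n) (Fin n) K).mulVec v) i) ∈ ⨆ α : Kˣ, expSpace α := by
  have hv : v ∈ ⨆ a, End.eigenspace (Matrix.toLin' (s : Matrix (Fin n) (Fin n) K)) a :=
    hs ▸ Submodule.mem_top
  refine Submodule.iSup_induction _ (motive := fun v => (fun kl : ℤ × ℤ =>
    (((s ^ kl.1 * u ^ kl.2 : GL (Fin n) K) : Matrix (Fin n) (Fin n) K).mulVec v) i) ∈ _) hv
    (fun a v hv => ?_) ?_ fun v w hv hw => ?_
  · rw [End.mem_eigenspace_iff, Matrix.toLin'_apply] at hv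
    by_cases ha : a = 0
    · have : v = 0 := by
        have h1 := congrArg (((s⁻¹ : GL (Fin n) K) : Matrix (Fin n) (Fin n) K).mulVec) hv
        rwa [Matrix.mulVec_mulVec, ← Units.val_mul, inv_mul_cancel, Units.val_one,
          Matrix.one_mulVec, ha, zero_smul, Matrix.mulVec_zero] at h1
      subst this
      convert! Submodule.zero_mem _ using 1
      funext kl
      simp
    · refine Submodule.mem_iSup_of_mem (Units.mk0 a ha)
        ⟨_, entry_zpow_mem_unipotentSeq hu v i, fun k l => ?_⟩
      change (((s ^ k * u ^ l : GL (Fin n) K) : Matrix (Fin n) (Fin n) K).mulVec v) i = _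
      rw [((hsu.zpow_zpow k l).eq : s ^ k * u ^ l = u ^ l * s ^ k), Units.val_mul,
        ← Matrix.mulVec_mulVec, units_mulVec_zpow (α := Units.mk0 a ha) hv, Matrix.mulVec_smul]
      simp
  · convert! Submodule.zero_mem _ using 1
    funext kl
    simp
  · convert! add_mem hv hw using 1
    funext kl
    simp [Matrix.mulVec_add]

theorem iSup_eigenspace_inv {s : GL (Fin n) K}
    (hs : ⨆ a, End.eigenspace (Matrix.toLin' (s : Matrix (Fin n) (Fin n) K)) a = ⊤) :
    ⨆ a, End.eigenspace (Matrix.toLin' ((s⁻¹ : GL (Fin n) K) : Matrix (Fin n) (Fin n) K)) a = ⊤ := by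
  rw [eq_top_iff, ← hs]
  refine iSup_le fun a v hv => ?_
  refine Submodule.mem_iSup_of_mem a⁻¹ ?_
  rw [End.mem_eigenspace_iff, Matrix.toLin'_apply] at hv ⊢
  have h1 := congrArg (((s⁻¹ : GL (Fin n) K) : Matrix (Fin n) (Fin n) K).mulVec) hv
  rw [Matrix.mulVec_mulVec, ← Units.val_mul, inv_mul_cancel, Units.val_one,
    Matrix.one_mulVec, Matrix.mulVec_smul] at h1
  by_cases ha : a = 0
  · rw [ha, zero_smul] at h1
    rw [h1]; simp
  · conv_rhs => rw [h1]
    rw [smul_smul, inv_mul_cancel₀ ha, one_smul]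

theorem eval_coord_mem_iSup_expSpace {s u : GL (Fin n) K}
    (hs : ⨆ a, End.eigenspace (Matrix.toLin' (s : Matrix (Fin n) (Fin n) K)) a = ⊤)
    (hu : IsNilpotent ((u : Matrix (Fin n) (Fin n) K) - 1)) (hsu : Commute s u)
    (p : MvPolynomial (Coord n) K) :
    (fun kl : ℤ × ℤ => eval (coord (s ^ kl.1 * u ^ kl.2)) p) ∈ ⨆ α : Kˣ, expSpace α := by
  induction p using MvPolynomial.induction_on with
  | C a =>
    refine Submodule.mem_iSup_of_mem 1 ⟨_, const_mem_unipotentSeq a, fun k l => ?_⟩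
    simp
  | add p q hp hq => simpa using! add_mem hp hq
  | mul_X p i hp =>
    have hX : (fun kl : ℤ × ℤ => coord (s ^ kl.1 * u ^ kl.2) i) ∈ ⨆ α : Kˣ, expSpace α := by
      rcases i with ⟨i, j⟩ | ⟨i, j⟩
      · simpa [coord, -Units.val_mul] using entry_mem_iSup_expSpace hs hu hsu (Pi.single j 1) i
      · have h := entry_mem_iSup_expSpace (iSup_eigenspace_inv hs) (isNilpotent_inv_sub_one hu)
          hsu.inv_inv (Pi.single j 1) i
        convert! h using 1
        funext kl
        have : (s ^ kl.1 * u ^ kl.2)⁻¹ = s⁻¹ ^ kl.1 * u⁻¹ ^ kl.2 := by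
          rw [(hsu.zpow_zpow kl.1 kl.2).eq, mul_inv_rev, inv_zpow, inv_zpow]
        simp [coord, this, -Units.val_mul]
    simpa using! mul_mem_iSup_expSpace hp hX

/-- The multiplicative Jordan decomposition. -/
theorem exists_jordan [IsAlgClosed K] (c : GL (Fin n) K) : ∃ s u : GL (Fin n) K,
    End.IsSemisimple (Matrix.toLin' (s : Matrix (Fin n) (Fin n) K)) ∧
    IsNilpotent ((u : Matrix (Fin n) (Fin n) K) - 1) ∧ Commute s u ∧ c = s * u := by
  let e := Matrix.toLinAlgEquiv' (R := K) (n := Fin n)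
  obtain ⟨N, hN, S, hS, hnil, hss, hc⟩ :=
    End.exists_isNilpotent_isSemisimple (f := e (c : Matrix (Fin n) (Fin n) K))
  have hcomm : Commute N S := Algebra.commute_of_mem_adjoin_singleton_of_commute hS
    (Algebra.commute_of_mem_adjoin_self hN).symm
  -- `S` is the unit `c` minus a commuting nilpotent. Below, `s⁻¹ * c - 1 = s⁻¹N` is nilpotent for
  -- the same reason.
  have hSu : IsUnit S := by
    have h1 : IsUnit (e (c : Matrix (Fin n) (Fin n) K)) := c.isUnit.map e
    have h2 := hnil.neg.isUnit_add_left_of_commute h1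
      ((Algebra.commute_of_mem_adjoin_self hN).symm.neg_left)
    rwa [hc, add_comm N S, add_neg_cancel_right] at h2
  obtain ⟨s, hs⟩ := hSu.map e.symm
  have hs' : e (s : Matrix (Fin n) (Fin n) K) = S := by rw [hs]; exact e.apply_symm_apply S
  have hcs : (c : Matrix (Fin n) (Fin n) K) = s + e.symm N := by
    apply e.injective
    rw [map_add, hs', hc, add_comm]
    congr 1
    exact (e.apply_symm_apply N).symm
  have hNs : Commute (s : Matrix (Fin n) (Fin n) K) (e.symm N) := by
    rw [hs]
    exact (hcomm.symm.map e.symm)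
  have hcomm' : Commute s c := by
    apply Units.ext
    rw [Units.val_mul, Units.val_mul, hcs]
    exact ((Commute.refl _).add_right hNs).eq
  refine ⟨s, s⁻¹ * c, ?_, ?_, ?_, by group⟩
  · rw [← hs'] at hss
    exact hss
  · have h1 : ((s⁻¹ : GL (Fin n) K) : Matrix (Fin n) (Fin n) K) * (s : Matrix (Fin n) (Fin n) K) = 1 := by
      rw [← Units.val_mul, inv_mul_cancel, Units.val_one]
    rw [Units.val_mul, hcs, mul_add, h1, add_sub_cancel_left]
    exact (Commute.units_inv_left hNs).isNilpotent_mul_left (hnil.map e.symm)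
  · exact ((Commute.refl s).inv_right).mul_right hcomm'

end JordanDecomposition

end CosetWeyl

namespace CosetWeyl

open MvPolynomial TopologicalSpace Module
open scoped MatrixGroups

/-! ### Closed diagonalizable groups can be conjugated to diagonal form -/

section DiagonalCharacters

variable {K : Type*} [Field K] {n : ℕ}

/-- The diagonal entries of a diagonal representation are characters. -/
def diagHom {G : Type*} [Group G] {m : ℕ} (ρ : G →* GL (Fin m) K)
    (h : ∀ c, (ρ c : Matrix (Fin m) (Fin m) K).IsDiag) (i : Fin m) : G →* Kˣ :=
  MonoidHom.toHomUnits
    { toFun := fun c => (ρ c : Matrix (Fin m) (Fin m) K) i i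
      map_one' := by simp
      map_mul' := fun c d => by
        rw [map_mul, Units.val_mul, ← (h c).diagonal_diag, Matrix.diagonal_mul]
        simp }

theorem diagHom_apply {G : Type*} [Group G] {m : ℕ} (ρ : G →* GL (Fin m) K)
    (h : ∀ c, (ρ c : Matrix (Fin m) (Fin m) K).IsDiag) (i : Fin m) (c : G) :
    (diagHom ρ h i c : K) = (ρ c : Matrix (Fin m) (Fin m) K) i i := rfl

theorem eq_one_of_diagHom {G : Type*} [Group G] {m : ℕ} (ρ : G →* GL (Fin m) K)
    (h : ∀ c, (ρ c : Matrix (Fin m) (Fin m) K).IsDiag) {c : G} (hc : ∀ i, diagHom ρ h i c = 1) :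
    ρ c = 1 := by
  ext i j
  by_cases hij : i = j
  · subst hij
    rw [← diagHom_apply ρ h, hc]
    simp
  · rw [h c hij]
    simp [hij]

theorem IsDiagonalizable.mul_comm {C : Subgroup (GL (Fin n) K)} (hC : IsDiagonalizable C)
    {c d : GL (Fin n) K} (hc : c ∈ C) (hd : d ∈ C) : c * d = d * c := by
  obtain ⟨m, ρ, -, hinj, hdiag⟩ := hC
  have : (⟨c, hc⟩ * ⟨d, hd⟩ : C) = ⟨d, hd⟩ * ⟨c, hc⟩ := by
    apply hinj
    rw [map_mul, map_mul]
    apply Units.ext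
    rw [Units.val_mul, Units.val_mul, ← (hdiag ⟨c, hc⟩).diagonal_diag,
      ← (hdiag ⟨d, hd⟩).diagonal_diag, Matrix.diagonal_mul_diagonal, Matrix.diagonal_mul_diagonal]
    simp only [_root_.mul_comm]
  exact congrArg Subtype.val this

/-- For a diagonal character with value `α` at `u`, the sequence `α ^ l` is both an eigenvector of
the shift for `α` and a unipotent sequence; a nonzero sequence can be both only if `α = 1`.
Faithfulness of `ρ` finishes. -/
theorem IsDiagonalizable.eq_one_of_unipotent {C : Subgroup (GL (Fin n) K)}
    (hC : IsDiagonalizable C) {u : GL (Fin n) K} (hu : u ∈ C)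
    (hnil : IsNilpotent ((u : Matrix (Fin n) (Fin n) K) - 1)) : u = 1 := by
  obtain ⟨m, ρ, hreg, hinj, hdiag⟩ := hC
  have h1 : ρ ⟨u, hu⟩ = 1 := by
    refine eq_one_of_diagHom ρ hdiag fun i => ?_
    obtain ⟨p, hp⟩ := hreg i i
    let α : Kˣ := diagHom ρ hdiag i ⟨u, hu⟩
    have hq : (fun l : ℤ => ((α ^ l : Kˣ) : K)) ∈ unipotentSeq K := by
      convert! eval_coord_zpow_mem_unipotentSeq hnil p using 1
      funext l
      rw [← map_zpow, diagHom_apply]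
      exact hp _
    by_contra hα
    have hdis := End.disjoint_genEigenspace (shift K).toLinearMap
      (fun h => hα (Units.ext h) : (α : K) ≠ 1) ⊤ ⊤
    have := Submodule.disjoint_def.1 hdis _ (zpow_mem_eigenspace α) hq
    simpa using congrFun this 0
  have h2 : (⟨u, hu⟩ : C) = 1 := hinj (by rw [h1, map_one])
  exact congrArg Subtype.val h2

/-- If `p` vanishes on `C`, then `(k, l) ↦ p(s ^ k * u ^ l)` vanishes on the diagonal, where it is
evaluated at `(su) ^ k ∈ C`. Hence it vanishes everywhere, in particular at `(0, 1)`. -/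
theorem unipotent_mem_of_isClosed {C : Subgroup (GL (Fin n) K)}
    (hC : DefinedOver K (C : Set (GL (Fin n) K))) {s u : GL (Fin n) K}
    (hs : ⨆ a, End.eigenspace (Matrix.toLin' (s : Matrix (Fin n) (Fin n) K)) a = ⊤)
    (hu : IsNilpotent ((u : Matrix (Fin n) (Fin n) K) - 1)) (hsu : Commute s u)
    (h : s * u ∈ C) : u ∈ C := by
  obtain ⟨I, hI⟩ := hC
  rw [← SetLike.mem_coe, hI]
  intro p hp
  have h0 := eq_zero_of_diagonal (eval_coord_mem_iSup_expSpace hs hu hsu p) fun k => by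
    have hk : (s * u) ^ k ∈ (C : Set (GL (Fin n) K)) := C.zpow_mem h k
    rw [hI] at hk
    have := hk p hp
    rwa [hsu.mul_zpow] at this
  have := congrFun h0 (0, 1)
  rw [aeval_eq_eval]
  simpa using this

theorem IsDiagonalizable.isSemisimple [IsAlgClosed K] {C : Subgroup (GL (Fin n) K)}
    (hC : IsDiagonalizable C) (hc : DefinedOver K (C : Set (GL (Fin n) K))) {c : GL (Fin n) K}
    (h : c ∈ C) :
    End.IsSemisimple (Matrix.toLin' (c : Matrix (Fin n) (Fin n) K)) := by
  obtain ⟨s, u, hs, hu, hsu, rfl⟩ := exists_jordan c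
  have := hC.eq_one_of_unipotent
    (unipotent_mem_of_isClosed hc hs.iSup_eigenspace_eq_top hu hsu h) hu
  subst this
  rwa [mul_one]

/-- A closed diagonalizable subgroup of `GL n` is conjugate to a group of diagonal matrices. -/
theorem IsDiagonalizable.exists_conj [IsAlgClosed K] {C : Subgroup (GL (Fin n) K)}
    (hC : IsDiagonalizable C) (hcl : DefinedOver K (C : Set (GL (Fin n) K))) :
    ∃ P : GL (Fin n) K, ∀ c ∈ C,
      ((P⁻¹ * c * P : GL (Fin n) K) : Matrix (Fin n) (Fin n) K).IsDiag := by
  let f : C → End K (Fin n → K) := fun c =>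
    Matrix.toLin' ((c : GL (Fin n) K) : Matrix (Fin n) (Fin n) K)
  have hcomm : ∀ c d : C, Commute (f c) (f d) := fun c d => by
    have : ((c : GL (Fin n) K) : Matrix (Fin n) (Fin n) K) * ((d : GL (Fin n) K) : Matrix _ _ K) =
        ((d : GL (Fin n) K) : Matrix _ _ K) * ((c : GL (Fin n) K) : Matrix _ _ K) := by
      rw [← Units.val_mul, hC.mul_comm c.2 d.2, Units.val_mul]
    rw [Commute, SemiconjBy]
    change Matrix.toLin' _ * Matrix.toLin' _ = Matrix.toLin' _ * Matrix.toLin' _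
    rw [End.mul_eq_comp, End.mul_eq_comp, ← Matrix.toLin'_mul, ← Matrix.toLin'_mul, this]
  have htop := End.iSup_iInf_maxGenEigenspace_eq_top_of_forall_mapsTo f
    (fun c d a => End.mapsTo_maxGenEigenspace_of_comm (hcomm d c) a)
    (fun c => End.iSup_maxGenEigenspace_eq_top (f c))
  have heig : ∀ (c : C) (a : K) (v : Fin n → K), v ∈ (f c).maxGenEigenspace a → f c v = a • v := by
    intro c a v hv
    have hss : (f c).IsFinitelySemisimple :=
      End.isFinitelySemisimple_iff_isSemisimple.2 (hC.isSemisimple hcl c.2)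
    rw [hss.maxGenEigenspace_eq_eigenspace] at hv
    exact End.mem_eigenspace_iff.1 hv
  -- Common eigenvectors span, because commuting semisimple operators have joint eigenspaces
  -- spanning the space; `P` has as columns a basis chosen among them.
  let E : Set (Fin n → K) := {v | ∀ c : C, ∃ a : K, f c v = a • v}
  have hspan : ⊤ ≤ Submodule.span K E := by
    rw [← htop]
    refine iSup_le fun χ v hv => Submodule.subset_span fun c => ⟨χ c, heig c _ v ?_⟩
    exact (Submodule.mem_iInf _).1 hv c
  let b₀ := Basis.ofSpan hspan
  have := Module.Finite.finite_basis b₀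
  let b := b₀.reindex (Finite.equivFinOfCardEq (n := n) (by
    rw [← Module.finrank_eq_nat_card_basis b₀]; simp))
  have hb : ∀ j, b j ∈ E := fun j => by
    rw [Basis.reindex_apply]
    exact Basis.ofSpan_subset hspan ⟨_, rfl⟩
  let _ := (Pi.basisFun K (Fin n)).invertibleToMatrix b
  let P : GL (Fin n) K := unitOfInvertible ((Pi.basisFun K (Fin n)).toMatrix b)
  have hP : ∀ j, (P : Matrix (Fin n) (Fin n) K).mulVec (Pi.single j 1) = b j := fun j => by
    funext i
    simp [P, Basis.toMatrix_apply]
  refine ⟨P, fun c hc i j hij => ?_⟩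
  obtain ⟨a, ha⟩ := hb j ⟨c, hc⟩
  have h1 : ((P⁻¹ * c * P : GL (Fin n) K) : Matrix (Fin n) (Fin n) K).mulVec (Pi.single j 1) =
      a • Pi.single j 1 := by
    have ha' : (c : Matrix (Fin n) (Fin n) K).mulVec (b j) = a • b j := ha
    rw [Units.val_mul, Units.val_mul, ← Matrix.mulVec_mulVec, hP, ← Matrix.mulVec_mulVec, ha',
      Matrix.mulVec_smul, ← hP, Matrix.mulVec_mulVec, ← Units.val_mul, inv_mul_cancel,
      Units.val_one, Matrix.one_mulVec]
  have h2 := congrFun h1 i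
  simpa [hij] using h2

end DiagonalCharacters

/-! ### Generators of the character group -/

section DiagonalCoordinates

variable {K : Type*} [Field K] {n : ℕ}

/-- The conjugation representation `c ↦ P⁻¹ c P` of a subgroup. -/
def conjRep (C : Subgroup (GL (Fin n) K)) (P : GL (Fin n) K) : C →* GL (Fin n) K :=
  (MulAut.conj P⁻¹).toMonoidHom.comp C.subtype

theorem conjRep_apply (C : Subgroup (GL (Fin n) K)) (P : GL (Fin n) K) (c : C) :
    conjRep C P c = P⁻¹ * c * P := by
  simp [conjRep]

theorem isRegular_conjRep (C : Subgroup (GL (Fin n) K)) (P : GL (Fin n) K) (i j : Fin n) :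
    IsRegular C fun c => (conjRep C P c : Matrix (Fin n) (Fin n) K) i j := by
  obtain ⟨q, hq⟩ := exists_translate P⁻¹ P
  refine ⟨q (Sum.inl (i, j)), fun c => ?_⟩
  have h := congrFun (hq c) (Sum.inl (i, j))
  rw [← conjRep_apply] at h
  exact h

/-- Every character of a diagonal group is a product of diagonal entries and their inverses. -/
theorem mem_closure_diagHom {C : Subgroup (GL (Fin n) K)} {P : GL (Fin n) K}
    (hP : ∀ c, (conjRep C P c : Matrix (Fin n) (Fin n) K).IsDiag) {χ : C →* Kˣ}
    (hχ : χ ∈ charGroup C) : χ ∈ Subgroup.closure (Set.range (diagHom (conjRep C P) hP)) := by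
  set Γ := Subgroup.closure (Set.range (diagHom (conjRep C P) hP)) with hΓ
  let v : (C →* Kˣ) → C → K := fun χ c => (χ c : K)
  have hli : LinearIndependent K v := by
    refine (linearIndependent_monoidHom C K).comp
      (fun χ : C →* Kˣ => (Units.coeHom K).comp χ) fun χ ψ h => ?_
    ext c
    exact DFunLike.congr_fun h c
  -- `V` turns out to be an algebra containing all coordinates, hence all regular functions. So `χ`
  -- is a linear combination of characters in `Γ`, and independence of characters puts `χ` itself in
  -- `Γ`.
  let V := Submodule.span K (v '' (Γ : Set (C →* Kˣ)))
  have hmul : ∀ x ∈ V, ∀ y ∈ V, x * y ∈ V := by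
    intro x hx y hy
    have h1 := Submodule.mul_mem_mul hx hy
    rw [Submodule.span_mul_span] at h1
    refine Submodule.span_mono ?_ h1
    rintro _ ⟨_, ⟨χ, hχ, rfl⟩, _, ⟨ψ, hψ, rfl⟩, rfl⟩
    exact ⟨χ * ψ, Γ.mul_mem hχ hψ, rfl⟩
  have hcoord : ∀ i, (fun c : C => coord (c : GL (Fin n) K) i) ∈ V := by
    have key : ∀ (η : Fin n → (C →* Kˣ)) (_ : ∀ a, η a ∈ Γ) (i j : Fin n),
        (fun c : C => ∑ a, (P : Matrix (Fin n) (Fin n) K) i a * (η a c : K) *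
          ((P⁻¹ : GL (Fin n) K) : Matrix (Fin n) (Fin n) K) a j) ∈ V := by
      intro η hη i j
      have : (fun c : C => ∑ a, (P : Matrix (Fin n) (Fin n) K) i a * (η a c : K) *
          ((P⁻¹ : GL (Fin n) K) : Matrix (Fin n) (Fin n) K) a j) =
          ∑ a, ((P : Matrix (Fin n) (Fin n) K) i a *
            ((P⁻¹ : GL (Fin n) K) : Matrix (Fin n) (Fin n) K) a j) • v (η a) := by
        funext c
        simp only [Finset.sum_apply, Pi.smul_apply, smul_eq_mul, v]
        exact Finset.sum_congr rfl fun a _ => by ring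
      rw [this]
      exact Submodule.sum_mem _ fun a _ => Submodule.smul_mem _ _
        (Submodule.subset_span ⟨_, hη a, rfl⟩)
    have hmat : ∀ (c : C), ((c : GL (Fin n) K) : Matrix (Fin n) (Fin n) K) =
        (P : Matrix (Fin n) (Fin n) K) * Matrix.diagonal
          (fun a => (diagHom (conjRep C P) hP a c : K)) *
          ((P⁻¹ : GL (Fin n) K) : Matrix (Fin n) (Fin n) K) := by
      intro c
      have h1 : Matrix.diagonal (fun a => (diagHom (conjRep C P) hP a c : K)) =
          (conjRep C P c : Matrix (Fin n) (Fin n) K) := (hP c).diagonal_diag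
      rw [h1, ← Units.val_mul, ← Units.val_mul, conjRep_apply]
      congr 1
      group
    rintro (⟨i, j⟩ | ⟨i, j⟩)
    · convert! key (diagHom (conjRep C P) hP)
        (fun a => Subgroup.subset_closure ⟨a, rfl⟩) i j using 1
      funext c
      simp only [coord, Sum.elim_inl]
      rw [hmat c, Matrix.mul_apply]
      simp [Matrix.mul_diagonal]
    · convert! key (fun a => (diagHom (conjRep C P) hP a)⁻¹)
        (fun a => Γ.inv_mem (Subgroup.subset_closure ⟨a, rfl⟩)) i j using 1
      funext c
      simp only [coord, Sum.elim_inr]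
      rw [← InvMemClass.coe_inv, hmat c⁻¹, Matrix.mul_apply]
      simp [Matrix.mul_diagonal]
  have hone : (1 : C → K) ∈ V := Submodule.subset_span ⟨1, Γ.one_mem, rfl⟩
  have hpoly : ∀ p : MvPolynomial (Coord n) K,
      (fun c : C => eval (coord (c : GL (Fin n) K)) p) ∈ V := by
    intro p
    induction p using MvPolynomial.induction_on with
    | C a =>
      convert! Submodule.smul_mem V a hone using 1
      funext c
      simp
    | add p q hp hq => simpa using! add_mem hp hq
    | mul_X p i hp => simpa using! hmul _ hp _ (hcoord i)
  obtain ⟨p, hp⟩ := hχ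
  have hχV : v χ ∈ V := by
    convert! hpoly p using 1
    funext c
    exact hp c
  by_contra hn
  exact hli.notMem_span_image hn hχV

end DiagonalCoordinates

/-! ### Regular elements of the generating coset -/

section RegularElements

attribute [local instance] zariski

variable {K : Type*} [Field K] {n : ℕ}

/-- The elements of `g C°` whose centralizer equals the centralizer of `C` contain the complement of a
proper hypersurface. -/
theorem exists_regular {C : Subgroup (GL (Fin n) K)} (hcl : IsClosed (C : Set (GL (Fin n) K)))
    {P : GL (Fin n) K} (hP : ∀ c, (conjRep C P c : Matrix (Fin n) (Fin n) K).IsDiag)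
    {g : GL (Fin n) K} (hg : GeneratesComponents C g) :
    ∃ f : MvPolynomial (Coord n) K, f ∉ vanIdeal coord (idComp C : Set (GL (Fin n) K)) ∧
      ∀ s ∈ idComp C, eval (coord s) f ≠ 0 →
        ∀ z : GL (Fin n) K, Commute z (g * s) → ∀ c ∈ C, Commute z c := by
  classical
  obtain ⟨q, hq⟩ := (((IsRegularMap.const (κ := coord) P⁻¹).mul
    ((IsRegularMap.const g).mul IsRegularMap.id)).mul (IsRegularMap.const P) :
    IsRegularMap coord coord fun s : GL (Fin n) K => P⁻¹ * (g * s) * P)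
  let ε := diagHom (conjRep C P) hP
  have hε : ∀ (s : GL (Fin n) K) (hs : g * s ∈ C) i,
      (ε i ⟨g * s, hs⟩ : K) = eval (coord s) (q (Sum.inl (i, i))) := by
    intro s hs i
    rw [diagHom_apply, conjRep_apply, ← congrFun (hq s)]
    rfl
  have hmem : ∀ s ∈ idComp C, g * s ∈ C := fun s hs => C.mul_mem hg.1 (idComp_le C hs)
  -- A discriminant: the product of `ε i - ε j` at `g * s` over the pairs of diagonal characters
  -- that differ on `C`. If it vanished on `C°`, primality would make some such pair agree on `gC°`,
  -- hence at `g` and on `C°`, hence on all of `C`.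
  refine ⟨∏ ij ∈ Finset.univ.filter (fun ij : Fin n × Fin n => ε ij.1 ≠ ε ij.2),
    (q (Sum.inl (ij.1, ij.1)) - q (Sum.inl (ij.2, ij.2))), ?_, ?_⟩
  · have hprime := isAffineChart_coord.isPrime_vanIdeal (isIrreducible_idComp hcl)
    rw [hprime.prod_mem_iff]
    rintro ⟨⟨i, j⟩, hij, h⟩
    refine (Finset.mem_filter.1 hij).2 ?_
    have h1 : ∀ s (hs : s ∈ idComp C), ε i ⟨g * s, hmem s hs⟩ = ε j ⟨g * s, hmem s hs⟩ := by
      intro s hs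
      apply Units.ext
      rw [hε, hε]
      simpa [sub_eq_zero] using h s hs
    have hgg : ε i ⟨g, hg.1⟩ = ε j ⟨g, hg.1⟩ := by
      simpa using h1 1 (idComp C).one_mem
    have h2 : ∀ s (hs : s ∈ idComp C), ε i ⟨s, idComp_le C hs⟩ = ε j ⟨s, idComp_le C hs⟩ := by
      intro s hs
      have h3 := h1 s hs
      have h4 : (⟨g * s, hmem s hs⟩ : C) = ⟨g, hg.1⟩ * ⟨s, idComp_le C hs⟩ := rfl
      rw [h4, map_mul, map_mul, hgg] at h3
      exact mul_left_cancel h3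
    ext ⟨c, hc⟩
    obtain ⟨m, hm⟩ := hg.2 c hc
    have h5 : (⟨c, hc⟩ : C) = ⟨_, idComp_le C hm⟩ * ⟨g, hg.1⟩ ^ m := by
      apply Subtype.ext
      simp
    rw [h5, map_mul, map_mul, map_zpow, map_zpow, h2 _ hm, hgg]
  · intro s hs hne z hz c hc
    have hne' : ∀ i j, ε i ≠ ε j → ε i ⟨g * s, hmem s hs⟩ ≠ ε j ⟨g * s, hmem s hs⟩ := by
      intro i j hij he
      rw [map_prod] at hne
      refine Finset.prod_ne_zero_iff.1 hne (i, j) (by simpa using hij) ?_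
      rw [map_sub, ← hε s (hmem s hs), ← hε s (hmem s hs), he, sub_self]
    have hdiag : ∀ (d : C), (conjRep C P d : Matrix (Fin n) (Fin n) K) =
        Matrix.diagonal fun a => (ε a d : K) := fun d => ((hP d).diagonal_diag).symm
    let z' : GL (Fin n) K := P⁻¹ * z * P
    have hconj : ∀ d : C, Commute z (d : GL (Fin n) K) ↔ Commute z' (conjRep C P d) := by
      intro d
      rw [conjRep_apply]
      simp only [Commute, SemiconjBy, z']
      constructor
      · intro h
        calc P⁻¹ * z * P * (P⁻¹ * d * P) = P⁻¹ * (z * d) * P := by group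
          _ = P⁻¹ * (d * z) * P := by rw [h]
          _ = _ := by group
      · intro h
        calc z * d = P * (P⁻¹ * z * P * (P⁻¹ * d * P)) * P⁻¹ := by group
          _ = P * (P⁻¹ * d * P * (P⁻¹ * z * P)) * P⁻¹ := by rw [h]
          _ = _ := by group
    have hz' := (hconj ⟨g * s, hmem s hs⟩).1 hz
    refine (hconj ⟨c, hc⟩).2 ?_
    -- Entrywise, commuting with a diagonal matrix means that `z'` has a nonzero `(i, j)` entry only
    -- where the diagonal values agree. At a regular element they agree only for `ε i = ε j`, and
    -- then they agree throughout `C`.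
    have hmul : ∀ d : C, Commute z' (conjRep C P d) ↔ ∀ i j,
        (z' : Matrix (Fin n) (Fin n) K) i j * (ε j d : K) =
          (ε i d : K) * (z' : Matrix (Fin n) (Fin n) K) i j := by
      intro d
      clear_value z'
      rw [Commute, SemiconjBy, ← Units.val_inj, Units.val_mul, Units.val_mul, hdiag, ← Matrix.ext_iff]
      refine forall₂_congr fun i j => ?_
      rw [Matrix.mul_diagonal, Matrix.diagonal_mul]
    rw [hmul] at hz' ⊢
    intro i j
    by_cases hij : ε i = ε j
    · rw [hij, _root_.mul_comm]
    · have h6 := hz' i j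
      have h7 : (z' : Matrix (Fin n) (Fin n) K) i j = 0 := by
        by_contra h0
        refine hne' i j hij (Units.ext ?_)
        rw [_root_.mul_comm] at h6
        exact (mul_right_cancel₀ h0 h6).symm
      rw [h7, zero_mul, mul_zero]

end RegularElements

end CosetWeyl

namespace CosetWeyl

open MvPolynomial TopologicalSpace Module
open scoped MatrixGroups

/-! ### Arithmetic of dimensions -/

section DimensionLemmas

/-- A chain in `F` is a chain in its largest member. This reduces bounds on fibres, which may be
reducible, to irreducible sets. -/
theorem zdim_le_of_forall {M : Type*} [TopologicalSpace M] {F : Set M} {d : WithBot ℕ∞}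
    (h : ∀ T : IrreducibleCloseds M, (T : Set M) ⊆ F → zdim (T : Set M) ≤ d) : zdim F ≤ d := by
  refine iSup_le fun l => le_trans ?_ (h l.last.1 l.last.2)
  let l' : LTSeries {T : IrreducibleCloseds M // (T : Set M) ⊆ (l.last.1 : Set M)} :=
    { length := l.length
      toFun := fun i => ⟨(l i).1, (LTSeries.monotone l (Fin.le_last i) : l i ≤ l.last)⟩
      step := fun i => l.step i }
  exact le_iSup (fun p : LTSeries _ => (p.length : WithBot ℕ∞)) l'

theorem le_of_natCast_add_le_add {a b : ℕ} {x : WithBot ℕ∞} (h : (a : WithBot ℕ∞) + b ≤ x + b) :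
    (a : WithBot ℕ∞) ≤ x := by
  induction x with
  | bot =>
    rw [WithBot.bot_add, le_bot_iff] at h
    exact absurd h (by exact_mod_cast WithBot.coe_ne_bot (a := ((a + b : ℕ) : ℕ∞)))
  | coe e =>
    induction e using ENat.recTopCoe with
    | top => exact le_top
    | coe k =>
      have h' : a + b ≤ k + b := by exact_mod_cast h
      exact_mod_cast Nat.le_of_add_le_add_right h'

theorem exists_zdim_eq_natCast {K σ M : Type*} [Field K] [Finite σ] [TopologicalSpace M]
    {κ : M → σ → K} (hκ : IsAffineChart κ) {F : Set M} (hF : IsIrreducible F) (hFc : IsClosed F) :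
    ∃ d : ℕ, zdim F = d := by
  have : Nonempty {T : IrreducibleCloseds M // (T : Set M) ⊆ F} := ⟨⟨⟨F, hF, hFc⟩, subset_rfl⟩⟩
  have h0 : 0 ≤ zdim F := Order.krullDim_nonneg
  have h1 := hκ.zdim_lt_top F
  obtain ⟨e, he⟩ := WithBot.ne_bot_iff_exists.1 (ne_bot_of_le_ne_bot (by simp) h0)
  rw [← he] at h1 ⊢
  obtain ⟨d, hd⟩ := ENat.ne_top_iff_exists.1 (WithBot.coe_lt_coe.1 h1).ne
  exact ⟨d, by rw [← hd]; rfl⟩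

theorem succ_le_zdim {M : Type*} [TopologicalSpace M] {Y Z : Set M} (hYZ : Y ⊂ Z)
    (hZ : IsIrreducible Z) (hZc : IsClosed Z) {d : ℕ} (h : d ≤ zdim Y) :
    ((d + 1 : ℕ) : WithBot ℕ∞) ≤ zdim Z := by
  obtain ⟨l, hl⟩ := Order.le_krullDim_iff.1 h
  let l' : LTSeries {T : IrreducibleCloseds M // (T : Set M) ⊆ Z} :=
    l.map (fun T => ⟨T.1, T.2.trans hYZ.subset⟩) fun _ _ h => h
  have hlt : l'.last < ⟨⟨Z, hZ, hZc⟩, subset_rfl⟩ := by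
    refine lt_of_le_of_ne l'.last.2 fun he => hYZ.not_subset ?_
    have h1 : (l.last.1 : Set M) = Z := congrArg (fun T => ((T.1 : IrreducibleCloseds M) : Set M)) he
    rw [← h1]
    exact l.last.2
  exact Order.le_krullDim_iff.2 ⟨RelSeries.snoc l' _ hlt, congrArg (· + 1) hl⟩

end DimensionLemmas

/-! ### Conjugacy of Cartan subgroups of a coset -/

section Conjugacy

attribute [local instance] zariski pairZariski

variable {K : Type*} [Field K] {n : ℕ}

theorem IsCartan.isClosed {H C : Subgroup (GL (Fin n) K)} (hC : IsCartan H C) :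
    IsClosed (C : Set (GL (Fin n) K)) := (isClosed_zariski_iff _).2 hC.closed

/-- An inclusion `t C t⁻¹ ⊆ C` is an equality. -/
theorem mem_normalizer_of_conj_le {C : Subgroup (GL (Fin n) K)}
    (hC : IsClosed (C : Set (GL (Fin n) K))) {t : GL (Fin n) K}
    (h : ∀ c ∈ C, t * c * t⁻¹ ∈ C) : t ∈ Subgroup.normalizer (C : Set (GL (Fin n) K)) := by
  have := noetherianSpace_zariski (K := K) (n := n)
  -- The groups `t ^ k C t ^ (-k)` form a descending chain of closed sets, so two consecutive ones
  -- agree; conjugating back gives `C = tCt⁻¹`.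
  let D : ℕ → Closeds (GL (Fin n) K) := fun k =>
    ⟨{x | (t ^ k)⁻¹ * x * t ^ k ∈ C}, by
      have := hC.preimage (continuous_translate (t ^ k)⁻¹ (t ^ k))
      exact this⟩
  obtain ⟨_, ⟨k, rfl⟩, hmin⟩ := (wellFounded_lt (α := Closeds (GL (Fin n) K))).has_min
    (Set.range D) ⟨_, 0, rfl⟩
  have hle : D (k + 1) ≤ D k := fun x hx => by
    have h1 := h _ (hx : (t ^ (k + 1))⁻¹ * x * t ^ (k + 1) ∈ C)
    have h2 : t * ((t ^ (k + 1))⁻¹ * x * t ^ (k + 1)) * t⁻¹ = (t ^ k)⁻¹ * x * t ^ k := by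
      rw [pow_succ]; group
    rw [h2] at h1
    exact h1
  have heq : D k ≤ D (k + 1) := by
    by_contra hn
    exact hmin _ ⟨k + 1, rfl⟩ (lt_of_le_not_ge hle hn)
  refine Subgroup.mem_normalizer_iff.2 fun c => ⟨h c, fun hc => ?_⟩
  have h1 : t ^ k * (t * c * t⁻¹) * (t ^ k)⁻¹ ∈ D k := by
    change (t ^ k)⁻¹ * (t ^ k * (t * c * t⁻¹) * (t ^ k)⁻¹) * t ^ k ∈ C
    convert! hc using 1
    group
  have h2 : (t ^ (k + 1))⁻¹ * (t ^ k * (t * c * t⁻¹) * (t ^ k)⁻¹) * t ^ (k + 1) ∈ C := heq h1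
  convert! h2 using 1
  rw [pow_succ]
  group

/-- If `t` conjugates an element of `g C°` to a regular element of `g' C'°`, then it conjugates `C`
into `C'`. -/
theorem IsCartan.conj_mem {H C C' : Subgroup (GL (Fin n) K)} (hC : IsCartan H C)
    (hC' : IsCartan H C') {g g' s s' t : GL (Fin n) K} (hg : GeneratesComponents C g)
    (hg' : GeneratesComponents C' g') (hs : s ∈ idComp C) (hs' : s' ∈ idComp C') (ht : t ∈ H)
    (hreg : ∀ z : GL (Fin n) K, Commute z (g' * s') → ∀ c ∈ C', Commute z c)
    (hconj : t * (g * s) * t⁻¹ = g' * s') : ∀ c ∈ C, t * c * t⁻¹ ∈ C' := by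
  have hgs : g * s ∈ C := C.mul_mem hg.1 (idComp_le C hs)
  have hmul : ∀ x y : GL (Fin n) K, t * (x * y) * t⁻¹ = (t * x * t⁻¹) * (t * y * t⁻¹) :=
    fun x y => by group
  -- `c` commutes with `g * s`, so its conjugate commutes with the regular element `g' * s'`, and
  -- therefore with all of `C'`.
  have hcomm : ∀ c ∈ C, ∀ d ∈ C', Commute (t * c * t⁻¹) d := by
    intro c hc d hd
    refine hreg _ ?_ d hd
    rw [← hconj, Commute, SemiconjBy, ← hmul, ← hmul, hC.diagonalizable.mul_comm hc hgs]
  -- The image centralizes `C'`, so it lies in `N_H(C')`, where `C'` has finite index; being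
  -- irreducible and containing `1`, it falls into `C'`.
  have hS : (fun x => t * x * t⁻¹) '' (idComp C : Set (GL (Fin n) K)) ⊆ C' := by
    refine subset_of_relIndex_ne_zero hC'.isClosed hC'.finite_index
      ((isIrreducible_idComp hC.isClosed).image _ (continuous_conj_zariski t).continuousOn) ?_
      ⟨1, (idComp C).one_mem, by simp⟩
    rintro _ ⟨x, hx, rfl⟩
    refine ⟨Subgroup.mem_normalizer_iff.2 fun d => ?_,
      H.mul_mem (H.mul_mem ht (hC.le (idComp_le C hx))) (H.inv_mem ht)⟩
    have hx' := hcomm x (idComp_le C hx)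
    constructor
    · intro hd
      rw [(hx' d hd).eq, mul_inv_cancel_right]
      exact hd
    · intro hd
      have h1 := (hx' _ hd).eq
      have h2 : d = t * x * t⁻¹ * d * (t * x * t⁻¹)⁻¹ := by
        have h3 : t * x * t⁻¹ * d * (t * x * t⁻¹)⁻¹ * (t * x * t⁻¹) = t * x * t⁻¹ * d := by group
        rw [h3] at h1
        exact (mul_left_cancel h1).symm
      rw [h2]
      exact hd
  have hgt : t * g * t⁻¹ ∈ C' := by
    have h1 : t * g * t⁻¹ = (g' * s') * (t * s⁻¹ * t⁻¹) := by
      rw [← hconj]; group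
    rw [h1]
    exact C'.mul_mem (C'.mul_mem hg'.1 (idComp_le C' hs')) (hS ⟨_, (idComp C).inv_mem hs, rfl⟩)
  intro c hc
  obtain ⟨m, hm⟩ := hg.2 c hc
  have h1 : t * c * t⁻¹ = (t * (c * (g ^ m)⁻¹) * t⁻¹) * (t * g * t⁻¹) ^ m := by
    rw [conj_zpow]; group
  rw [h1]
  exact C'.mul_mem (hS ⟨_, hm, rfl⟩) (C'.zpow_mem hgt m)

theorem isRegularMap_conj (g : GL (Fin n) K) :
    IsRegularMap pairCoord coord fun z : GL (Fin n) K × GL (Fin n) K => z.1 * (g * z.2) * z.1⁻¹ :=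
  (isRegularMap_fst.mul ((IsRegularMap.const g).mul isRegularMap_snd)).mul isRegularMap_fst.inv

/-- The fibres of `(h, s) ↦ h (g s) h⁻¹` over regular elements. -/
theorem IsCartan.zdim_fibre_le {H C : Subgroup (GL (Fin n) K)} (hC : IsCartan H C)
    {g s₀ : GL (Fin n) K} (hg : GeneratesComponents C g) (hs₀ : s₀ ∈ idComp C)
    (hreg : ∀ z : GL (Fin n) K, Commute z (g * s₀) → ∀ c ∈ C, Commute z c) :
    zdim (((idComp H : Set (GL (Fin n) K)) ×ˢ (idComp C : Set (GL (Fin n) K))) ∩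
      (fun z : GL (Fin n) K × GL (Fin n) K => z.1 * (g * z.2) * z.1⁻¹) ⁻¹' {g * s₀}) ≤
      zdim (idComp C : Set (GL (Fin n) K)) := by
  refine zdim_le_of_forall fun T hT => ?_
  let B := Subgroup.normalizer (C : Set (GL (Fin n) K)) ⊓ H
  have hCB : C ≤ B := le_inf Subgroup.le_normalizer hC.le
  have hidx : (idComp C).relIndex B ≠ 0 := by
    rw [← Subgroup.relIndex_mul_relIndex _ _ _ (idComp_le C) hCB]
    exact mul_ne_zero (relIndex_idComp_ne_zero hC.isClosed) hC.finite_index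
  have himg : Prod.fst '' (T : Set (GL (Fin n) K × GL (Fin n) K)) ⊆ B := by
    rintro _ ⟨⟨h, s⟩, hz, rfl⟩
    obtain ⟨⟨hh, hs⟩, hz⟩ := hT hz
    have hhH : h ∈ H := idComp_le H hh
    exact ⟨mem_normalizer_of_conj_le hC.isClosed (hC.conj_mem hC hg hg hs hs₀ hhH hreg hz), hhH⟩
  -- The first projection of `T` lies in a single coset `bC°`. The second coordinate is recovered
  -- from the first as `g⁻¹h⁻¹(gs₀)h`, so `T` embeds in `C°`.
  obtain ⟨b, hb, hTb⟩ := exists_subset_coset (isClosed_idComp hC.isClosed) hidx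
    (T.isIrreducible.image _ continuous_fst_pairZariski.continuousOn) himg
  have hα : Continuous fun z : GL (Fin n) K × GL (Fin n) K => b⁻¹ * z.1 :=
    (continuous_mul_left_zariski b⁻¹).comp continuous_fst_pairZariski
  have hβ : Continuous fun x : GL (Fin n) K =>
      ((b * x, g⁻¹ * ((b * x)⁻¹ * (g * s₀) * (b * x))) : GL (Fin n) K × GL (Fin n) K) := by
    have hbx : IsRegularMap coord coord fun x : GL (Fin n) K => b * x :=
      (IsRegularMap.const b).mul IsRegularMap.id
    exact (hbx.pair ((IsRegularMap.const g⁻¹).mul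
      ((hbx.inv.mul (IsRegularMap.const (g * s₀))).mul hbx))).continuous isAffineChart_coord
        isAffineChart_pairCoord
  refine zdim_le_of_leftInverse hα hβ (isClosed_idComp hC.isClosed) (fun z hz => ?_)
    (fun z hz => ?_) (fun x _ => ?_)
  · exact hTb ⟨z, hz, rfl⟩
  · have h1 : z.1 * (g * z.2) * z.1⁻¹ = g * s₀ := (hT hz).2
    refine Prod.ext ?_ ?_
    · simp
    · simp only [mul_inv_cancel_left]
      rw [← h1]
      group
  · simp

variable [IsAlgClosed K]

/-- The `H°`-conjugates of `g C°` are dense in `g H°`. -/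
theorem IsCartan.closure_conj {H C : Subgroup (GL (Fin n) K)}
    (hH : IsClosed (H : Set (GL (Fin n) K))) (hC : IsCartan H C) {g : GL (Fin n) K}
    (hg : GeneratesComponents C g) :
    closure ((fun z : GL (Fin n) K × GL (Fin n) K => z.1 * (g * z.2) * z.1⁻¹) ''
      ((idComp H : Set (GL (Fin n) K)) ×ˢ (idComp C : Set (GL (Fin n) K)))) =
      {x | g⁻¹ * x ∈ (idComp H : Set (GL (Fin n) K))} := by
  obtain ⟨P, hP⟩ := hC.diagonalizable.exists_conj hC.closed
  obtain ⟨f, hf, hreg⟩ := exists_regular hC.isClosed (P := P)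
    (fun c => by rw [conjRep_apply]; exact hP c c.2) hg
  obtain ⟨s₀, hs₀, hfs₀⟩ : ∃ s ∈ idComp C, eval (coord s) f ≠ 0 := by
    by_contra! hc
    exact hf hc
  have hgH : g ∈ H := hC.le hg.1
  set X := (idComp H : Set (GL (Fin n) K)) ×ˢ (idComp C : Set (GL (Fin n) K)) with hX
  set Φ := fun z : GL (Fin n) K × GL (Fin n) K => z.1 * (g * z.2) * z.1⁻¹ with hΦ
  have hXc : IsClosed X :=
    isClosed_prod_zariski (isClosed_idComp hH) (isClosed_idComp hC.isClosed)
  have hx₀ : ((1 : GL (Fin n) K), s₀) ∈ X := ⟨(idComp H).one_mem, hs₀⟩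
  obtain ⟨a, ha⟩ := exists_zdim_eq_natCast isAffineChart_coord (isIrreducible_idComp hH)
    (isClosed_idComp hH)
  obtain ⟨b, hb⟩ := exists_zdim_eq_natCast isAffineChart_coord (isIrreducible_idComp hC.isClosed)
    (isClosed_idComp hC.isClosed)
  have h1 : ((a + b : ℕ) : WithBot ℕ∞) ≤ zdimAt ((1 : GL (Fin n) K), s₀) X :=
    add_le_zdimAt_prod (ha ▸ zdim_le_zdimAt _ (idComp H).one_mem)
      (hb ▸ zdim_le_zdimAt _ hs₀)
  have h2 := (isRegularMap_conj g).zdimAt_le isAffineChart_pairCoord isAffineChart_coord hXc hx₀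
  have hΦ₀ : Φ ((1 : GL (Fin n) K), s₀) = g * s₀ := by simp [hΦ]
  have h3 := hC.zdim_fibre_le hg hs₀ (hreg s₀ hs₀ hfs₀)
  -- The source has dimension at least `a + b` at `(1, s₀)` and the fibre there at most `b`, with `a
  -- = dim H°` and `b = dim C°`.
  have h4 : (a : WithBot ℕ∞) ≤ zdim (closure (Φ '' X)) := by
    have h5 : ((a + b : ℕ) : WithBot ℕ∞) ≤ zdim (closure (Φ '' X)) + b := by
      refine h1.trans (h2.trans (add_le_add le_rfl ?_))
      rw [← hb]
      change zdim (X ∩ Φ ⁻¹' {Φ (1, s₀)}) ≤ _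
      rw [hΦ₀]
      exact h3
    rw [Nat.cast_add] at h5
    exact le_of_natCast_add_le_add h5
  have hsub : closure (Φ '' X) ⊆ {x | g⁻¹ * x ∈ (idComp H : Set (GL (Fin n) K))} := by
    refine closure_minimal ?_ (isClosed_mul_left (isClosed_idComp hH) g)
    rintro _ ⟨⟨h, s⟩, ⟨hh, hs⟩, rfl⟩
    have h5 : g⁻¹ * (h * (g * s) * h⁻¹) = (g⁻¹ * h * g⁻¹⁻¹) * s * h⁻¹ := by group
    change g⁻¹ * (h * (g * s) * h⁻¹) ∈ idComp H
    rw [h5]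
    exact (idComp H).mul_mem ((idComp H).mul_mem (conj_mem_idComp hH (H.inv_mem hgH) hh)
      (idComp_mono hC.isClosed hC.le hs)) ((idComp H).inv_mem hh)
  by_contra hne
  -- If the closure were proper, its chain of length `a` could be extended by the irreducible coset
  -- `gH°`, which has dimension at most `a`.
  have h5 := succ_le_zdim (hsub.ssubset_of_ne hne)
    (isIrreducible_mul_left (isIrreducible_idComp hH) g)
    (isClosed_mul_left (isClosed_idComp hH) g) h4
  have h6 := h5.trans (zdim_coset_le (isClosed_idComp hH) g)
  rw [ha] at h6
  have h7 : a + 1 ≤ a := by exact_mod_cast h6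
  omega

/-- A dense open subset of `g H°` consists of conjugates of regular elements of `g C°`. -/
theorem IsCartan.exists_open_conj {H C : Subgroup (GL (Fin n) K)}
    (hH : IsClosed (H : Set (GL (Fin n) K))) (hC : IsCartan H C) {g : GL (Fin n) K}
    (hg : GeneratesComponents C g) :
    ∃ p : MvPolynomial (Coord n) K,
      p ∉ vanIdeal coord {x | g⁻¹ * x ∈ (idComp H : Set (GL (Fin n) K))} ∧
      ∀ y, g⁻¹ * y ∈ idComp H → eval (coord y) p ≠ 0 → ∃ h ∈ idComp H, ∃ s ∈ idComp C,
        h * (g * s) * h⁻¹ = y ∧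
          ∀ z : GL (Fin n) K, Commute z (g * s) → ∀ c ∈ C, Commute z c := by
  obtain ⟨P, hP⟩ := hC.diagonalizable.exists_conj hC.closed
  obtain ⟨f, hf, hreg⟩ := exists_regular hC.isClosed (P := P)
    (fun c => by rw [conjRep_apply]; exact hP c c.2) hg
  have hev : ∀ z : GL (Fin n) K × GL (Fin n) K,
      eval (pairCoord z) (rename Sum.inr f) = eval (coord z.2) f := fun z => by
    rw [eval_rename]
    rfl
  obtain ⟨p, hp, hp'⟩ := (isRegularMap_conj g).exists_open_subset_image isAffineChart_pairCoord
    isAffineChart_coord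
    (isIrreducible_prod_zariski (isIrreducible_idComp hH) (isIrreducible_idComp hC.isClosed))
    (isClosed_prod_zariski (isClosed_idComp hH) (isClosed_idComp hC.isClosed))
    (f := rename Sum.inr f) (fun hc => hf fun s hs => by
      have := hc (1, s) ⟨(idComp H).one_mem, hs⟩
      rwa [hev] at this)
  rw [hC.closure_conj hH hg] at hp hp'
  refine ⟨p, hp, fun y hy hpy => ?_⟩
  obtain ⟨⟨h, s⟩, ⟨hh, hs⟩, hne, rfl⟩ := hp' y hy hpy
  rw [hev] at hne
  exact ⟨h, hh, s, hs, rfl, hreg s hs hne⟩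

/-- Cartan subgroups associated to the same coset of `H°` are conjugate under `H°`. -/
theorem IsCartan.exists_conj {H C C' : Subgroup (GL (Fin n) K)}
    (hH : IsClosed (H : Set (GL (Fin n) K))) (hC : IsCartan H C) (hC' : IsCartan H C')
    {g g' : GL (Fin n) K} (hg : GeneratesComponents C g) (hg' : GeneratesComponents C' g')
    (hgg' : g⁻¹ * g' ∈ idComp H) :
    ∃ t ∈ idComp H, ∀ x, x ∈ C ↔ t * x * t⁻¹ ∈ C' := by
  have hcoset : {x | g'⁻¹ * x ∈ (idComp H : Set (GL (Fin n) K))} =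
      {x | g⁻¹ * x ∈ (idComp H : Set (GL (Fin n) K))} := by
    ext x
    have : g⁻¹ * x = (g⁻¹ * g') * (g'⁻¹ * x) := by group
    simp only [Set.mem_ofPred_eq, SetLike.mem_coe]
    rw [this, (idComp H).mul_mem_cancel_left hgg']
  obtain ⟨p, hp, hp'⟩ := hC.exists_open_conj hH hg
  obtain ⟨q, hq, hq'⟩ := hC'.exists_open_conj hH hg'
  rw [hcoset] at hq
  have hprime := isAffineChart_coord.isPrime_vanIdeal
    (isIrreducible_mul_left (isIrreducible_idComp hH) g)
  have hpq : p * q ∉ vanIdeal coord {x | g⁻¹ * x ∈ (idComp H : Set (GL (Fin n) K))} :=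
    fun h => (hprime.mem_or_mem h).elim hp hq
  -- A point of the coset in both open sets: `h(gs)h⁻¹ = y = h'(g's')h'⁻¹`, so `h'⁻¹h` matches two
  -- regular elements. Regularity on both sides gives both inclusions.
  obtain ⟨y, hy, hpqy⟩ : ∃ y, g⁻¹ * y ∈ idComp H ∧ eval (coord y) (p * q) ≠ 0 := by
    by_contra! hc
    exact hpq hc
  rw [map_mul] at hpqy
  obtain ⟨h, hh, s, hs, hy1, hreg⟩ := hp' y hy (left_ne_zero_of_mul hpqy)
  obtain ⟨h', hh', s', hs', hy2, hreg'⟩ := hq' y ((Set.ext_iff.1 hcoset y).2 hy)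
    (right_ne_zero_of_mul hpqy)
  have ht : h'⁻¹ * h ∈ idComp H := (idComp H).mul_mem ((idComp H).inv_mem hh') hh
  have h1 : (h'⁻¹ * h) * (g * s) * (h'⁻¹ * h)⁻¹ = g' * s' := by
    have : (h'⁻¹ * h) * (g * s) * (h'⁻¹ * h)⁻¹ = h'⁻¹ * (h * (g * s) * h⁻¹) * h' := by group
    rw [this, hy1, ← hy2]
    group
  have h2 : (h'⁻¹ * h)⁻¹ * (g' * s') * (h'⁻¹ * h)⁻¹⁻¹ = g * s := by
    rw [← h1]
    group
  refine ⟨h'⁻¹ * h, ht, fun x => ⟨hC.conj_mem hC' hg hg' hs hs' (idComp_le H ht) hreg' h1 x,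
    fun hx => ?_⟩⟩
  have h3 := hC'.conj_mem hC hg' hg hs' hs (H.inv_mem (idComp_le H ht)) hreg h2 _ hx
  have h4 : (h'⁻¹ * h)⁻¹ * (h'⁻¹ * h * x * (h'⁻¹ * h)⁻¹) * (h'⁻¹ * h)⁻¹⁻¹ = x := by group
  rwa [h4] at h3

end Conjugacy

end CosetWeyl

namespace CosetWeyl

open MvPolynomial
open scoped MatrixGroups

/-! ### Galois action on points and on the identity component -/

section GaloisAction

attribute [local instance] zariski

variable {k K : Type*} [Field k] [Field K] [Algebra k K] {n : ℕ}

theorem galGL_mul_apply (σ τ : K ≃ₐ[k] K) (g : GL (Fin n) K) :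
    galGL (σ * τ) g = galGL σ (galGL τ g) := rfl

theorem galGL_one_apply (g : GL (Fin n) K) : galGL (1 : K ≃ₐ[k] K) g = g := by
  ext i j
  rfl

theorem galGL_apply_inv_apply (σ : K ≃ₐ[k] K) (g : GL (Fin n) K) :
    galGL σ (galGL σ⁻¹ g) = g := by
  rw [← galGL_mul_apply, mul_inv_cancel, galGL_one_apply]

theorem galGL_inv_apply_apply (σ : K ≃ₐ[k] K) (g : GL (Fin n) K) :
    galGL σ⁻¹ (galGL σ g) = g := by
  rw [← galGL_mul_apply, inv_mul_cancel, galGL_one_apply]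

theorem eval_coord_galGL (σ : K ≃ₐ[k] K) (g : GL (Fin n) K) (p : MvPolynomial (Coord n) K) :
    eval (coord (galGL σ g)) (map (σ : K →+* K) p) = σ (eval (coord g) p) := by
  rw [coord_galGL, eval_map]
  exact (eval₂_comp_left (σ : K →+* K) (RingHom.id K) _ p).symm

/-- `galGL σ` is not a regular map over `K`, but the preimage of a zero locus is the zero locus of
the polynomials with `σ⁻¹` applied to their coefficients. -/
theorem continuous_galGL (σ : K ≃ₐ[k] K) :
    Continuous (galGL σ : GL (Fin n) K → GL (Fin n) K) := by
  rw [continuous_iff_isClosed]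
  intro S hS
  rw [isClosed_zariski_iff] at hS ⊢
  obtain ⟨I, rfl⟩ := hS
  refine ⟨map (σ⁻¹ : K ≃ₐ[k] K).toRingEquiv.toRingHom '' I, ?_⟩
  ext g
  simp only [Set.mem_preimage, Set.mem_ofPred_eq, Set.forall_mem_image, aeval_eq_eval]
  refine forall₂_congr fun p _ => ?_
  have h := eval_coord_galGL σ⁻¹ (galGL σ g) p
  rw [galGL_inv_apply_apply] at h
  constructor
  · intro h0
    rw [h0, map_zero] at h
    exact h
  · intro h0
    exact (map_eq_zero_iff _ (σ⁻¹ : K ≃ₐ[k] K).injective).1 (h.symm.trans h0)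

theorem galGL_mem_idComp {H : Subgroup (GL (Fin n) K)}
    (hH : DefinedOver k (H : Set (GL (Fin n) K))) (σ : K ≃ₐ[k] K) {x : GL (Fin n) K}
    (hx : x ∈ idComp H) : galGL σ x ∈ idComp H := by
  have hpre : IsPreconnected (galGL σ '' connectedComponentIn (H : Set (GL (Fin n) K)) 1) :=
    isPreconnected_connectedComponentIn.image _ (continuous_galGL σ).continuousOn
  refine hpre.subset_connectedComponentIn (F := (H : Set (GL (Fin n) K))) (x := 1) ?_ ?_
    ⟨x, hx, rfl⟩
  · exact ⟨1, mem_connectedComponentIn H.one_mem, map_one _⟩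
  · rintro _ ⟨z, hz, rfl⟩
    exact galGL_mem hH σ (connectedComponentIn_subset _ _ hz)

end GaloisAction

/-! ### Compatibility of the Weyl group with Galois action and conjugation -/

section WeylMembership

variable {k K : Type*} [Field k] [Field K] [Algebra k K] {n : ℕ}

/-- An unbundled form: quantifying over every `d` that equals `x⁻¹ * c * x` avoids handling the
normalizer subtype in matrix computations. -/
theorem mem_weyl_iff {H C : Subgroup (GL (Fin n) K)} {f : MulAut (charGroup C)} :
    f ∈ weyl H C ↔ ∃ x ∈ idComp H, (∀ y, y ∈ C ↔ x * y * x⁻¹ ∈ C) ∧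
      ∀ (χ : charGroup C) (c d : C), (d : GL (Fin n) K) = x⁻¹ * c * x →
        (f χ : C →* Kˣ) c = (χ : C →* Kˣ) d := by
  have key : ∀ (x : Subgroup.normalizer (C : Set (GL (Fin n) K))) (χ : charGroup C) (c d : C),
      (d : GL (Fin n) K) = (x : GL (Fin n) K)⁻¹ * c * x →
        (conjAct C x χ : C →* Kˣ) c = (χ : C →* Kˣ) d := by
    intro x χ c d hd
    have : C.normalizerMonoidHom x⁻¹ c = d := by
      refine Subtype.ext (Eq.trans ?_ hd.symm)
      change (x : GL (Fin n) K)⁻¹ * c * ((x : GL (Fin n) K)⁻¹)⁻¹ = _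
      rw [inv_inv]
    rw [← this]
    rfl
  constructor
  · rintro ⟨x, hx, rfl⟩
    exact ⟨x, hx, Subgroup.mem_normalizer_iff.1 x.2, key x⟩
  · rintro ⟨x, hx, hxC, hf⟩
    have hn : x ∈ Subgroup.normalizer (C : Set (GL (Fin n) K)) :=
      Subgroup.mem_normalizer_iff.2 hxC
    refine ⟨⟨x, hn⟩, hx, ?_⟩
    ext1 χ
    refine Subtype.ext (MonoidHom.ext fun c => ?_)
    have hd : x⁻¹ * c * x ∈ C := by
      rw [hxC]
      have : x * (x⁻¹ * (c : GL (Fin n) K) * x) * x⁻¹ = c := by group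
      rw [this]
      exact c.2
    rw [key ⟨x, hn⟩ χ c ⟨_, hd⟩ rfl, hf χ c ⟨_, hd⟩ rfl]

/-- Transport of a character along conjugation by `t`. -/
def transportChar {C C' : Subgroup (GL (Fin n) K)} {t : GL (Fin n) K}
    (ht : ∀ x, x ∈ C ↔ t * x * t⁻¹ ∈ C') (χ : charGroup C') : charGroup C :=
  ⟨(χ : C' →* Kˣ).comp (((MulAut.conj t).toMonoidHom.comp C.subtype).codRestrict C'
      fun c => (ht c).1 c.2), by
    obtain ⟨p, hp⟩ := χ.2
    obtain ⟨q, hq⟩ := exists_translate t t⁻¹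
    refine ⟨bind₁ q p, fun c => (hp _).trans ?_⟩
    change eval (coord (t * (c : GL (Fin n) K) * t⁻¹)) p = _
    rw [hq, ← aeval_eq_eval, ← aeval_eq_eval]
    exact (aeval_bind₁ _ _ _).symm⟩

theorem transportChar_apply {C C' : Subgroup (GL (Fin n) K)} {t : GL (Fin n) K}
    (ht : ∀ x, x ∈ C ↔ t * x * t⁻¹ ∈ C') (χ : charGroup C') (c : C) (d : C')
    (h : (d : GL (Fin n) K) = t * c * t⁻¹) :
    (transportChar ht χ : C →* Kˣ) c = (χ : C' →* Kˣ) d := by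
  have : d = (⟨t * c * t⁻¹, (ht c).1 c.2⟩ : C') := Subtype.ext h
  rw [this]
  rfl

/-- If `t ∈ H°` conjugates `C` to `C'`, the elements of the Galois group acting on `X(C)` through
the Weyl group act on `X(C')` through the Weyl group. -/
theorem comap_weyl_le_of_conj {H C C' : Subgroup (GL (Fin n) K)}
    (hH : DefinedOver k (H : Set (GL (Fin n) K))) (hC : DefinedOver k (C : Set (GL (Fin n) K)))
    (hC' : DefinedOver k (C' : Set (GL (Fin n) K))) {t : GL (Fin n) K} (htH : t ∈ idComp H)
    (ht : ∀ x, x ∈ C ↔ t * x * t⁻¹ ∈ C') :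
    (weyl H C).comap (phi k C hC) ≤ (weyl H C').comap (phi k C' hC') := by
  intro σ hσ
  rw [Subgroup.mem_comap, mem_weyl_iff] at hσ ⊢
  obtain ⟨x, hx, hxC, hf⟩ := hσ
  have hσC : ∀ y, y ∈ C ↔ galGL σ y ∈ C := fun y =>
    ⟨galGL_mem hC σ, fun h => galGL_inv_apply_apply σ y ▸ galGL_mem hC σ⁻¹ h⟩
  have hσC' : ∀ y, y ∈ C' ↔ galGL σ y ∈ C' := fun y =>
    ⟨galGL_mem hC' σ, fun h => galGL_inv_apply_apply σ y ▸ galGL_mem hC' σ⁻¹ h⟩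
  have hσt : ∀ y, y ∈ C ↔ galGL σ t * y * (galGL σ t)⁻¹ ∈ C' := fun y => by
    rw [← galGL_apply_inv_apply σ y, ← hσC, ht, hσC']
    simp only [map_mul, map_inv]
  -- The element travels from `C'` back to `C` by `t⁻¹`, acts by `x`, and returns by `σ(t)`; the
  -- return uses `σ(t)` because `σ` also moves the identification of `C` with `C'`.
  refine ⟨galGL σ t * x * t⁻¹, (idComp H).mul_mem ((idComp H).mul_mem
    (galGL_mem_idComp hH σ htH) hx) ((idComp H).inv_mem htH), fun y => ?_, fun χ c d hd => ?_⟩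
  · have h1 : t * (t⁻¹ * y * t) * t⁻¹ = y := by group
    have h2 : galGL σ t * x * t⁻¹ * y * (galGL σ t * x * t⁻¹)⁻¹ =
        galGL σ t * (x * (t⁻¹ * y * t) * x⁻¹) * (galGL σ t)⁻¹ := by group
    rw [h2, ← hσt, ← hxC, ht, h1]
  · have hc₁ : (galGL σ t)⁻¹ * c * galGL σ t ∈ C := by
      rw [hσt]
      have : galGL σ t * ((galGL σ t)⁻¹ * (c : GL (Fin n) K) * galGL σ t) * (galGL σ t)⁻¹ = c := by
        group
      rw [this]
      exact c.2
    have hd₁ : t⁻¹ * d * t ∈ C := by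
      rw [ht]
      have : t * (t⁻¹ * (d : GL (Fin n) K) * t) * t⁻¹ = d := by group
      rw [this]
      exact d.2
    have h1 := hf (transportChar ht χ) ⟨_, hc₁⟩ ⟨_, hd₁⟩ (by
      change t⁻¹ * (d : GL (Fin n) K) * t = x⁻¹ * ((galGL σ t)⁻¹ * c * galGL σ t) * x
      rw [hd]
      group)
    rw [transportChar_apply ht χ ⟨_, hd₁⟩ d (by simp [mul_assoc])] at h1
    rw [← h1]
    refine Units.ext ?_
    change σ (((χ : C' →* Kˣ) (galPts hC' σ⁻¹ c) : Kˣ) : K) =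
      σ (((transportChar ht χ : C →* Kˣ) (galPts hC σ⁻¹ ⟨_, hc₁⟩) : Kˣ) : K)
    rw [transportChar_apply ht χ _ (galPts hC' σ⁻¹ c)]
    change galGL σ⁻¹ (c : GL (Fin n) K) =
      t * galGL σ⁻¹ ((galGL σ t)⁻¹ * (c : GL (Fin n) K) * galGL σ t) * t⁻¹
    simp only [map_mul, map_inv, galGL_inv_apply_apply]
    group

/-- The Weyl group is normalized by the Galois group. -/
theorem phi_conj_mem_weyl {H C : Subgroup (GL (Fin n) K)}
    (hH : DefinedOver k (H : Set (GL (Fin n) K))) (hC : DefinedOver k (C : Set (GL (Fin n) K)))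
    (σ : K ≃ₐ[k] K) {f : MulAut (charGroup C)} (hf : f ∈ weyl H C) :
    phi k C hC σ * f * (phi k C hC σ)⁻¹ ∈ weyl H C := by
  rw [mem_weyl_iff] at hf ⊢
  obtain ⟨x, hx, hxC, hf⟩ := hf
  have hσC : ∀ y, y ∈ C ↔ galGL σ y ∈ C := fun y =>
    ⟨galGL_mem hC σ, fun h => galGL_inv_apply_apply σ y ▸ galGL_mem hC σ⁻¹ h⟩
  -- Conjugating the action of `x` by `φ_C(σ)` gives the action of `σ(x)`.
  refine ⟨galGL σ x, galGL_mem_idComp hH σ hx, fun y => ?_, fun χ c d hd => ?_⟩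
  · rw [← galGL_apply_inv_apply σ y, ← hσC, hxC, hσC]
    simp only [map_mul, map_inv]
  · rw [← map_inv]
    refine Units.ext ?_
    change σ (((f (phi k C hC σ⁻¹ χ) : C →* Kˣ) (galPts hC σ⁻¹ c) : Kˣ) : K) = _
    rw [hf _ _ (galPts hC σ⁻¹ d) (by
      change galGL σ⁻¹ (d : GL (Fin n) K) = x⁻¹ * galGL σ⁻¹ (c : GL (Fin n) K) * x
      rw [hd]
      simp only [map_mul, map_inv, galGL_inv_apply_apply])]
    change σ (σ⁻¹ (((χ : C →* Kˣ) (galPts hC σ⁻¹⁻¹ (galPts hC σ⁻¹ d)) : Kˣ) : K)) = _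
    have h1 : galPts hC σ⁻¹⁻¹ (galPts hC σ⁻¹ d) = d :=
      Subtype.ext (galGL_inv_apply_apply σ⁻¹ (d : GL (Fin n) K))
    rw [h1]
    exact σ.apply_symm_apply _

theorem normal_comap_weyl {H C : Subgroup (GL (Fin n) K)}
    (hH : DefinedOver k (H : Set (GL (Fin n) K))) (hC : DefinedOver k (C : Set (GL (Fin n) K))) :
    ((weyl H C).comap (phi k C hC)).Normal :=
  ⟨fun τ hτ σ => by
    rw [Subgroup.mem_comap] at hτ ⊢
    rw [map_mul, map_mul, map_inv]
    exact phi_conj_mem_weyl hH hC σ hτ⟩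

end WeylMembership

/-! ### Splitting over a finite extension -/

section SplittingField

variable {k K : Type*} [Field k] [Field K] [Algebra k K] {n : ℕ}

/-- A diagonalizable group is split by a finite extension. -/
theorem IsDiagonalizable.exists_fixingSubgroup_le_ker [IsAlgClosed K] [Algebra.IsAlgebraic k K]
    {C : Subgroup (GL (Fin n) K)} (h : IsDiagonalizable C)
    (hC : DefinedOver k (C : Set (GL (Fin n) K))) :
    ∃ E : IntermediateField k K, FiniteDimensional k E ∧ E.fixingSubgroup ≤ (phi k C hC).ker := by
  obtain ⟨P, hP⟩ := h.exists_conj (hC.extend K)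
  have hP' : ∀ c, (conjRep C P c : Matrix (Fin n) (Fin n) K).IsDiag := fun c => by
    rw [conjRep_apply]
    exact hP c c.2
  choose p hp using fun i => isRegular_conjRep C P i i
  have hε : ∀ i c, ((diagHom (conjRep C P) hP' i c : Kˣ) : K) =
      eval (coord (c : GL (Fin n) K)) (p i) := hp
  -- If `σ` fixes the coefficients of polynomials representing the diagonal entries, it fixes those
  -- characters, hence the group they generate, which contains `X(C)`.
  let S : Set K := ⋃ i, (fun m => (p i).coeff m) '' ((p i).support : Set (Coord n →₀ ℕ))
  have hS : Finite S := (Set.finite_iUnion fun i => (p i).support.finite_toSet.image _).to_subtype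
  refine ⟨IntermediateField.adjoin k S, IntermediateField.finiteDimensional_adjoin
    fun x _ => (Algebra.IsAlgebraic.isAlgebraic x).isIntegral, fun σ hσ => ?_⟩
  have hfix : ∀ i, map (σ : K →+* K) (p i) = p i := fun i => by
    ext m
    rw [coeff_map]
    by_cases hm : m ∈ (p i).support
    · exact hσ ⟨_, IntermediateField.subset_adjoin k _ 
        (Set.mem_iUnion.2 ⟨i, m, hm, rfl⟩)⟩
    · rw [notMem_support_iff.1 hm, map_zero]
  have hfix' : ∀ i c, σ ((diagHom (conjRep C P) hP' i (galPts hC σ⁻¹ c) : Kˣ) : K) =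
      (diagHom (conjRep C P) hP' i c : Kˣ) := fun i c => by
    have h1 : galGL σ (galPts hC σ⁻¹ c : GL (Fin n) K) = c :=
      galGL_apply_inv_apply σ (c : GL (Fin n) K)
    rw [hε, hε, ← eval_coord_galGL, hfix, h1]
  let Φ : (C →* Kˣ) →* (C →* Kˣ) :=
    { toFun := fun χ => (Units.map (σ : K →* K)).comp (χ.comp (galPts hC σ⁻¹))
      map_one' := by
        ext c
        simp
      map_mul' := fun χ ψ => by
        ext c
        simp }
  have hle : Subgroup.closure (Set.range (diagHom (conjRep C P) hP')) ≤
      Φ.eqLocus (MonoidHom.id _) := by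
    rw [Subgroup.closure_le]
    rintro _ ⟨i, rfl⟩
    exact MonoidHom.ext fun c => Units.ext (hfix' i c)
  rw [MonoidHom.mem_ker]
  ext1 χ
  exact Subtype.ext (hle (mem_closure_diagHom hP' χ.2))

end SplittingField

end CosetWeyl

namespace CosetWeyl

/-! ### Factoring homomorphisms and quotients -/

section GroupTheory

variable {G P Q : Type*} [Group G] [Group P] [Group Q]

theorem exists_injective_of_ker_eq {r : G →* Q} (hr : Function.Surjective r) {f : G →* P}
    (h : r.ker = f.ker) : ∃ g : Q →* P, Function.Injective g ∧ ∀ x, g (r x) = f x := by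
  have hg := MonoidHom.liftOfRightInverse_comp_apply r (Function.surjInv hr)
    (Function.rightInverse_surjInv hr) ⟨f, h.le⟩
  refine ⟨_, (injective_iff_map_eq_one _).2 fun y hy => ?_, hg⟩
  obtain ⟨x, rfl⟩ := hr y
  rw [hg] at hy
  exact h.ge hy

/-- If `P` is generated by `W` and the image of a group `G` normalizing `W`, then `P / W` is any
quotient of `G` by the preimage of `W`. -/
theorem exists_surjective_of_ker_eq_comap {f : G →* P} {W : Subgroup P}
    (hW : ∀ x, ∀ w ∈ W, f x * w * (f x)⁻¹ ∈ W) (hsup : W ⊔ f.range = ⊤) {r : G →* Q}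
    (hr : Function.Surjective r) (hker : r.ker = W.comap f) :
    ∃ π : P →* Q, Function.Surjective π ∧ π.ker = W ∧ ∀ x, π (f x) = r x := by
  have hWn : W.Normal := by
    rw [← Subgroup.normalizer_eq_top_iff, eq_top_iff, ← hsup, sup_le_iff]
    refine ⟨Subgroup.le_normalizer, ?_⟩
    rintro _ ⟨x, rfl⟩
    refine Subgroup.mem_normalizer_iff.2 fun w => ⟨hW x w, fun hw => ?_⟩
    have := hW x⁻¹ _ hw
    simpa [mul_assoc] using this
  -- `P` is generated by `W` and the image of `f`, so `G` already surjects onto `P / W`, with kernel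
  -- the preimage of `W`, which is `ker r`.
  have hs : Function.Surjective ((QuotientGroup.mk' W).comp f) := by
    rw [← MonoidHom.range_eq_top, ← MonoidHom.map_range, eq_top_iff,
      ← Subgroup.map_top_of_surjective _ (QuotientGroup.mk'_surjective W), ← hsup,
      Subgroup.map_sup, QuotientGroup.map_mk'_self, bot_sup_eq]
  obtain ⟨g, hg, hgr⟩ := exists_injective_of_ker_eq hs (f := r) (by
    rw [hker, ← MonoidHom.comap_ker, QuotientGroup.ker_mk'])
  refine ⟨g.comp (QuotientGroup.mk' W), fun y => ?_, ?_, hgr⟩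
  · obtain ⟨x, rfl⟩ := hr y
    exact ⟨f x, hgr x⟩
  · rw [← MonoidHom.comap_ker, (MonoidHom.ker_eq_bot_iff g).2 hg, MonoidHom.comap_bot,
      QuotientGroup.ker_mk']

end GroupTheory

/-! ### Open subgroups of the Galois group and finite extensions -/

section FixedField

variable {k K : Type*} [Field k] [Field K] [Algebra k K] [IsGalois k K]

/-- A subgroup containing the group fixing a finite extension corresponds to a finite extension. -/
theorem fixingSubgroup_fixedField_of_le {S : Subgroup (K ≃ₐ[k] K)} {E : IntermediateField k K}
    [FiniteDimensional k E] (h : E.fixingSubgroup ≤ S) :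
    (IntermediateField.fixedField S).fixingSubgroup = S :=
  InfiniteGalois.fixingSubgroup_fixedField
    ⟨S, Subgroup.isClosed_of_isOpen S (Subgroup.isOpen_mono h E.fixingSubgroup_isOpen)⟩

theorem isGalois_and_finiteDimensional_fixedField {S : Subgroup (K ≃ₐ[k] K)} (hS : S.Normal)
    {E : IntermediateField k K} [FiniteDimensional k E] (h : E.fixingSubgroup ≤ S) :
    IsGalois k (IntermediateField.fixedField S) ∧
      FiniteDimensional k (IntermediateField.fixedField S) := by
  refine ((InfiniteGalois.isOpen_and_normal_iff_finite_and_isGalois _).1 ?_).symm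
  rw [fixingSubgroup_fixedField_of_le h]
  exact ⟨Subgroup.isOpen_mono h E.fixingSubgroup_isOpen, hS⟩

end FixedField

/-! ### Independence of the choice of Cartan subgroup -/

section Independence

variable {F K : Type*} [Field F] [Field K] [Algebra F K] [IsAlgClosed K] {n : ℕ}

/-- Both generators lie in `Hi`, so they differ by an element of `H°` and the conjugacy theorem
applies. Exchanging `C` and `C'` gives equality. -/
theorem IsCartanOver.comap_weyl_le {H : Subgroup (GL (Fin n) K)}
    (hH : DefinedOver F (H : Set (GL (Fin n) K))) {Hi : Set (GL (Fin n) K)}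
    (hHi : IsComponent H Hi) {C C' : Subgroup (GL (Fin n) K)} (hC : IsCartanOver F H Hi C)
    (hC' : IsCartanOver F H Hi C') :
    (weyl H C).comap (phi F C hC.definedOver) ≤ (weyl H C').comap (phi F C' hC'.definedOver) := by
  obtain ⟨h, -, rfl⟩ := hHi
  obtain ⟨g, hg, hgC⟩ := hC.generator
  obtain ⟨g', hg', hgC'⟩ := hC'.generator
  obtain ⟨t, ht, htC⟩ := hC.isCartan.exists_conj ((isClosed_zariski_iff _).2 (hH.extend K))
    hC'.isCartan hgC hgC' (by
      have := (idComp H).mul_mem ((idComp H).inv_mem hg) hg'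
      simpa [mul_assoc] using this)
  exact comap_weyl_le_of_conj hH hC.definedOver hC'.definedOver ht htC

end Independence

/-! ### Change of base field and the Galois group of the splitting field -/

section ScalarExtension

variable {F K : Type*} [Field F] [Field K] [Algebra F K] {n : ℕ}

theorem phi_restrictScalars {C : Subgroup (GL (Fin n) K)}
    (hC : DefinedOver F (C : Set (GL (Fin n) K))) (E : IntermediateField F K) (σ : K ≃ₐ[E] K) :
    phi E C (hC.extend E) σ = phi F C hC (σ.restrictScalars F) := rfl

theorem range_phi_le {C : Subgroup (GL (Fin n) K)}
    (hC : DefinedOver F (C : Set (GL (Fin n) K))) (E : IntermediateField F K) :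
    (phi E C (hC.extend E)).range ≤ (phi F C hC).range := by
  rintro _ ⟨σ, rfl⟩
  exact ⟨σ.restrictScalars F, (phi_restrictScalars hC E σ).symm⟩

/-- `PiGroup` is generated by the Weyl group and the image of `φ_C`. The criterion matters because
the Weyl group does not involve the base field, while the image only grows as that field shrinks. -/
theorem surjective_phiPi_iff {H C : Subgroup (GL (Fin n) K)}
    (hC : DefinedOver F (C : Set (GL (Fin n) K))) :
    Function.Surjective (phiPi F H C hC) ↔ weyl H C ≤ (phi F C hC).range := by
  constructor
  · intro h f hf
    obtain ⟨σ, hσ⟩ := h ⟨f, le_sup_left (a := weyl H C) hf⟩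
    exact ⟨σ, congrArg Subtype.val hσ⟩
  · rintro h ⟨f, hf⟩
    obtain ⟨σ, hσ⟩ := sup_le h le_rfl hf
    exact ⟨σ, Subtype.ext hσ⟩

/-- The Galois group of the splitting field over the Weyl field embeds in the Weyl group. -/
theorem exists_injective_gal_weyl [IsGalois F K] {H C : Subgroup (GL (Fin n) K)}
    (hC : DefinedOver F (C : Set (GL (Fin n) K)))
    (hW : (weylField F H C hC).fixingSubgroup = (weyl H C).comap (phi F C hC))
    (hS : (splittingField F C hC).fixingSubgroup = (phi F C hC).ker)
    (h : weylField F H C hC ≤ splittingField F C hC) :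
    ∃ f : (IntermediateField.extendScalars h ≃ₐ[weylField F H C hC]
      IntermediateField.extendScalars h) →* weyl H C, Function.Injective f := by
  let ρ : (K ≃ₐ[weylField F H C hC] K) →* (K ≃ₐ[F] K) := AlgEquiv.restrictScalarsHom F
  -- On automorphisms fixing the Weyl field, `φ_C` takes values in the Weyl group, and its kernel
  -- there fixes exactly the splitting field; the embedding is the induced map on the quotient.
  let θ : (K ≃ₐ[weylField F H C hC] K) →* weyl H C :=
    ((phi F C hC).comp ρ).codRestrict _ fun σ => by
      have : ρ σ ∈ (weylField F H C hC).fixingSubgroup := fun x => σ.commutes x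
      rw [hW] at this
      exact this
  have hθ : (IntermediateField.extendScalars h).fixingSubgroup = θ.ker := by
    ext σ
    have h1 : σ ∈ (IntermediateField.extendScalars h).fixingSubgroup ↔
        ρ σ ∈ (splittingField F C hC).fixingSubgroup := Iff.rfl
    rw [h1, hS, MonoidHom.mem_ker, MonoidHom.mem_ker, ← Subtype.val_inj]
    rfl
  have : IsGalois (weylField F H C hC) (IntermediateField.extendScalars h) := by
    rw [← InfiniteGalois.normal_iff_isGalois, hθ]
    exact θ.normal_ker
  obtain ⟨f, hf, -⟩ := exists_injective_of_ker_eq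
    (AlgEquiv.restrictNormalHom_surjective (F := weylField F H C hC)
      (K₁ := IntermediateField.extendScalars h) K)
    ((IntermediateField.restrictNormalHom_ker _).trans hθ)
  exact ⟨f, hf⟩

end ScalarExtension

/-! ### The two exact sequences -/

section ExactSequences

variable {F K : Type*} [Field F] [Field K] [Algebra F K] [Normal F K] {n : ℕ}
  {H C : Subgroup (GL (Fin n) K)} {L : IntermediateField F K} [Normal F L]

/-- An instance of `exists_surjective_of_ker_eq_comap` for the image of `φ_C` and its intersection
with the Weyl group; restriction to `L` has kernel `φ_C⁻¹(W̃)` by `hL`. -/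
theorem exists_exact_range (hH : DefinedOver F (H : Set (GL (Fin n) K)))
    (hC : DefinedOver F (C : Set (GL (Fin n) K)))
    (hL : L.fixingSubgroup = (weyl H C).comap (phi F C hC)) :
    ∃ π : (phi F C hC).range →* (L ≃ₐ[F] L),
    Function.Surjective π ∧
      π.ker = (weyl H C ⊓ (phi F C hC).range).subgroupOf (phi F C hC).range ∧
      ∀ (σ : K ≃ₐ[F] K) (x : L), ((π ((phi F C hC).rangeRestrict σ) x : L) : K) = σ x := by
  obtain ⟨π, hπ, hπker, hπr⟩ := exists_surjective_of_ker_eq_comap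
    (f := (phi F C hC).rangeRestrict)
    (W := (weyl H C ⊓ (phi F C hC).range).subgroupOf (phi F C hC).range)
    (fun σ w hw => ⟨phi_conj_mem_weyl hH hC σ hw.1,
      SetLike.coe_mem ((phi F C hC).rangeRestrict σ * w * ((phi F C hC).rangeRestrict σ)⁻¹)⟩)
    (by rw [MonoidHom.range_eq_top.2 (MonoidHom.rangeRestrict_surjective _), sup_top_eq])
    (AlgEquiv.restrictNormalHom_surjective (F := F) (K₁ := L) K) (by
      rw [IntermediateField.restrictNormalHom_ker, hL]
      ext σ
      exact ⟨fun h => ⟨h, σ, rfl⟩, fun h => h.1⟩)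
  exact ⟨π, hπ, hπker, fun σ x => by
    rw [hπr]
    exact AlgEquiv.restrictNormalHom_apply _ _ _⟩

theorem exists_exact_PiGroup (hH : DefinedOver F (H : Set (GL (Fin n) K)))
    (hC : DefinedOver F (C : Set (GL (Fin n) K)))
    (hL : L.fixingSubgroup = (weyl H C).comap (phi F C hC)) :
    ∃ π : PiGroup F H C hC →* (L ≃ₐ[F] L),
    Function.Surjective π ∧ π.ker = (weyl H C).subgroupOf (PiGroup F H C hC) ∧
      ∀ (σ : K ≃ₐ[F] K) (x : L), ((π (phiPi F H C hC σ) x : L) : K) = σ x := by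
  obtain ⟨π, hπ, hπker, hπr⟩ := exists_surjective_of_ker_eq_comap
    (f := phiPi F H C hC) (W := (weyl H C).subgroupOf (PiGroup F H C hC))
    (fun σ w hw => phi_conj_mem_weyl hH hC σ hw) (by
      have hrange : (phiPi F H C hC).range = (phi F C hC).range.subgroupOf (PiGroup F H C hC) := by
        ext f
        exact ⟨fun ⟨σ, hσ⟩ => ⟨σ, congrArg Subtype.val hσ⟩, fun ⟨σ, hσ⟩ => ⟨σ, Subtype.ext hσ⟩⟩
      rw [hrange, ← Subgroup.subgroupOf_sup (show weyl H C ≤ PiGroup F H C hC from le_sup_left)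
        (show (phi F C hC).range ≤ PiGroup F H C hC from le_sup_right)]
      exact Subgroup.subgroupOf_self _)
    (AlgEquiv.restrictNormalHom_surjective (F := F) (K₁ := L) K) (by
      rw [IntermediateField.restrictNormalHom_ker, hL]
      rfl)
  exact ⟨π, hπ, hπker, fun σ x => by
    rw [hπr]
    exact AlgEquiv.restrictNormalHom_apply _ _ _⟩

end ExactSequences

end CosetWeyl

open CosetWeyl

/-! ### Assembly of the lemma -/

theorem lemma2p3 {F K : Type*} [Field F] [PerfectField F] [Field K] [Algebra F K]
    [IsAlgClosure F K] {n : ℕ}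
    (H : Subgroup (Matrix.GeneralLinearGroup (Fin n) K))
    (hH : CosetWeyl.DefinedOver F (H : Set (Matrix.GeneralLinearGroup (Fin n) K)))
    (Hi : Set (Matrix.GeneralLinearGroup (Fin n) K)) (hHi : CosetWeyl.IsComponent H Hi)
    (C : Subgroup (Matrix.GeneralLinearGroup (Fin n) K))
    (hC : CosetWeyl.IsCartanOver F H Hi C) :
    -- the field `F_i^W` depends only on the coset
    (∀ (C' : Subgroup (Matrix.GeneralLinearGroup (Fin n) K))
      (hC' : CosetWeyl.IsCartanOver F H Hi C'),
      CosetWeyl.weylField F H C' hC'.definedOver = CosetWeyl.weylField F H C hC.definedOver) ∧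
    -- `F_C` and `F_i^W` are finite Galois extensions of `F`
    (IsGalois F (CosetWeyl.splittingField F C hC.definedOver) ∧
      FiniteDimensional F (CosetWeyl.splittingField F C hC.definedOver)) ∧
    (IsGalois F (CosetWeyl.weylField F H C hC.definedOver) ∧
      FiniteDimensional F (CosetWeyl.weylField F H C hC.definedOver)) ∧
    -- (i)
    (CosetWeyl.cosetSplittingField F H Hi).fixingSubgroup.map
        (CosetWeyl.phi F C hC.definedOver) ≤ CosetWeyl.weyl H C ∧
    CosetWeyl.weylField F H C hC.definedOver ≤ CosetWeyl.cosetSplittingField F H Hi ∧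
    (CosetWeyl.cosetSplittingField F H Hi).fixingSubgroup ≤
      (CosetWeyl.weylField F H C hC.definedOver).fixingSubgroup ∧
    -- (ii)(a)
    (∃ (h : CosetWeyl.weylField F H C hC.definedOver ≤
          CosetWeyl.splittingField F C hC.definedOver)
        (f : (IntermediateField.extendScalars h ≃ₐ[CosetWeyl.weylField F H C hC.definedOver]
          IntermediateField.extendScalars h) →* CosetWeyl.weyl H C),
      Function.Injective f) ∧
    -- (ii)(b), first exact sequence; its second map sends `φ_C(σ)` to the restriction of `σ`
    (∃ π : (CosetWeyl.phi F C hC.definedOver).range →*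
        (CosetWeyl.weylField F H C hC.definedOver ≃ₐ[F]
          CosetWeyl.weylField F H C hC.definedOver),
      Function.Surjective π ∧
      π.ker = (CosetWeyl.weyl H C ⊓ (CosetWeyl.phi F C hC.definedOver).range).subgroupOf
        (CosetWeyl.phi F C hC.definedOver).range ∧
      ∀ (σ : K ≃ₐ[F] K) (x : CosetWeyl.weylField F H C hC.definedOver),
        ((π ((CosetWeyl.phi F C hC.definedOver).rangeRestrict σ) x :
          CosetWeyl.weylField F H C hC.definedOver) : K) = σ x) ∧
    -- (ii)(b), second exact sequence; its second map sends `φ_C(σ)` to the restriction of `σ`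
    (∃ π : CosetWeyl.PiGroup F H C hC.definedOver →*
        (CosetWeyl.weylField F H C hC.definedOver ≃ₐ[F]
          CosetWeyl.weylField F H C hC.definedOver),
      Function.Surjective π ∧
      π.ker = (CosetWeyl.weyl H C).subgroupOf (CosetWeyl.PiGroup F H C hC.definedOver) ∧
      ∀ (σ : K ≃ₐ[F] K) (x : CosetWeyl.weylField F H C hC.definedOver),
        ((π (CosetWeyl.phiPi F H C hC.definedOver σ) x :
          CosetWeyl.weylField F H C hC.definedOver) : K) = σ x) ∧
    -- (iii)
    (∀ E : IntermediateField F K, FiniteDimensional F E →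
      CosetWeyl.PiGroup E H C (hC.definedOver.extend E) ≤
        CosetWeyl.PiGroup F H C hC.definedOver) ∧
    -- (iv)
    ((∃ E : IntermediateField F K, FiniteDimensional F E ∧
        Function.Surjective (CosetWeyl.phiPi E H C (hC.definedOver.extend E))) →
      Function.Surjective (CosetWeyl.phiPi F H C hC.definedOver)) := by

  have : IsAlgClosed K := IsAlgClosure.isAlgClosed F
  have : Algebra.IsAlgebraic F K := IsAlgClosure.isAlgebraic
  have : Normal F K := IsAlgClosure.normal F K
  -- Separability of `K` over `F` comes from `F` being perfect.
  have : IsGalois F K := ⟨⟩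
  have hle : ∀ C' (hC' : IsCartanOver F H Hi C'), (phi F C' hC'.definedOver).ker ≤
      (weyl H C').comap (phi F C' hC'.definedOver) := fun C' hC' =>
    (phi F C' hC'.definedOver).ker_le_comap (weyl H C')
  have hcomap : ∀ C' (hC' : IsCartanOver F H Hi C'),
      (weyl H C').comap (phi F C' hC'.definedOver) = (weyl H C).comap (phi F C hC.definedOver) :=
    fun C' hC' => le_antisymm (hC'.comap_weyl_le hH hHi hC) (hC.comap_weyl_le hH hHi hC')
  have hindep : ∀ C' (hC' : IsCartanOver F H Hi C'),
      weylField F H C' hC'.definedOver = weylField F H C hC.definedOver := fun C' hC' =>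
    congrArg IntermediateField.fixedField (hcomap C' hC')
  have hWS : ∀ C' (hC' : IsCartanOver F H Hi C'),
      weylField F H C' hC'.definedOver ≤ splittingField F C' hC'.definedOver := fun C' hC' =>
    IntermediateField.fixedField_antitone (hle C' hC')
  obtain ⟨E, hE, hEker⟩ := hC.isCartan.diagonalizable.exists_fixingSubgroup_le_ker hC.definedOver
  have hEW := hEker.trans (hle C hC)
  have hfixW : (weylField F H C hC.definedOver).fixingSubgroup =
      (weyl H C).comap (phi F C hC.definedOver) := fixingSubgroup_fixedField_of_le hEW
  have hfixS : (splittingField F C hC.definedOver).fixingSubgroup =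
      (phi F C hC.definedOver).ker := fixingSubgroup_fixedField_of_le hEker
  have hnormal := normal_comap_weyl (H := H) hH hC.definedOver
  have hWgal := isGalois_and_finiteDimensional_fixedField hnormal hEW
  -- Independence of the choice is essential here: the Weyl field of `C` is that of each `C'`, hence
  -- lies in every splitting field.
  have hWcos : weylField F H C hC.definedOver ≤ cosetSplittingField F H Hi :=
    le_iInf fun C' => hindep C'.1 C'.2 ▸ hWS C'.1 C'.2
  have hcosfix := IntermediateField.fixingSubgroup_antitone hWcos
  have : IsGalois F (weylField F H C hC.definedOver) := hWgal.1
  refine ⟨hindep, isGalois_and_finiteDimensional_fixedField (MonoidHom.normal_ker _) hEker, hWgal,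
    ?_, hWcos, hcosfix, ⟨hWS C hC, exists_injective_gal_weyl hC.definedOver hfixW hfixS _⟩,
    ?_, ?_, fun E' _ => sup_le_sup_left (range_phi_le hC.definedOver E') _, ?_⟩
  -- The preimage of the Weyl group is the whole group fixing `F_i^W`, so the claim about `φ_C` is
  -- the inclusion of fields read through the Galois correspondence.
  · rw [Subgroup.map_le_iff_le_comap, ← hfixW]
    exact hcosfix
  · exact exists_exact_range hH hC.definedOver hfixW
  · exact exists_exact_PiGroup hH hC.definedOver hfixW
  · rintro ⟨E', -, hE'⟩
    rw [surjective_phiPi_iff] at hE' ⊢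
    exact hE'.trans (range_phi_le hC.definedOver E')
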